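/- Fix a path loss exponent $\alpha>2$, a decoding threshold $T>0$, a link length $r>0$, a density $\lambda>0$, a transmit power $P_{\rm tx}>0$, a noise variance $\sigma^2>0$, an arrival rate $0<\xi\le 1$ and a (deterministic) measurable observation window $S\subset\mathbb R^2$; put $\rho=P_{\rm tx}/\sigma^2$ and $\delta=2/\alpha$. *Network.* Transmitters $X_1,X_2,\dots$ form a homogeneous Poisson point process of density $\lambda$ in the plane, and transmitter $j$ has a receiver $y_j$ at distance $r$ in an independent uniform direction. In addition there is a typical link of length $r$ with receiver at the origin. *Policy.* A transmitter that observes, besides its own receiver, receivers at distances $l_i$ accesses the channel with probability $\eta$, where, with $D_i=l_i^\alpha/(Tr^\alpha)$ and $V=\int_{\mathbb R^2\setminus S}\frac{\lambda\,dz}{1+\|z\|^\alpha/(Tr^\alpha)}$, $\eta\in(0,1)$ is the unique solution of $\frac1\eta-\sum_i\frac1{1+D_i-\eta}-V=0$ if $\sum_i\frac1{D_i}+V>1$, and $\eta=1$ otherwise. For $d>0$ let $\mathcal Z(d)$ be the mean of the access probability of a transmitter at the origin that observes those receivers of the above Poisson network that lie in $S$ and, in addition, the typical receiver at distance $l$,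 where $d=l^\alpha/(Tr^\alpha)$; that is, $\mathcal Z(d)$ is the probability that an interferer at distance $l$ from the typical receiver is scheduled when its queue is non-empty. *Mean-field dynamics.* Interferer $j$ carries a transmission success probability $\mu_j$; the $\mu_j$ are i.i.d. and independent of the locations. Given locations and success probabilities, the queue of interferer $j$ is empty at time $0$ and in each slot receives a packet with probability $\xi$; if it is non-empty, the transmitter is scheduled with the access probability prescribed by the policy (the typical receiver being observed at its actual distance, the rest of the local environment of $j$ being an independent copy of the Poisson network in each slot); if it is scheduled, its head-of-line packet is delivered and removed with probability $\mu_j$. All these choices are independent over slots and interferers. With $\zeta_{j,t},\nu_{j,t}\in\{0,1\}$ the indicators of a non-empty queue and of a positive scheduling decision, and with independent mean-one exponential fadings, let $$\mathrm{SINR}_{0,t}=\frac{P_{\rm tx}H_{00,t}\,r^{-\alpha}}{\sum_{j}P_{\rm tx}H_{j0,t}\,\zeta_{j,t}\nu_{j,t}\|X_j\|^{-\alpha}+\sigma^2},$$ let $\mu_{0,t}$ be the conditional probability of $\mathrm{SINR}_{0,t}>T$ given the $X_j$ and $\mu_j$, and let $\mu_0=\lim_{t\to\infty}\mu_{0,t}$.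 Assume the mean-field consistency that each $\mu_j$ has the same law as $\mu_0$, and let $F_\mu$ be the CDF of $\mu_0$. **Theorem.** The limit $\mu_0$ exists almost surely, and for every $u>0$ $$F_\mu(u)=\frac12-\int_0^\infty \mathrm{Im}\Big\{u^{-j\omega}\exp\Big(-\frac{j\omega Tr^\alpha}{\rho}-\lambda\pi r^2T^\delta\sum_{k=1}^\infty\binom{j\omega}{k}\int_0^\infty\frac{(-1)^{k+1}}{(1+v^{\alpha/2})^k}\Big[\mathcal Z(v^{\alpha/2})^kF_\mu\Big(\frac{\xi}{\mathcal Z(v^{\alpha/2})}\Big)+\int_{\xi/\mathcal Z(v^{\alpha/2})}^1\frac{\xi^k}{t^k}F_\mu(dt)\Big]dv\Big)\Big\}\frac{d\omega}{\pi\omega},$$ where in this formula $j=\sqrt{-1}$, the innermost integral is $0$ if its lower limit exceeds $1$, the series converges absolutely, and the integrals over $v$ and over $\omega$ converge absolutely. -/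

import Mathlib

open MeasureTheory ProbabilityTheory Filter Topology Set

noncomputable section

/-- The Euclidean plane. -/
abbrev Plane : Type := EuclideanSpace ℝ (Fin 2)

/-- The uniform random numbers used below take values in `[0,1]`, with Lebesgue measure. -/
abbrev UnitI : Type := unitInterval

/-- The physical parameters of the network: path loss exponent `α`, decoding threshold `T`, link
length `r`, spatial density `lam`, transmit power `Ptx`, thermal noise variance `noiseVar`, and
packet arrival rate `ξ` (packets per slot). -/
structure NetworkParams where
  α : ℝ
  T : ℝ
  r : ℝ
  lam : ℝ
  Ptx : ℝ
  noiseVar : ℝ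
  ξ : ℝ
  two_lt_α : 2 < α
  T_pos : 0 < T
  r_pos : 0 < r
  lam_pos : 0 < lam
  Ptx_pos : 0 < Ptx
  noiseVar_pos : 0 < noiseVar
  ξ_pos : 0 < ξ
  ξ_le_one : ξ ≤ 1

namespace NetworkParams

/-- `ρ = Ptx / σ²`. -/
def ρ (p : NetworkParams) : ℝ := p.Ptx / p.noiseVar

/-- `δ = 2 / α`. -/
def δ (p : NetworkParams) : ℝ := 2 / p.α

/-- The relative path loss `𝒟 = ‖x‖^α / (T r^α)` over the displacement `x`. -/
def relLoss (p : NetworkParams) (x : Plane) : ℝ := ‖x‖ ^ p.α / (p.T * p.r ^ p.α)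

end NetworkParams

/-! ### Poisson point processes -/

/-- The number of points of the configuration `x` that lie in `B`. -/
def pointCount (x : ℕ → Plane) (B : Set Plane) : ℕ∞ := {n | x n ∈ B}.encard

/-- The random points `X 0, X 1, …` form (in some enumeration) a homogeneous Poisson point process
of density `lam` on the plane. -/
structure IsPoissonProcess {Ω : Type*} [MeasurableSpace Ω] (P : Measure Ω) (lam : ℝ)
    (X : ℕ → Ω → Plane) : Prop where
  measurable : ∀ n, Measurable (X n)
  count_law : ∀ B : Set Plane, MeasurableSet B → volume B < ⊤ → ∀ k : ℕ,
    P {ω | pointCount (fun n => X n ω) B = k}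
      = poissonMeasure (lam * (volume B).toReal).toNNReal {k}
  count_indep : ∀ (n : ℕ) (B : Fin n → Set Plane), (∀ i, MeasurableSet (B i)) →
    Pairwise (fun i j => Disjoint (B i) (B j)) →
    iIndepFun (fun i ω => pointCount (fun n => X n ω) (B i)) P

/-! ### The locally adaptive scheduling policy -/

/-- The channel access probability of a transmitter whose observed receivers (other than its own)
have the relative path losses `D i`, and whose mean interference to the unobserved region is `V`:
the solution `η` of `1/η - ∑ 1/(1 + D i - η) - V = 0` if `∑ 1/(D i) + V > 1`, and `1` otherwise.
The left-hand side is strictly decreasing in `η`, so the set below has at most one element. -/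
def accessProb {ι : Type} (D : ι → ℝ) (V : ℝ) : ℝ :=
  open Classical in
  if 1 < ∑' i, 1 / D i + V then
    sSup {η : ℝ | 0 < η ∧ η < 1 ∧ 1 / η - ∑' i, 1 / (1 + D i - η) - V = 0}
  else 1

/-- A configuration of links: the positions of the transmitters and the orientations (angles) of
the segments that lead to their receivers. -/
abbrev LinkConfig : Type := (ℕ → Plane) × (ℕ → ℝ)

namespace NetworkParams

/-- The position of the `j`-th receiver, at distance `r` from its transmitter. -/
def receiver (p : NetworkParams) (c : LinkConfig) (j : ℕ) : Plane :=
  c.1 j + p.r • !₂[Real.cos (c.2 j), Real.sin (c.2 j)]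

/-- `∫_{ℝ² ∖ S} lam dz / (1 + ‖z‖^α / (T r^α))`. -/
def unobserved (p : NetworkParams) (S : Set Plane) : ℝ :=
  ∫ z in Sᶜ, p.lam / (1 + p.relLoss z)

/-- The channel access probability, with observation window `S`, of a transmitter located at the
origin, when `c` is the configuration of the other links with the typical link left out, and the
typical receiver is an additional observed receiver whose relative path loss is `d`. -/
def policy (p : NetworkParams) (S : Set Plane) (c : LinkConfig) (d : ℝ) : ℝ :=
  accessProb
    (fun o : Option {j : ℕ // p.receiver c j ∈ S} =>
      o.elim d (fun j => p.relLoss (p.receiver c j)))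
    (p.unobserved S)

/-- The function `𝒵`: the probability that a transmitter is scheduled for channel access, given
that the relative path loss between it and the typical receiver is `d`. Here `envLaw` is the law of
the configuration of the other links. -/
def schedZ (p : NetworkParams) (S : Set Plane) (envLaw : Measure LinkConfig) (d : ℝ) : ℝ :=
  ∫ c, p.policy S c d ∂envLaw

/-! ### Queues and SINR at the typical link, given the locations and the service rates -/

/-- The randomness that remains when the interferers' locations and transmission success
probabilities are given. Index `(j, t)` refers to interferer `j` in slot `t`. -/
structure Noise where
  /-- fading on the typical link, per slot -/
  H₀ : ℕ → ℝ
  /-- fading from the interferers to the typical receiver -/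
  H : ℕ × ℕ → ℝ
  /-- a packet arrives at `j` in slot `t` iff this number is at most `ξ` -/
  arr : ℕ × ℕ → UnitI
  /-- the local environment that determines the channel access probability -/
  env : ℕ × ℕ → LinkConfig
  /-- access is granted iff this number is at most the access probability -/
  sched : ℕ × ℕ → UnitI
  /-- an attempted transmission of `j` succeeds iff this number is at most its success probability -/
  succ : ℕ × ℕ → UnitI

/-- The noise built from a point of the corresponding product space. -/
def Noise.ofProd (n : (ℕ → ℝ) × (ℕ × ℕ → ℝ) × (ℕ × ℕ → UnitI) × (ℕ × ℕ → LinkConfig) ×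
    (ℕ × ℕ → UnitI) × (ℕ × ℕ → UnitI)) : Noise :=
  ⟨n.1, n.2.1, n.2.2.1, n.2.2.2.1, n.2.2.2.2.1, n.2.2.2.2.2⟩

/-- All the components of the noise are independent: the fadings are exponential with mean one, the
environments have law `envLaw`, the other numbers are uniform. -/
def noiseLaw (envLaw : Measure LinkConfig) :
    Measure ((ℕ → ℝ) × (ℕ × ℕ → ℝ) × (ℕ × ℕ → UnitI) × (ℕ × ℕ → LinkConfig) ×
      (ℕ × ℕ → UnitI) × (ℕ × ℕ → UnitI)) :=
  (Measure.infinitePi fun _ => expMeasure 1).prod <|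
  (Measure.infinitePi fun _ => expMeasure 1).prod <|
  (Measure.infinitePi fun _ => volume).prod <|
  (Measure.infinitePi fun _ => envLaw).prod <|
  (Measure.infinitePi fun _ => volume).prod <|
  Measure.infinitePi fun _ => volume

/-- The scheduling decision `ν_{j,t}` of the interferer `j`, located at `x j` (the typical receiver
is at the origin). -/
def IsScheduled (p : NetworkParams) (S : Set Plane) (x : ℕ → Plane) (n : Noise) (j t : ℕ) : Prop :=
  (n.sched (j, t) : ℝ) ≤ p.policy S (n.env (j, t)) (p.relLoss (x j))

open Classical in
/-- The number of packets in the queue of interferer `j` at the beginning of slot `t`. In each slot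
the head-of-line packet leaves if the transmitter is scheduled and its transmission succeeds, which
has probability `m j`; a new packet arrives with probability `ξ`. -/
def queue (p : NetworkParams) (S : Set Plane) (x : ℕ → Plane) (m : ℕ → ℝ) (n : Noise) (j : ℕ) :
    ℕ → ℕ
  | 0 => 0
  | t + 1 => queue p S x m n j t
      - (if 0 < queue p S x m n j t ∧ IsScheduled p S x n j t ∧ (n.succ (j, t) : ℝ) ≤ m j
          then 1 else 0)
      + (if (n.arr (j, t) : ℝ) ≤ p.ξ then 1 else 0)

open Classical in
/-- The SINR at the typical receiver in slot `t`, when the tagged transmitter sends a packet. -/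
def SINR (p : NetworkParams) (S : Set Plane) (x : ℕ → Plane) (m : ℕ → ℝ) (n : Noise) (t : ℕ) : ℝ :=
  p.Ptx * n.H₀ t * p.r ^ (-p.α) /
    ((∑' j, p.Ptx * n.H (j, t) * (if 0 < queue p S x m n j t then 1 else 0)
        * (if IsScheduled p S x n j t then 1 else 0) * ‖x j‖ ^ (-p.α)) + p.noiseVar)

/-- `μ_{0,t}`: the transmission success probability of the typical link in slot `t`, conditioned on
the locations `x` and the success probabilities `m` of the interferers. -/
def successProbAt (p : NetworkParams) (S : Set Plane) (envLaw : Measure LinkConfig)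
    (x : ℕ → Plane) (m : ℕ → ℝ) (t : ℕ) : ℝ :=
  (noiseLaw envLaw).real {n | p.T < SINR p S x m (Noise.ofProd n) t}

/-- `μ_0 = lim_t μ_{0,t}`: the conditional transmission success probability in steady state. -/
def successProb (p : NetworkParams) (S : Set Plane) (envLaw : Measure LinkConfig)
    (x : ℕ → Plane) (m : ℕ → ℝ) : ℝ :=
  limUnder atTop (successProbAt p S envLaw x m)

end NetworkParams

/-- The law of the random link configuration with transmitters `X j` and orientations `θ j`. -/
def configLaw {Ω : Type*} [MeasurableSpace Ω] (P : Measure Ω) (X : ℕ → Ω → Plane)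
    (θ : ℕ → Ω → ℝ) : Measure LinkConfig :=
  P.map fun ω => (fun j => X j ω, fun j => θ j ω)

/-- The conditional transmission success probability `μ_0` of the typical link, as a random
variable: interferers at `X j` with transmission success probabilities `m j`. -/
def typicalSuccess {Ω : Type*} [MeasurableSpace Ω] (P : Measure Ω) (p : NetworkParams)
    (S : Set Plane) (X : ℕ → Ω → Plane) (θ m : ℕ → Ω → ℝ) (ω : Ω) : ℝ :=
  p.successProb S (configLaw P X θ) (fun j => X j ω) (fun j => m j ω)

/-- The mean-field Poisson bipolar network. The transmitters form a Poisson process, the receivers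
are placed in independent uniform directions, and the transmission success probabilities of the
links are independent of the geometry seen from the typical link and i.i.d., with the same law as
that of the typical link. -/
structure MeanFieldNetwork {Ω : Type*} [MeasurableSpace Ω] (P : Measure Ω) (p : NetworkParams)
    (S : Set Plane) (X : ℕ → Ω → Plane) (θ m : ℕ → Ω → ℝ) : Prop where
  poisson : IsPoissonProcess P p.lam X
  measurable_angle : ∀ j, Measurable (θ j)
  angle_law : ∀ j, P.map (θ j) = ProbabilityTheory.cond volume (Ico 0 (2 * Real.pi))
  angle_indep : iIndepFun θ P
  angle_indep_loc : IndepFun (fun ω j => X j ω) (fun ω j => θ j ω) P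
  rate_indep : iIndepFun m P
  rate_indep_config :
    IndepFun (fun ω => ((fun j => X j ω, fun j => θ j ω) : LinkConfig)) (fun ω j => m j ω) P
  rate_law : ∀ j, IdentDistrib (m j) (typicalSuccess P p S X θ m) P P

/-! ### The functional equation -/

namespace NetworkParams

/-- `Z^k F(ξ/Z) + ∫_{ξ/Z}^1 (ξ^k / t^k) F(dt)`, with `Z` the number `z`. -/
def activityMoment (p : NetworkParams) (F : StieltjesFunction ℝ) (z : ℝ) (k : ℕ) : ℝ :=
  z ^ k * F (p.ξ / z) + ∫ t in Ioc (p.ξ / z) 1, p.ξ ^ k / t ^ k ∂F.measure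

/-- The integrand in `v` of the `k`-th term of the series in the exponent. -/
def seriesIntegrand (p : NetworkParams) (Z : ℝ → ℝ) (F : StieltjesFunction ℝ) (k : ℕ) (v : ℝ) : ℝ :=
  (-1) ^ (k + 1) / (1 + v ^ (p.α / 2)) ^ k * p.activityMoment F (Z (v ^ (p.α / 2))) k

/-- The `k`-th term of the series in the exponent, at the frequency `w`. -/
def seriesTerm (p : NetworkParams) (Z : ℝ → ℝ) (F : StieltjesFunction ℝ) (w : ℝ) (k : ℕ) : ℂ :=
  Ring.choose (Complex.I * w) k * ((∫ v in Ioi 0, p.seriesIntegrand Z F k v : ℝ) : ℂ)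

/-- The exponential factor, with the series over `k ≥ 1`. -/
def expFactor (p : NetworkParams) (Z : ℝ → ℝ) (F : StieltjesFunction ℝ) (w : ℝ) : ℂ :=
  Complex.exp (-(Complex.I * w * ((p.T * p.r ^ p.α / p.ρ : ℝ) : ℂ))
    - ((p.lam * Real.pi * p.r ^ 2 * p.T ^ p.δ : ℝ) : ℂ) * ∑' k : ℕ, p.seriesTerm Z F w (k + 1))

/-- The integrand in the frequency `w`: `Im {u^{-jw} exp(…)} / (π w)`. -/
def inversionIntegrand (p : NetworkParams) (Z : ℝ → ℝ) (F : StieltjesFunction ℝ) (u w : ℝ) : ℝ :=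
  ((u : ℂ) ^ (-(Complex.I * w)) * p.expFactor Z F w).im / (Real.pi * w)

end NetworkParams

end

/-! ### Gil-Pelaez inversion for an integrable characteristic function. -/

section CdfInversion

/-! Condition on the locations and rates of the interferers. The fading of the typical link is
exponential, so the success probability in slot t is the Laplace transform of the normalized noise
plus interference, and it factors over the interferers because these are driven by independent
noise. The queue length of an interferer in a slot is independent of its fading and scheduling in
that slot, so its factor is 1 - P(busy) Z / (1 + d), with d the relative path loss and Z the mean
access probability (`integral_exp_neg_rowLoss`, `successProbAt_eq`). Since the environment is
redrawn in every slot, the queue is a birth-death chain with arrival probability ξ and service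
probability s = Z μ; started empty, its busy probability increases to 1 if s ≤ ξ and to ξ / s
otherwise (`tendsto_queueTail_one`). Dominated convergence in the sum of logarithms then gives the
limit μ₀, with log μ₀ equal to minus the noise exponent plus the sum of log (1 - a_j), where a_j is
the limiting activity discounted by path loss (`tendsto_successProbAt`).

Thus log μ₀ is a sum over a Poisson process with independent marks. Integrating out the marks and
applying the probability generating functional to the mean of (1 - a)^(iw) yields its characteristic
function (`tendsto_integral_prod`, `charFun_log_typicalSuccess`). By consistency the marks have the
law of μ₀ itself, which closes the equation. Polar coordinates, the binomial series of (1 - a)^(iw)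
and the moments of a, split according to whether the queue is saturated, give the exponent in the
stated form (`hasSum_choose_mul_integral`, `integral_activity_pow`, `expFactor_eq`).

Inversion needs an integrable characteristic function and a first moment. Interferers with d of
order w contribute phases of order one, and their number grows like w^δ, so the characteristic
function decays like exp (-c w^δ) (`le_integral_re_meanDefect`, `integrableOn_expFactor`). The first
moment, like the other exchanges of sums and integrals over the plane, comes from the majorant log
(1 + 1/d) of |log (1 - a)|, which is integrable over the plane because α > 2
(`integrableOn_log_one_add_inv`, `abs_log_one_sub_le`). -/

lemma integrableOn_exp_neg_mul {ε : ℝ} (hε : 0 < ε) :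
    IntegrableOn (fun w : ℝ => Real.exp (-ε * w)) (Ioi 0) :=
  integrableOn_exp_mul_Ioi (by linarith) 0

/-- The Laplace transform of the cosine. -/
lemma integral_exp_neg_mul_cos {ε : ℝ} (hε : 0 < ε) (x : ℝ) :
    ∫ w in Ioi (0 : ℝ), Real.exp (-ε * w) * Real.cos (w * x) = ε / (ε ^ 2 + x ^ 2) := by
  have ha : ((-ε : ℂ) + x * Complex.I).re < 0 := by simp [hε]
  have h := integral_exp_mul_complex_Ioi ha 0
  have hi := integrableOn_exp_mul_complex_Ioi ha 0
  have h2 := congrArg Complex.re h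
  have h3 := integral_re (𝕜 := ℂ) hi
  simp only [RCLike.re_eq_complex_re] at h3
  rw [← h3] at h2
  have e : ∀ w : ℝ, (Complex.exp (((-ε : ℂ) + x * Complex.I) * w)).re
      = Real.exp (-ε * w) * Real.cos (w * x) := by
    intro w
    rw [Complex.exp_re]
    simp [mul_comm]
  simp only [e] at h2
  rw [h2]
  have hp : 0 < ε ^ 2 + x ^ 2 := by positivity
  simp [Complex.div_re, Complex.normSq_apply]
  field_simp

lemma abs_exp_neg_mul_sin_div_le {ε w : ℝ} (hw : 0 < w) (x : ℝ) :
    |Real.exp (-ε * w) * (Real.sin (w * x) / w)| ≤ Real.exp (-ε * w) * |x| := by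
  rw [abs_mul, abs_of_pos (Real.exp_pos _), abs_div, abs_of_pos hw]
  gcongr
  rw [div_le_iff₀ hw]
  calc |Real.sin (w * x)| ≤ |w * x| := Real.abs_sin_le_abs
    _ = |x| * w := by rw [abs_mul, abs_of_pos hw, mul_comm]

lemma integrableOn_exp_neg_mul_sin_div {ε : ℝ} (hε : 0 < ε) (x : ℝ) :
    IntegrableOn (fun w : ℝ => Real.exp (-ε * w) * (Real.sin (w * x) / w)) (Ioi 0) := by
  refine ((integrableOn_exp_neg_mul hε).mul_const |x|).mono' ?_ ?_
  · exact Measurable.aestronglyMeasurable (by fun_prop)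
  · filter_upwards [ae_restrict_mem measurableSet_Ioi] with w hw
    exact abs_exp_neg_mul_sin_div_le hw x

/-- The damped Dirichlet integral. -/
lemma integral_exp_neg_mul_sin_div {ε : ℝ} (hε : 0 < ε) (x : ℝ) :
    ∫ w in Ioi (0 : ℝ), Real.exp (-ε * w) * (Real.sin (w * x) / w) = Real.arctan (x / ε) := by
  -- Differentiating under the integral cancels the division by w and leaves the Laplace transform
  -- of the cosine, which is also the derivative of arctan (y / ε). The difference is therefore
  -- constant, and it vanishes at 0.
  have hd : ∀ y : ℝ, HasDerivAt
      (fun y => (∫ w in Ioi (0 : ℝ), Real.exp (-ε * w) * (Real.sin (w * y) / w))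
        - Real.arctan (y / ε)) 0 y := by
    intro y
    have h1 := hasDerivAt_integral_of_dominated_loc_of_deriv_le (μ := volume.restrict (Ioi (0 : ℝ)))
      (F := fun y w => Real.exp (-ε * w) * (Real.sin (w * y) / w))
      (F' := fun y w => Real.exp (-ε * w) * Real.cos (w * y))
      (x₀ := y) (s := univ) (bound := fun w => Real.exp (-ε * w)) univ_mem
      (Eventually.of_forall fun z => Measurable.aestronglyMeasurable (by fun_prop))
      (integrableOn_exp_neg_mul_sin_div hε y) (Measurable.aestronglyMeasurable (by fun_prop))
      (Eventually.of_forall fun w z _ => by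
        rw [norm_mul, Real.norm_of_nonneg (Real.exp_pos _).le]
        exact mul_le_of_le_one_right (Real.exp_pos _).le (Real.abs_cos_le_one _))
      (integrableOn_exp_neg_mul hε)
      (by
        filter_upwards [ae_restrict_mem measurableSet_Ioi] with w hw z _
        have hw' : w ≠ 0 := ne_of_gt hw
        have := (((Real.hasDerivAt_sin (w * z)).comp z
          ((hasDerivAt_id z).const_mul w)).div_const w).const_mul (Real.exp (-ε * w))
        refine this.congr_deriv ?_
        simp only [mul_one]
        field_simp)
    have h2 := ((hasDerivAt_id y).div_const ε).arctan
    refine (h1.2.sub h2).congr_deriv ?_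
    rw [integral_exp_neg_mul_cos hε]
    simp only [id]
    have : 0 < ε ^ 2 + y ^ 2 := by positivity
    field_simp
    ring
  have hc := is_const_of_deriv_eq_zero (fun y => (hd y).differentiableAt) (fun y => (hd y).deriv) x 0
  simp only [mul_zero, Real.sin_zero, zero_div, integral_zero, Real.arctan_zero, sub_zero] at hc
  linarith

variable (ν : Measure ℝ) [IsProbabilityMeasure ν] (φ : ℝ → ℂ)
  (hφ : ∀ w, φ w = ∫ x, Complex.exp (Complex.I * (w * x)) ∂ν)

include hφ in
-- The shift turns the transform into the mean of an exponential of modulus one, so real and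
-- imaginary parts pass inside the integral. The cosine form serves the estimate of atoms, the sine
-- form the inversion.
lemma charFun_shift_re_im (y w : ℝ) :
    (Complex.exp (-(Complex.I * w * y)) * φ w).re = ∫ x, Real.cos (w * (x - y)) ∂ν ∧
    (Complex.exp (-(Complex.I * w * y)) * φ w).im = ∫ x, Real.sin (w * (x - y)) ∂ν := by
  have hi : Integrable (fun x : ℝ => Complex.exp ((w * (x - y) : ℝ) * Complex.I)) ν := by
    refine (integrable_const (1 : ℝ)).mono' (Measurable.aestronglyMeasurable (by fun_prop)) ?_
    exact Eventually.of_forall fun x => (Complex.norm_exp_ofReal_mul_I _).le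
  have e : Complex.exp (-(Complex.I * w * y)) * φ w
      = ∫ x, Complex.exp ((w * (x - y) : ℝ) * Complex.I) ∂ν := by
    rw [hφ, ← integral_const_mul]
    congr 1; ext x
    rw [← Complex.exp_add]
    congr 1; push_cast; ring
  constructor
  · rw [e, ← RCLike.re_eq_complex_re, ← integral_re hi]
    congr 1; ext x
    exact Complex.exp_ofReal_mul_I_re _
  · rw [e, ← RCLike.im_eq_complex_im, ← integral_im hi]
    congr 1; ext x
    exact Complex.exp_ofReal_mul_I_im _

include hφ in
-- The kernel ε² / (ε² + (x - y)²) dominates the indicator of y. Written as a damped cosine integral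
-- and integrated against ν, it is at most ε times the L¹ norm of φ, which tends to 0 with ε.
lemma measure_singleton_eq_zero_of_integrable_charFun (hφi : IntegrableOn φ (Ioi 0)) (y : ℝ) :
    ν.real {y} = 0 := by
  have key : ∀ ε : ℝ, 0 < ε → ν.real {y} ≤ ε * ∫ w in Ioi (0 : ℝ), ‖φ w‖ := by
    intro ε hε
    have hprod : Integrable (Function.uncurry fun (x w : ℝ) =>
        Real.exp (-ε * w) * Real.cos (w * (x - y))) (ν.prod (volume.restrict (Ioi 0))) := by
      refine ((integrable_const (1 : ℝ)).mul_prod (integrableOn_exp_neg_mul hε)).mono'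
        (Measurable.aestronglyMeasurable (by fun_prop)) (Eventually.of_forall fun z => ?_)
      simp only [Function.uncurry, norm_mul, one_mul]
      rw [Real.norm_of_nonneg (Real.exp_pos _).le]
      exact mul_le_of_le_one_right (Real.exp_pos _).le (Real.abs_cos_le_one _)
    have hi1 : Integrable (fun x => ε / (ε ^ 2 + (x - y) ^ 2)) ν := by
      have := hprod.integral_prod_left
      simpa only [Function.uncurry, integral_exp_neg_mul_cos hε] using this
    have h1 : ν.real {y} ≤ ε * ∫ x, ε / (ε ^ 2 + (x - y) ^ 2) ∂ν := by
      rw [← integral_const_mul, ← integral_indicator_one (measurableSet_singleton y)]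
      refine integral_mono ((integrable_const (1 : ℝ)).indicator (measurableSet_singleton y))
        (hi1.const_mul ε) fun x => ?_
      by_cases hx : x = y
      · subst hx
        simp
        field_simp
        exact le_rfl
      · simp only [mem_singleton_iff, hx, not_false_eq_true, indicator_of_notMem]
        positivity
    have h2 : ∫ x, ε / (ε ^ 2 + (x - y) ^ 2) ∂ν
        = ∫ w in Ioi (0 : ℝ), Real.exp (-ε * w) * (Complex.exp (-(Complex.I * w * y)) * φ w).re := by
      simp only [(charFun_shift_re_im ν φ hφ y _).1, ← integral_const_mul,
        ← integral_exp_neg_mul_cos hε]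
      exact integral_integral_swap hprod
    have h3 : ∫ w in Ioi (0 : ℝ), Real.exp (-ε * w) * (Complex.exp (-(Complex.I * w * y)) * φ w).re
        ≤ ∫ w in Ioi (0 : ℝ), ‖φ w‖ := by
      have hn : ∀ w : ℝ, ‖Complex.exp (-(Complex.I * w * y)) * φ w‖ = ‖φ w‖ := by
        intro w
        rw [norm_mul, Complex.norm_exp]; simp
      have hle : ∀ w : ℝ, 0 < w → ∀ a : ℝ, a ≤ ‖φ w‖ → Real.exp (-ε * w) * a ≤ ‖φ w‖ := by
        intro w hw a ha
        refine (mul_le_mul_of_nonneg_left ha (Real.exp_pos _).le).trans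
          (mul_le_of_le_one_left (norm_nonneg _) ?_)
        rw [Real.exp_le_one_iff]
        have : 0 < ε * w := mul_pos hε hw
        linarith
      refine integral_mono_ae ?_ hφi.norm ?_
      · refine hφi.norm.mono' ((Measurable.aestronglyMeasurable (by fun_prop)).mul
          (Complex.continuous_re.comp_aestronglyMeasurable ((Measurable.aestronglyMeasurable
            (by fun_prop)).mul hφi.aestronglyMeasurable))) ?_
        filter_upwards [ae_restrict_mem measurableSet_Ioi] with w hw
        rw [norm_mul, Real.norm_of_nonneg (Real.exp_pos _).le, Real.norm_eq_abs]
        exact hle w hw _ ((Complex.abs_re_le_norm _).trans (hn w).le)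
      filter_upwards [ae_restrict_mem measurableSet_Ioi] with w hw
      exact hle w hw _ ((Complex.re_le_norm _).trans (hn w).le)
    rw [h2] at h1
    exact h1.trans (by gcongr)
  have hlim : Tendsto (fun ε : ℝ => ε * ∫ w in Ioi (0 : ℝ), ‖φ w‖) (𝓝[>] 0) (𝓝 0) := by
    have : Tendsto (fun ε : ℝ => ε * ∫ w in Ioi (0 : ℝ), ‖φ w‖) (𝓝 0) (𝓝 (0 * _)) :=
      tendsto_id.mul_const _
    rw [zero_mul] at this
    exact this.mono_left nhdsWithin_le_nhds
  refine le_antisymm (ge_of_tendsto hlim ?_) measureReal_nonneg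
  filter_upwards [self_mem_nhdsWithin] with ε hε using key ε hε

include hφ in
/-- Gil-Pelaez inversion of an integrable characteristic function. -/
theorem cdf_inversion (hint : Integrable (fun x : ℝ => x) ν) (hφi : IntegrableOn φ (Ioi 0))
    (y : ℝ) :
    IntegrableOn (fun w : ℝ => (Complex.exp (-(Complex.I * w * y)) * φ w).im / (Real.pi * w))
      (Ioi 0) ∧
    ν.real (Iic y) = 1 / 2 - ∫ w in Ioi (0 : ℝ),
      (Complex.exp (-(Complex.I * w * y)) * φ w).im / (Real.pi * w) := by
  set s : ℝ → ℝ := fun w => (Complex.exp (-(Complex.I * w * y)) * φ w).im with hs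
  have hxy : Integrable (fun x : ℝ => |x - y|) ν := (hint.sub (integrable_const y)).abs
  have hs1 : ∀ w, s w = ∫ x, Real.sin (w * (x - y)) ∂ν := fun w =>
    (charFun_shift_re_im ν φ hφ y w).2
  have hsb : ∀ w, |s w| ≤ ‖φ w‖ := by
    intro w
    have hn : ‖Complex.exp (-(Complex.I * w * y)) * φ w‖ = ‖φ w‖ := by
      rw [norm_mul, Complex.norm_exp]; simp
    rw [← hn]; exact Complex.abs_im_le_norm _
  -- The first moment keeps s w / w bounded near 0, where integrability of φ does not control the
  -- quotient.
  have hsb2 : ∀ w, 0 < w → |s w| ≤ w * ∫ x, |x - y| ∂ν := by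
    intro w hw
    rw [hs1, ← integral_const_mul]
    refine (abs_integral_le_integral_abs).trans (integral_mono_of_nonneg
      (Eventually.of_forall fun _ => abs_nonneg _) (hxy.const_mul w)
      (Eventually.of_forall fun x => ?_))
    calc |Real.sin (w * (x - y))| ≤ |w * (x - y)| := Real.abs_sin_le_abs
      _ = w * |x - y| := by rw [abs_mul, abs_of_pos hw]
  have hsm : AEStronglyMeasurable s (volume.restrict (Ioi 0)) := by
    have : AEStronglyMeasurable (fun w : ℝ => Complex.exp (-(Complex.I * w * y)) * φ w)
        (volume.restrict (Ioi 0)) :=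
      (Measurable.aestronglyMeasurable (by fun_prop)).mul hφi.aestronglyMeasurable
    exact Complex.continuous_im.comp_aestronglyMeasurable this
  have hsi : IntegrableOn (fun w => s w / w) (Ioi 0) := by
    have hb : IntegrableOn (fun w => (Ioc (0 : ℝ) 1).indicator (fun _ => ∫ x, |x - y| ∂ν) w + ‖φ w‖)
        (Ioi 0) := by
      refine Integrable.add ?_ hφi.norm
      refine Integrable.restrict ?_
      rw [integrable_indicator_iff measurableSet_Ioc]
      simp
    refine hb.mono' (hsm.aemeasurable.div measurable_id.aemeasurable).aestronglyMeasurable ?_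
    filter_upwards [ae_restrict_mem measurableSet_Ioi] with w hw
    have hw : 0 < w := hw
    rw [Real.norm_eq_abs, abs_div, abs_of_pos hw, div_le_iff₀ hw]
    by_cases h1 : w ≤ 1
    · rw [indicator_of_mem (by exact ⟨hw, h1⟩)]
      refine (hsb2 w hw).trans ?_
      nlinarith [norm_nonneg (φ w)]
    · rw [indicator_of_notMem (by exact fun h => h1 h.2)]
      refine (hsb w).trans ?_
      nlinarith [norm_nonneg (φ w)]
  -- Abel damping: the exponential factor makes the double integral absolutely convergent, so Fubini
  -- applies before the damping is removed.
  have hdamp : ∀ n : ℕ, ∫ w in Ioi (0 : ℝ), Real.exp (-(1 / ((n : ℝ) + 1)) * w) * (s w / w)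
      = ∫ x, Real.arctan ((x - y) * (n + 1)) ∂ν := by
    intro n
    have hε : (0 : ℝ) < 1 / ((n : ℝ) + 1) := by positivity
    have hprod : Integrable (Function.uncurry fun (x w : ℝ) =>
        Real.exp (-(1 / ((n : ℝ) + 1)) * w) * (Real.sin (w * (x - y)) / w))
          (ν.prod (volume.restrict (Ioi 0))) := by
      refine (hxy.mul_prod (integrableOn_exp_neg_mul hε)).mono'
        (Measurable.aestronglyMeasurable (by fun_prop)) ?_
      have : ∀ᵐ z ∂(ν.prod (volume.restrict (Ioi (0 : ℝ)))), z.2 ∈ Ioi (0 : ℝ) :=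
        Measure.quasiMeasurePreserving_snd.ae (ae_restrict_mem measurableSet_Ioi)
      filter_upwards [this] with z hz
      simp only [Function.uncurry]
      rw [mul_comm |z.1 - y|]
      exact abs_exp_neg_mul_sin_div_le hz _
    have hsw := integral_integral_swap hprod
    have e : ∀ x : ℝ, Real.arctan ((x - y) * (n + 1)) = ∫ w in Ioi (0 : ℝ),
        Real.exp (-(1 / ((n : ℝ) + 1)) * w) * (Real.sin (w * (x - y)) / w) := by
      intro x
      rw [integral_exp_neg_mul_sin_div hε]
      congr 1
      field_simp
    simp only [e, hs1]
    rw [hsw]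
    congr 1; ext w
    rw [integral_const_mul, integral_div]
  have hL : Tendsto (fun n : ℕ => ∫ w in Ioi (0 : ℝ),
      Real.exp (-(1 / ((n : ℝ) + 1)) * w) * (s w / w)) atTop
      (𝓝 (∫ w in Ioi (0 : ℝ), s w / w)) := by
    refine tendsto_integral_of_dominated_convergence (fun w => ‖s w / w‖) (fun n => ?_) hsi.norm
      (fun n => ?_) (Eventually.of_forall fun w => ?_)
    · exact (Measurable.aestronglyMeasurable (by fun_prop)).mul hsi.aestronglyMeasurable
    · filter_upwards [ae_restrict_mem measurableSet_Ioi] with w hw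
      rw [norm_mul, Real.norm_of_nonneg (Real.exp_pos _).le]
      refine mul_le_of_le_one_left (norm_nonneg _) ?_
      rw [Real.exp_le_one_iff, neg_mul, neg_nonpos]
      exact mul_nonneg (by positivity) (le_of_lt hw)
    · have h0 : Tendsto (fun n : ℕ => Real.exp (-(1 / ((n : ℝ) + 1)) * w)) atTop
          (𝓝 (Real.exp (-0 * w))) :=
        (Real.continuous_exp.tendsto _).comp
          ((tendsto_one_div_add_atTop_nhds_zero_nat.neg).mul_const w)
      simpa using h0.mul_const (s w / w)
  have hR : Tendsto (fun n : ℕ => ∫ x, Real.arctan ((x - y) * (n + 1)) ∂ν) atTop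
      (𝓝 (∫ x, (Real.pi / 2) * (1 - 2 * (Iic y).indicator 1 x) ∂ν)) := by
    refine tendsto_integral_of_dominated_convergence (fun _ => Real.pi / 2)
      (fun n => Measurable.aestronglyMeasurable (by fun_prop)) (integrable_const _)
      (fun n => Eventually.of_forall fun x => ?_) ?_
    · exact abs_le.2 ⟨(Real.neg_pi_div_two_lt_arctan _).le, (Real.arctan_lt_pi_div_two _).le⟩
    -- The arctangents tend to ±π/2 except at x = y, where they are 0; since y is not an atom, the
    -- limit depends only on which side of y the point lies.
    · have hne : ∀ᵐ x ∂ν, x ≠ y := by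
        rw [ae_iff]
        simp only [ne_eq, not_not, Set.ofPred_eq_eq_singleton]
        have := measure_singleton_eq_zero_of_integrable_charFun ν φ hφ hφi y
        rwa [measureReal_eq_zero_iff] at this
      have hn : Tendsto (fun n : ℕ => (n : ℝ) + 1) atTop atTop :=
        tendsto_atTop_add_const_right _ _ tendsto_natCast_atTop_atTop
      filter_upwards [hne] with x hx
      rcases lt_or_gt_of_ne hx with h | h
      · rw [indicator_of_mem (by exact h.le)]
        have := tendsto_nhds_of_tendsto_nhdsWithin
          (Real.tendsto_arctan_atBot.comp (hn.const_mul_atTop_of_neg (sub_neg.2 h)))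
        rw [Pi.one_apply, show Real.pi / 2 * (1 - 2 * (1 : ℝ)) = -(Real.pi / 2) by ring]
        exact this
      · rw [indicator_of_notMem (by simpa using h)]
        have := tendsto_nhds_of_tendsto_nhdsWithin
          (Real.tendsto_arctan_atTop.comp (hn.const_mul_atTop (sub_pos.2 h)))
        rw [show Real.pi / 2 * (1 - 2 * (0 : ℝ)) = Real.pi / 2 by ring]
        exact this
  have heq : ∫ w in Ioi (0 : ℝ), s w / w = (Real.pi / 2) * (1 - 2 * ν.real (Iic y)) := by
    simp only [hdamp] at hL
    have hi : Integrable ((Iic y).indicator (1 : ℝ → ℝ)) ν :=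
      (integrable_const (1 : ℝ)).indicator measurableSet_Iic
    rw [tendsto_nhds_unique hL hR, integral_const_mul, integral_sub (integrable_const _)
      (hi.const_mul 2), integral_const_mul, integral_indicator_one measurableSet_Iic]
    simp
  have hdiv : ∀ w, s w / (Real.pi * w) = (s w / w) / Real.pi := fun w => by
    rw [div_div, mul_comm]
  refine ⟨?_, ?_⟩
  · exact (hsi.div_const _).congr (Eventually.of_forall fun w => (hdiv w).symm)
  · rw [integral_congr_ae (Eventually.of_forall hdiv), integral_div, heq]
    field_simp [Real.pi_ne_zero]
    ring

end CdfInversion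

/-! ### Poisson processes: intensity measure and probability generating functional. -/

section PoissonProcess

/-- The first moment of the Poisson distribution. -/
lemma lintegral_poissonMeasure_natCast (r : NNReal) :
    ∫⁻ n, (n : ENNReal) ∂(poissonMeasure r) = r := by
  have hs := (hasSum_one_poissonMeasure r).mul_left (r : ℝ)
  rw [lintegral_countable']
  rw [tsum_eq_zero_add' ENNReal.summable]
  have e : ∀ n : ℕ, ((n + 1 : ℕ) : ENNReal) * poissonMeasure r {n + 1}
      = ENNReal.ofReal ((r : ℝ) * (Real.exp (-r) * r ^ n / n.factorial)) := by
    intro n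
    rw [poissonMeasure_singleton, ← ENNReal.ofReal_natCast, ← ENNReal.ofReal_mul (by positivity)]
    congr 1
    rw [Nat.factorial_succ]
    push_cast
    field_simp
    try ring
  simp only [e]
  rw [← ENNReal.ofReal_tsum_of_nonneg (fun n => by positivity) hs.summable, hs.tsum_eq]
  simp

/-- The probability generating function of the Poisson distribution. -/
lemma integral_poissonMeasure_pow (r : NNReal) (c : ℂ) :
    ∫ n, c ^ n ∂(poissonMeasure r) = Complex.exp (-(r * (1 - c))) := by
  rw [integral_poissonMeasure]
  have h := (NormedSpace.expSeries_div_hasSum_exp (r * c : ℂ)).mul_left (Complex.exp (-r))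
  have e : Complex.exp (-(r * (1 - c))) = Complex.exp (-r) * NormedSpace.exp (r * c : ℂ) := by
    rw [← Complex.exp_eq_exp_ℂ, ← Complex.exp_add]; congr 1; ring
  rw [e, ← h.tsum_eq]
  congr 1; ext n
  rw [Complex.real_smul]
  push_cast
  rw [mul_pow]
  ring

/-- Telescoping: exchanging one factor at a time costs only the difference of the two factors, since
the remaining ones have modulus at most one. The bound involves no constant that grows with the
number of factors. -/
lemma norm_prod_sub_prod_le {ι : Type*} (s : Finset ι) (a b : ι → ℂ) (ha : ∀ i, ‖a i‖ ≤ 1)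
    (hb : ∀ i, ‖b i‖ ≤ 1) : ‖∏ i ∈ s, a i - ∏ i ∈ s, b i‖ ≤ ∑ i ∈ s, ‖a i - b i‖ := by
  classical
  induction s using Finset.induction_on with
  | empty => simp
  | insert i s hi ih =>
    rw [Finset.prod_insert hi, Finset.prod_insert hi, Finset.sum_insert hi]
    have hp : ‖∏ i ∈ s, b i‖ ≤ 1 := by
      rw [norm_prod]; exact Finset.prod_le_one (fun _ _ => norm_nonneg _) fun i _ => hb i
    calc ‖a i * ∏ i ∈ s, a i - b i * ∏ i ∈ s, b i‖
        = ‖a i * (∏ i ∈ s, a i - ∏ i ∈ s, b i) + (a i - b i) * ∏ i ∈ s, b i‖ := by congr 1; ring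
      _ ≤ ‖a i‖ * ‖∏ i ∈ s, a i - ∏ i ∈ s, b i‖ + ‖a i - b i‖ * ‖∏ i ∈ s, b i‖ := by
          refine (norm_add_le _ _).trans ?_
          rw [norm_mul, norm_mul]
      _ ≤ 1 * ‖∏ i ∈ s, a i - ∏ i ∈ s, b i‖ + ‖a i - b i‖ * 1 := by
          gcongr; exact ha i
      _ ≤ _ := by linarith

variable {Ω : Type*} [MeasurableSpace Ω] {P : Measure Ω} [IsProbabilityMeasure P] {lam : ℝ}
  {X : ℕ → Ω → Plane}

lemma pointCount_toENNReal (x : ℕ → Plane) (B : Set Plane) :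
    ((pointCount x B : ℕ∞) : ENNReal) = ∑' n, B.indicator 1 (x n) := by
  rw [pointCount, ← ENNReal.tsum_set_one, tsum_subtype {n | x n ∈ B} fun _ => (1 : ENNReal)]
  rfl

namespace IsPoissonProcess

omit [IsProbabilityMeasure P] in
lemma measurable_count (hX : IsPoissonProcess P lam X) {B : Set Plane} (hB : MeasurableSet B) :
    Measurable fun ω => pointCount (fun n => X n ω) B := by
  have h : Measurable fun ω => ((pointCount (fun n => X n ω) B : ℕ∞) : ENNReal) := by
    simp only [pointCount_toENNReal]
    exact Measurable.tsum fun n => (measurable_one.indicator hB).comp (hX.measurable n)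
  refine measurable_to_countable' fun k => ?_
  have : (fun ω => pointCount (fun n => X n ω) B) ⁻¹' {k}
      = (fun ω => ((pointCount (fun n => X n ω) B : ℕ∞) : ENNReal)) ⁻¹' {(k : ENNReal)} := by
    ext ω; simp
  rw [this]
  exact h (measurableSet_singleton _)

/-- Only the atoms at finite counts are prescribed. They already have total mass one, so the Poisson
law lies below the law of the count, and ordered measures of equal finite mass coincide; nothing is
left for an infinite count. -/
lemma map_count (hX : IsPoissonProcess P lam X) {B : Set Plane} (hB : MeasurableSet B)
    (hv : volume B < ⊤) :
    P.map (fun ω => pointCount (fun n => X n ω) B)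
      = (poissonMeasure (lam * (volume B).toReal).toNNReal).map (Nat.cast : ℕ → ℕ∞) := by
  have hm := hX.measurable_count hB
  have : IsProbabilityMeasure (P.map fun ω => pointCount (fun n => X n ω) B) :=
    Measure.isProbabilityMeasure_map hm.aemeasurable
  have hc : Measurable (Nat.cast : ℕ → ℕ∞) := measurable_from_nat
  have hk : ∀ k : ℕ, P.map (fun ω => pointCount (fun n => X n ω) B) {(k : ℕ∞)}
      = poissonMeasure (lam * (volume B).toReal).toNNReal {k} := by
    intro k
    rw [Measure.map_apply hm (measurableSet_singleton _)]
    exact hX.count_law B hB hv k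
  have hle : (poissonMeasure (lam * (volume B).toReal).toNNReal).map (Nat.cast : ℕ → ℕ∞)
      ≤ P.map (fun ω => pointCount (fun n => X n ω) B) := by
    refine Measure.le_iff.2 fun s hs => ?_
    rw [Measure.map_apply hc hs, ← Measure.tsum_indicator_apply_singleton _ _ (hc hs)]
    have h2 : P.map (fun ω => pointCount (fun n => X n ω) B) (Nat.cast '' (Nat.cast ⁻¹' s : Set ℕ))
        = ∑' k : ℕ, (Nat.cast ⁻¹' s : Set ℕ).indicator
          (fun k => poissonMeasure (lam * (volume B).toReal).toNNReal {k}) k := by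
      have : (Nat.cast '' (Nat.cast ⁻¹' s : Set ℕ) : Set ℕ∞)
          = ⋃ k : (Nat.cast ⁻¹' s : Set ℕ), {((k : ℕ) : ℕ∞)} := by
        ext; simp [eq_comm]
      rw [this, measure_iUnion (fun i j hij => by
          simp only [Function.onFun, disjoint_singleton, ne_eq, Nat.cast_inj]
          exact fun h => hij (Subtype.ext h)) fun _ => measurableSet_singleton _]
      simp only [hk]
      exact tsum_subtype (Nat.cast ⁻¹' s : Set ℕ)
        fun k => poissonMeasure (lam * (volume B).toReal).toNNReal {k}
    rw [← h2]
    exact measure_mono (image_preimage_subset _ _)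
  have : IsProbabilityMeasure
      ((poissonMeasure (lam * (volume B).toReal).toNNReal).map (Nat.cast : ℕ → ℕ∞)) :=
    Measure.isProbabilityMeasure_map hc.aemeasurable
  exact (Measure.eq_of_le_of_measure_univ_eq hle (by simp)).symm

lemma count_ne_top (hX : IsPoissonProcess P lam X) {B : Set Plane} (hB : MeasurableSet B)
    (hv : volume B < ⊤) : ∀ᵐ ω ∂P, pointCount (fun n => X n ω) B ≠ ⊤ := by
  have hm := hX.measurable_count hB
  refine ae_of_ae_map (p := fun k : ℕ∞ => k ≠ ⊤) hm.aemeasurable ?_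
  rw [hX.map_count hB hv, ae_map_iff measurable_from_nat.aemeasurable MeasurableSet.of_discrete]
  exact Eventually.of_forall fun k => ENat.natCast_ne_top k

/-- The intensity measure of the process. -/
lemma sum_map (hlam : 0 ≤ lam) (hX : IsPoissonProcess P lam X) :
    Measure.sum (fun n => P.map (X n)) = ENNReal.ofReal lam • (volume : Measure Plane) := by
  have key : ∀ B : Set Plane, MeasurableSet B → volume B < ⊤ →
      Measure.sum (fun n => P.map (X n)) B = ENNReal.ofReal lam * volume B := by
    intro B hB hv
    have hm := hX.measurable_count hB
    have h1 : Measure.sum (fun n => P.map (X n)) B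
        = ∫⁻ ω, ((pointCount (fun n => X n ω) B : ℕ∞) : ENNReal) ∂P := by
      simp only [pointCount_toENNReal]
      rw [lintegral_tsum (f := fun n ω => B.indicator 1 (X n ω)) fun n =>
        ((measurable_one.indicator hB).comp (hX.measurable n)).aemeasurable, Measure.sum_apply _ hB]
      congr 1; ext n
      rw [← lintegral_map (measurable_one.indicator hB) (hX.measurable n), lintegral_indicator_one hB]
    rw [h1, ← lintegral_map (f := fun k : ℕ∞ => (k : ENNReal)) (measurable_from_top) hm,
      hX.map_count hB hv, lintegral_map measurable_from_top measurable_from_nat]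
    simp only [ENat.toENNReal_coe]
    rw [lintegral_poissonMeasure_natCast]
    rw [← ENNReal.ofReal, ENNReal.ofReal_mul hlam, ENNReal.ofReal_toReal hv.ne]
  -- Counts are prescribed only on sets of finite area; these form a generating π-system and include
  -- the balls that exhaust the plane.
  refine Measure.ext_of_generateFrom_of_iUnion {B | MeasurableSet B ∧ volume B < ⊤}
    (fun n => Metric.ball 0 n) ?_ ?_ (Metric.iUnion_ball_nat 0) ?_ ?_ ?_
  · refine le_antisymm ?_ (MeasurableSpace.generateFrom_le fun s hs => hs.1)
    intro s hs
    have : s = ⋃ n : ℕ, s ∩ Metric.ball 0 n := by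
      rw [← inter_iUnion, Metric.iUnion_ball_nat, inter_univ]
    rw [this]
    refine MeasurableSet.iUnion fun n => MeasurableSpace.measurableSet_generateFrom
      ⟨hs.inter measurableSet_ball, (measure_mono inter_subset_right).trans_lt measure_ball_lt_top⟩
  · rintro s ⟨hs, hs'⟩ t ⟨ht, -⟩ -
    exact ⟨hs.inter ht, (measure_mono inter_subset_left).trans_lt hs'⟩
  · exact fun n => ⟨measurableSet_ball, measure_ball_lt_top⟩
  · intro n
    rw [key _ measurableSet_ball measure_ball_lt_top]
    exact ENNReal.mul_ne_top ENNReal.ofReal_ne_top measure_ball_lt_top.ne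
  · rintro s ⟨hs, hs'⟩
    rw [key s hs hs', Measure.smul_apply, smul_eq_mul]

/-- Campbell's formula. -/
theorem lintegral_tsum_eq (hlam : 0 ≤ lam) (hX : IsPoissonProcess P lam X) {g : Plane → ENNReal}
    (hg : Measurable g) :
    ∑' n, ∫⁻ ω, g (X n ω) ∂P = ENNReal.ofReal lam * ∫⁻ z, g z := by
  rw [← smul_eq_mul, ← lintegral_smul_measure, ← hX.sum_map hlam, lintegral_sum_measure]
  congr 1; ext n
  rw [lintegral_map hg (hX.measurable n)]

lemma tendsto_prod_ite_of_count_ne_top (x : ℕ → Plane) (B : Set Plane) (c : ℂ)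
    [DecidablePred (· ∈ B)] (h : pointCount x B ≠ ⊤) :
    Tendsto (fun n => ∏ j ∈ Finset.range n, if x j ∈ B then c else 1) atTop
      (𝓝 (c ^ (pointCount x B).toNat)) := by
  have hf : {n | x n ∈ B}.Finite := by
    rw [pointCount, encard_ne_top_iff] at h; exact h
  obtain ⟨N, hN⟩ := hf.bddAbove
  refine tendsto_const_nhds.congr' ?_
  filter_upwards [eventually_gt_atTop N] with n hn
  rw [← Finset.prod_filter, Finset.prod_const]
  congr 1
  rw [pointCount, ← ncard_def, ← ncard_coe_finset]
  congr 1
  ext j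
  simp only [Finset.coe_filter, Finset.mem_range, mem_ofPred_eq]
  exact ⟨fun hj => ⟨(hN hj).trans_lt hn, hj⟩, fun hj => hj.2⟩

/-- Grouping the points by level sets turns the product into finitely many powers of 1 - v, whose
exponents are independent Poisson counts; each generating function contributes one term of the
integral of `g` to the exponent. The level 0 is left out: its area is infinite, but it contributes
only factors 1. -/
lemma tendsto_integral_prod_simpleFunc (hlam : 0 ≤ lam) (hX : IsPoissonProcess P lam X)
    (g : SimpleFunc Plane ℂ) (hg : Integrable g volume) (hg1 : ∀ z, ‖1 - g z‖ ≤ 1) :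
    Tendsto (fun n => ∫ ω, ∏ j ∈ Finset.range n, (1 - g (X j ω)) ∂P) atTop
      (𝓝 (Complex.exp (-(lam * ∫ z, g z)))) := by
  classical
  set s : Finset ℂ := g.range.filter (· ≠ 0) with hs
  let e : Fin s.card ≃ s := s.equivFin.symm
  have hfin : ∀ v : s, volume (g ⁻¹' {(v : ℂ)}) < ⊤ := fun v =>
    SimpleFunc.measure_preimage_lt_top_of_integrable g hg (Finset.mem_filter.1 v.2).2
  have hms : ∀ v : ℂ, MeasurableSet (g ⁻¹' {v}) := fun v => g.measurableSet_fiber v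
  have hv1 : ∀ v : s, ‖1 - (v : ℂ)‖ ≤ 1 := by
    intro v
    obtain ⟨z, hz⟩ := SimpleFunc.mem_range.1 (Finset.mem_filter.1 v.2).1
    rw [← hz]; exact hg1 z
  have hprod : ∀ z, 1 - g z = ∏ v : s, if z ∈ g ⁻¹' {(v : ℂ)} then 1 - (v : ℂ) else 1 := by
    intro z
    by_cases hz : g z = 0
    · rw [Finset.prod_eq_one]
      · simp [hz]
      · intro v _
        have := (Finset.mem_filter.1 v.2).2
        rw [if_neg]
        simp only [mem_preimage, mem_singleton_iff, hz]
        exact fun h => this h.symm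
    · have hz' : g z ∈ s := Finset.mem_filter.2 ⟨g.mem_range_self z, hz⟩
      rw [Finset.prod_eq_single ⟨g z, hz'⟩]
      · simp
      · intro v _ hv
        rw [if_neg]
        simp only [mem_preimage, mem_singleton_iff]
        exact fun h => hv (Subtype.ext h.symm)
      · simp
  have hlim : Tendsto (fun n => ∫ ω, ∏ j ∈ Finset.range n, (1 - g (X j ω)) ∂P) atTop
      (𝓝 (∫ ω, ∏ v : s, (1 - (v : ℂ)) ^ (pointCount (fun n => X n ω) (g ⁻¹' {(v : ℂ)})).toNat ∂P)) := by
    refine tendsto_integral_of_dominated_convergence (fun _ => 1) (fun n => ?_)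
      (integrable_const _) (fun n => Eventually.of_forall fun ω => ?_) ?_
    · exact (Finset.measurable_fun_prod _ fun j _ =>
        (g.measurable.comp (hX.measurable j)).const_sub 1).aestronglyMeasurable
    · rw [norm_prod]
      exact Finset.prod_le_one (fun _ _ => norm_nonneg _) fun j _ => hg1 _
    · have hne : ∀ᵐ ω ∂P, ∀ v : s, pointCount (fun n => X n ω) (g ⁻¹' {(v : ℂ)}) ≠ ⊤ :=
        ae_all_iff.2 fun v => hX.count_ne_top (hms v) (hfin v)
      filter_upwards [hne] with ω hω
      simp only [hprod]
      simp_rw [Finset.prod_comm (s := Finset.range _)]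
      exact tendsto_finsetProd _ fun v _ => tendsto_prod_ite_of_count_ne_top _ _ _ (hω v)
  have hval : ∫ ω, ∏ v : s, (1 - (v : ℂ)) ^ (pointCount (fun n => X n ω) (g ⁻¹' {(v : ℂ)})).toNat ∂P
      = Complex.exp (-(lam * ∫ z, g z)) := by
    have hind := hX.count_indep s.card (fun i => g ⁻¹' {(e i : ℂ)}) (fun i => hms _)
      (fun i j hij => Disjoint.preimage _ (by
        rw [disjoint_singleton]
        exact fun h => hij (e.injective (Subtype.ext h))))
    have h1 := hind.integral_fun_prod_comp
      (f := fun i k => (1 - (e i : ℂ)) ^ (ENat.toNat k))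
      (fun i => (hX.measurable_count (hms _)).aemeasurable)
      (fun i => (measurable_from_top).aestronglyMeasurable)
    have h2 : ∀ v : s, ∫ ω, (1 - (v : ℂ)) ^ (pointCount (fun n => X n ω) (g ⁻¹' {(v : ℂ)})).toNat ∂P
        = Complex.exp (-(lam * (volume.real (g ⁻¹' {(v : ℂ)}) • (v : ℂ)))) := by
      intro v
      have hmc := hX.measurable_count (hms v)
      rw [← integral_map (f := fun k : ℕ∞ => (1 - (v : ℂ)) ^ (ENat.toNat k)) hmc.aemeasurable
        (measurable_from_top).aestronglyMeasurable, hX.map_count (hms v) (hfin v),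
        integral_map measurable_from_nat.aemeasurable (measurable_from_top).aestronglyMeasurable]
      simp only [ENat.toNat_natCast]
      rw [integral_poissonMeasure_pow]
      congr 1
      have : (((lam * (volume (g ⁻¹' {(v : ℂ)})).toReal).toNNReal : ℝ) : ℂ)
          = lam * (volume.real (g ⁻¹' {(v : ℂ)}) : ℂ) := by
        rw [Real.coe_toNNReal _ (mul_nonneg hlam ENNReal.toReal_nonneg)]
        push_cast; rfl
      rw [Complex.real_smul, ← mul_assoc, ← this]
      simp
    have h3 : ∀ ω, ∏ v : s, (1 - (v : ℂ)) ^ (pointCount (fun n => X n ω) (g ⁻¹' {(v : ℂ)})).toNat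
        = ∏ i, (1 - (e i : ℂ)) ^ (pointCount (fun n => X n ω) (g ⁻¹' {(e i : ℂ)})).toNat := fun ω =>
      (Equiv.prod_comp e fun v : s =>
        (1 - (v : ℂ)) ^ (pointCount (fun n => X n ω) (g ⁻¹' {(v : ℂ)})).toNat).symm
    simp only [h3]
    rw [h1]
    simp only [h2]
    rw [← Complex.exp_sum, Equiv.sum_comp e fun v : s =>
      -((lam : ℂ) * (volume.real (g ⁻¹' {(v : ℂ)}) • (v : ℂ))), Finset.sum_neg_distrib,
      ← Finset.mul_sum, ← SimpleFunc.integral_eq_integral g hg, SimpleFunc.integral_eq_sum_filter,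
      ← hs, ← Finset.sum_coe_sort s]
  rw [← hval]
  exact hlim

/-- The probability generating functional, for complex-valued functions. -/
theorem tendsto_integral_prod (hlam : 0 ≤ lam) (hX : IsPoissonProcess P lam X)
    {h : Plane → ℂ} (hm : Measurable h) (h1 : ∀ z, ‖h z‖ ≤ 1)
    (hi : Integrable (fun z => 1 - h z)) :
    Tendsto (fun n => ∫ ω, ∏ j ∈ Finset.range n, h (X j ω) ∂P) atTop
      (𝓝 (Complex.exp (-(lam * ∫ z, (1 - h z))))) := by
  -- Approximants with values in this disc satisfy |1 - g| ≤ 1, so all products stay bounded by one.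
  set K : Set ℂ := Metric.closedBall 1 1 with hK
  have h0 : (0 : ℂ) ∈ K := by simp [hK]
  have hm' : Measurable fun z => 1 - h z := hm.const_sub 1
  set g : ℕ → SimpleFunc Plane ℂ := SimpleFunc.approxOn (fun z => 1 - h z) hm' K 0 h0 with hg
  have hgK : ∀ k z, ‖1 - g k z‖ ≤ 1 := by
    intro k z
    have : g k z ∈ K := SimpleFunc.approxOn_mem hm' h0 k z
    rwa [hK, Metric.mem_closedBall, dist_comm, dist_eq_norm] at this
  have hgi : ∀ k, Integrable (g k) volume := fun k =>
    SimpleFunc.integrable_approxOn hm' hi h0 (integrable_zero _ _ _) k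
  have hL1 : Tendsto (fun k => ∫⁻ z, ‖g k z - (1 - h z)‖ₑ) atTop (𝓝 0) := by
    refine SimpleFunc.tendsto_approxOn_L1_enorm hm' h0 (Eventually.of_forall fun z => ?_) ?_
    · refine subset_closure ?_
      simp [hK, h1 z]
    · simpa using hi.2
  have hB : Tendsto (fun k => Complex.exp (-(lam * ∫ z, g k z))) atTop
      (𝓝 (Complex.exp (-(lam * ∫ z, (1 - h z))))) := by
    refine (Complex.continuous_exp.tendsto _).comp (Tendsto.neg (Tendsto.const_mul _ ?_))
    exact tendsto_integral_of_L1 _ hi.aestronglyMeasurable (Eventually.of_forall hgi) hL1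
  -- By Campbell's formula the error is controlled by the L¹ distance, uniformly in n; this allows
  -- the limits in k and n to be exchanged.
  have hdiff : ∀ k n, ‖(∫ ω, ∏ j ∈ Finset.range n, h (X j ω) ∂P)
      - ∫ ω, ∏ j ∈ Finset.range n, (1 - g k (X j ω)) ∂P‖ₑ
        ≤ ENNReal.ofReal lam * ∫⁻ z, ‖g k z - (1 - h z)‖ₑ := by
    intro k n
    have hb : ∀ (f : Plane → ℂ), Measurable f → (∀ z, ‖f z‖ ≤ 1) →
        Integrable (fun ω => ∏ j ∈ Finset.range n, f (X j ω)) P := by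
      intro f hf hf1
      refine (integrable_const (1 : ℝ)).mono' (Finset.measurable_fun_prod _ fun j _ =>
        hf.comp (hX.measurable j)).aestronglyMeasurable (Eventually.of_forall fun ω => ?_)
      rw [norm_prod]
      exact Finset.prod_le_one (fun _ _ => norm_nonneg _) fun j _ => hf1 _
    rw [← integral_sub (hb h hm h1) (hb (fun z => 1 - g k z) ((g k).measurable.const_sub 1) (hgK k))]
    have hmm : Measurable fun z => ‖g k z - (1 - h z)‖ₑ := ((g k).measurable.sub hm').enorm
    rw [← hX.lintegral_tsum_eq hlam hmm]
    calc _ ≤ ∫⁻ ω, ‖∏ j ∈ Finset.range n, h (X j ω) - ∏ j ∈ Finset.range n, (1 - g k (X j ω))‖ₑ ∂P :=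
          enorm_integral_le_lintegral_enorm _
      _ ≤ ∫⁻ ω, ∑ j ∈ Finset.range n, ‖g k (X j ω) - (1 - h (X j ω))‖ₑ ∂P := by
          refine lintegral_mono fun ω => ?_
          have := norm_prod_sub_prod_le (Finset.range n) (fun j => h (X j ω))
            (fun j => 1 - g k (X j ω)) (fun j => h1 _) (fun j => hgK k _)
          simp only [← ofReal_norm]
          rw [← ENNReal.ofReal_sum_of_nonneg fun _ _ => norm_nonneg _]
          refine ENNReal.ofReal_le_ofReal (this.trans (le_of_eq ?_))
          congr 1; ext j; congr 1; ring
      _ = ∑ j ∈ Finset.range n, ∫⁻ ω, ‖g k (X j ω) - (1 - h (X j ω))‖ₑ ∂P :=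
          lintegral_finsetSum _ fun j _ => hmm.comp (hX.measurable j)
      _ ≤ _ := ENNReal.sum_le_tsum _
  have hL2 : Tendsto (fun k => ENNReal.ofReal lam * ∫⁻ z, ‖g k z - (1 - h z)‖ₑ) atTop (𝓝 0) := by
    simpa using ENNReal.Tendsto.const_mul hL1 (Or.inr ENNReal.ofReal_ne_top)
  rw [Metric.tendsto_atTop]
  intro ε hε
  have hε3 : (0 : ENNReal) < ENNReal.ofReal (ε / 3) := by simpa using hε
  obtain ⟨k, hk1, hk2⟩ := ((hL2.eventually (gt_mem_nhds hε3)).and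
    (hB.eventually (Metric.ball_mem_nhds _ (by positivity : 0 < ε / 3)))).exists
  obtain ⟨N, hN⟩ := (Metric.tendsto_atTop.1
    (hX.tendsto_integral_prod_simpleFunc hlam (g k) (hgi k) (hgK k))) (ε / 3) (by positivity)
  refine ⟨N, fun n hn => ?_⟩
  have h3 : dist (∫ ω, ∏ j ∈ Finset.range n, h (X j ω) ∂P)
      (∫ ω, ∏ j ∈ Finset.range n, (1 - g k (X j ω)) ∂P) < ε / 3 := by
    have := (hdiff k n).trans_lt hk1
    rw [← ofReal_norm, ENNReal.ofReal_lt_ofReal_iff (by positivity)] at this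
    rwa [dist_eq_norm]
  have h4 := hN n hn
  have h5 : dist (Complex.exp (-(lam * ∫ z, g k z))) (Complex.exp (-(lam * ∫ z, (1 - h z)))) < ε / 3 :=
    hk2
  calc _ ≤ _ := dist_triangle4 _ _ _ _
    _ < ε / 3 + ε / 3 + ε / 3 := add_lt_add (add_lt_add h3 h4) h5
    _ = ε := by ring

end IsPoissonProcess

end PoissonProcess

/-! ### The tail recursion of a discrete-time queue and its limiting busy probability. -/

noncomputable section

/-- The tail probabilities at time `t` of the queue with geometric arrivals of rate `ξ` and
geometric services of rate `s`, started empty. -/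
def queueTail (ξ s : ℝ) : ℕ → ℕ → ℝ
  | 0, k => if k = 0 then 1 else 0
  | _ + 1, 0 => 1
  | t + 1, k + 1 => queueTail ξ s t (k + 1)
      + (if k = 0 then ξ else ξ * (1 - s)) * (queueTail ξ s t k - queueTail ξ s t (k + 1))
      - s * (1 - ξ) * (queueTail ξ s t (k + 1) - queueTail ξ s t (k + 2))

/-- The limiting probability that the queue is busy. -/
def busyLimit (ξ s : ℝ) : ℝ := if s ≤ ξ then 1 else ξ / s

section QueueTail

variable {ξ s : ℝ}

lemma queueTail_zero_right (t : ℕ) : queueTail ξ s t 0 = 1 := by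
  cases t <;> simp [queueTail]

/-- The coefficients of a, b and c are all nonnegative; that of b is (1 - ξ)(1 - s), plus ξ s when k
> 0. The comparisons of tails below are inductions through this order-preserving step. -/
lemma queueTail_step_mono (hξ0 : 0 ≤ ξ) (hξ1 : ξ ≤ 1) (hs0 : 0 ≤ s) (hs1 : s ≤ 1) (k : ℕ)
    {a b c a' b' c' : ℝ} (ha : a ≤ a') (hb : b ≤ b') (hc : c ≤ c') :
    b + (if k = 0 then ξ else ξ * (1 - s)) * (a - b) - s * (1 - ξ) * (b - c)
      ≤ b' + (if k = 0 then ξ else ξ * (1 - s)) * (a' - b') - s * (1 - ξ) * (b' - c') := by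
  have h1 : 0 ≤ (if k = 0 then ξ else ξ * (1 - s)) := by
    split_ifs
    · exact hξ0
    · exact mul_nonneg hξ0 (by linarith)
  have h2 : 0 ≤ s * (1 - ξ) := mul_nonneg hs0 (by linarith)
  have h3 : 0 ≤ 1 - (if k = 0 then ξ else ξ * (1 - s)) - s * (1 - ξ) := by
    split_ifs <;> nlinarith [mul_nonneg (sub_nonneg.2 hξ1) (sub_nonneg.2 hs1), mul_nonneg hξ0 hs0]
  nlinarith [mul_le_mul_of_nonneg_left ha h1, mul_le_mul_of_nonneg_left hc h2,
    mul_le_mul_of_nonneg_left hb h3]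

lemma queueTail_nonneg (hξ0 : 0 ≤ ξ) (hξ1 : ξ ≤ 1) (hs0 : 0 ≤ s) (hs1 : s ≤ 1) (t k : ℕ) :
    0 ≤ queueTail ξ s t k := by
  induction t generalizing k with
  | zero => simp only [queueTail]; split_ifs <;> norm_num
  | succ t ih =>
    cases k with
    | zero => simp [queueTail]
    | succ k =>
      have := queueTail_step_mono hξ0 hξ1 hs0 hs1 k (ih k) (ih (k + 1)) (ih (k + 2))
      simp only [sub_self, mul_zero, add_zero] at this
      simpa [queueTail] using this

lemma queueTail_le_one (hξ0 : 0 ≤ ξ) (hξ1 : ξ ≤ 1) (hs0 : 0 ≤ s) (hs1 : s ≤ 1) (t k : ℕ) :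
    queueTail ξ s t k ≤ 1 := by
  induction t generalizing k with
  | zero => simp only [queueTail]; split_ifs <;> norm_num
  | succ t ih =>
    cases k with
    | zero => simp [queueTail]
    | succ k =>
      have := queueTail_step_mono hξ0 hξ1 hs0 hs1 k (ih k) (ih (k + 1)) (ih (k + 2))
      simp only [sub_self, mul_zero, add_zero, sub_zero] at this
      simpa [queueTail] using this

/-- The empty queue is the least initial state, so the first step can only raise the tails, and the
order-preserving step propagates this. Convergence in time then needs no ergodic theory. -/
lemma queueTail_mono_time (hξ0 : 0 ≤ ξ) (hξ1 : ξ ≤ 1) (hs0 : 0 ≤ s) (hs1 : s ≤ 1) (k : ℕ) :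
    Monotone fun t => queueTail ξ s t k := by
  refine monotone_nat_of_le_succ fun t => ?_
  induction t generalizing k with
  | zero =>
    cases k with
    | zero => simp [queueTail]
    | succ k =>
      have h := queueTail_nonneg hξ0 hξ1 hs0 hs1 1 (k + 1)
      have h0 : queueTail ξ s 0 (k + 1) = 0 := by simp [queueTail]
      exact h0.trans_le h
  | succ t ih =>
    cases k with
    | zero => simp [queueTail]
    | succ k => exact queueTail_step_mono hξ0 hξ1 hs0 hs1 k (ih k) (ih (k + 1)) (ih (k + 2))

lemma queueTail_succ_le (hξ0 : 0 ≤ ξ) (hξ1 : ξ ≤ 1) (hs0 : 0 ≤ s) (hs1 : s ≤ 1) (t k : ℕ) :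
    queueTail ξ s t (k + 1) ≤ queueTail ξ s t k := by
  induction t generalizing k with
  | zero => simp only [queueTail]; split_ifs <;> norm_num at *
  | succ t ih =>
    cases k with
    | zero => rw [queueTail_zero_right]; exact queueTail_le_one hξ0 hξ1 hs0 hs1 _ _
    | succ k =>
      -- Levels k + 2 and k + 1 use the same recursion except that the arrival coefficient at the
      -- lowest level is ξ instead of ξ (1 - s); the discrepancy ξ s has the favourable sign.
      refine (queueTail_step_mono hξ0 hξ1 hs0 hs1 (k + 1) (ih k) (ih (k + 1)) (ih (k + 2))).trans ?_
      simp only [queueTail, Nat.add_eq_zero_iff, one_ne_zero, and_false, if_false]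
      have : 0 ≤ ξ * s * (queueTail ξ s t k - queueTail ξ s t (k + 1)) :=
        mul_nonneg (mul_nonneg hξ0 hs0) (sub_nonneg.2 (ih k))
      split_ifs <;> nlinarith

/-- The stationary tail dominates the tail at all times. -/
lemma queueTail_one_le (hξ0 : 0 ≤ ξ) (hξs : ξ < s) (hs1 : s ≤ 1) (t : ℕ) :
    queueTail ξ s t 1 ≤ ξ / s := by
  have hs0 : 0 < s := hξ0.trans_lt hξs
  have hξ1 : ξ < 1 := hξs.trans_le hs1
  set ρ : ℝ := ξ * (1 - s) / (s * (1 - ξ)) with hρ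
  have hd : 0 < s * (1 - ξ) := mul_pos hs0 (by linarith)
  have hρ0 : 0 ≤ ρ := div_nonneg (mul_nonneg hξ0 (by linarith)) hd.le
  have hρd : s * (1 - ξ) * ρ = ξ * (1 - s) := by rw [hρ, mul_div_cancel₀ _ hd.ne']
  -- The stationary tails: busy probability ξ / s, then geometric decay with the ratio ρ of upward
  -- to downward rates. They are a fixed point of the recursion and lie above the initial tails.
  let q : ℕ → ℝ := fun k => if k = 0 then 1 else ξ / s * ρ ^ (k - 1)
  have hq : ∀ k, q (k + 1) = q (k + 1) + (if k = 0 then ξ else ξ * (1 - s)) * (q k - q (k + 1))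
      - s * (1 - ξ) * (q (k + 1) - q (k + 2)) := by
    intro k
    cases k with
    | zero =>
      have : s * (1 - ξ) * (ξ / s - ξ / s * ρ) = ξ * (1 - ξ / s) := by
        calc s * (1 - ξ) * (ξ / s - ξ / s * ρ) = ξ / s * (s * (1 - ξ) - s * (1 - ξ) * ρ) := by ring
          _ = ξ * (1 - ξ / s) := by rw [hρd]; field_simp; ring
      simp [q]
      linarith
    | succ k =>
      have : s * (1 - ξ) * (ξ / s * ρ ^ (k + 1) - ξ / s * ρ ^ (k + 2))
          = ξ * (1 - s) * (ξ / s * ρ ^ k - ξ / s * ρ ^ (k + 1)) := by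
        rw [← hρd]; ring
      simp [q]
      linarith
  have key : ∀ t k, queueTail ξ s t k ≤ q k := by
    intro t
    induction t with
    | zero =>
      intro k
      simp only [queueTail, q]
      split_ifs
      · exact le_rfl
      · positivity
    | succ t ih =>
      intro k
      cases k with
      | zero => simp [queueTail, q]
      | succ k =>
        rw [hq k]
        exact queueTail_step_mono hξ0 hξ1.le hs0.le hs1 k (ih k) (ih (k + 1)) (ih (k + 2))
  simpa [q] using key t 1

/-- Tails increase in time, so they converge, and the limits g balance the flow across every level.
If s ≤ ξ, the decrements of g from level 1 on do not decrease; as g stays in [0, 1] they vanish, and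
the balance at the lowest level forces g 1 = 1. If ξ < s, summing the balance equations gives s g 1
= ξ + (s - ξ) lim g ≥ ξ, and the stationary tail gives the reverse inequality. -/
theorem tendsto_queueTail_one (hξ0 : 0 < ξ) (hξ1 : ξ ≤ 1) (hs0 : 0 ≤ s) (hs1 : s ≤ 1) :
    Tendsto (fun t => queueTail ξ s t 1) atTop (𝓝 (busyLimit ξ s)) := by
  have hbdd : ∀ k, BddAbove (range fun t => queueTail ξ s t k) := fun k =>
    ⟨1, by rintro _ ⟨t, rfl⟩; exact queueTail_le_one hξ0.le hξ1 hs0 hs1 t k⟩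
  have hlim : ∀ k, Tendsto (fun t => queueTail ξ s t k) atTop (𝓝 (⨆ t, queueTail ξ s t k)) :=
    fun k => tendsto_atTop_ciSup (queueTail_mono_time hξ0.le hξ1 hs0 hs1 k) (hbdd k)
  set g : ℕ → ℝ := fun k => ⨆ t, queueTail ξ s t k with hg
  have hg0 : g 0 = 1 := by simp [hg, queueTail_zero_right]
  have hgn : ∀ k, 0 ≤ g k := fun k =>
    ge_of_tendsto' (hlim k) fun t => queueTail_nonneg hξ0.le hξ1 hs0 hs1 t k
  have hgle : ∀ k, g (k + 1) ≤ g k := fun k =>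
    le_of_tendsto_of_tendsto' (hlim (k + 1)) (hlim k) fun t =>
      queueTail_succ_le hξ0.le hξ1 hs0 hs1 t k
  have hbal : ∀ k, (if k = 0 then ξ else ξ * (1 - s)) * (g k - g (k + 1))
      = s * (1 - ξ) * (g (k + 1) - g (k + 2)) := by
    intro k
    have h1 := (hlim (k + 1)).comp (tendsto_add_atTop_nat 1)
    have h2 := ((hlim (k + 1)).add (((hlim k).sub (hlim (k + 1))).const_mul
      (if k = 0 then ξ else ξ * (1 - s)))).sub
        (((hlim (k + 1)).sub (hlim (k + 2))).const_mul (s * (1 - ξ)))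
    have := tendsto_nhds_unique h1 h2
    linarith
  have hg1 : g 1 ≤ 1 := hg0 ▸ hgle 0
  suffices g 1 = busyLimit ξ s from this ▸ hlim 1
  have hb0 : ξ * (1 - g 1) = s * (1 - ξ) * (g 1 - g 2) := by simpa [hg0] using hbal 0
  have hb : ∀ k, ξ * (1 - s) * (g (k + 1) - g (k + 2)) = s * (1 - ξ) * (g (k + 2) - g (k + 3)) :=
    fun k => by simpa using hbal (k + 1)
  have hd0 : 0 ≤ s * (1 - ξ) := mul_nonneg hs0 (by linarith)
  rw [busyLimit]
  split_ifs with hsξ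
  · -- overload: the decrements of `g` do not decrease, hence vanish
    rcases hd0.eq_or_lt with hd | hd
    -- There are no downward moves here (s = 0 or ξ = 1), and the lowest balance equation alone
    -- gives g 1 = 1.
    · rw [← hd, zero_mul] at hb0
      nlinarith
    · have hinc : ∀ k, g 1 - g 2 ≤ g (k + 1) - g (k + 2) := by
        intro k
        induction k with
        | zero => exact le_rfl
        | succ k ih =>
          refine ih.trans ?_
          have h1 : s * (1 - ξ) ≤ ξ * (1 - s) := by nlinarith
          have h2 := sub_nonneg.2 (hgle (k + 1))
          have h3 := hb k
          have : s * (1 - ξ) * (g (k + 1) - g (k + 2)) ≤ s * (1 - ξ) * (g (k + 2) - g (k + 3)) :=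
            (mul_le_mul_of_nonneg_right h1 h2).trans_eq h3
          exact le_of_mul_le_mul_left this hd
      have hsum : ∀ n : ℕ, n * (g 1 - g 2) ≤ g 1 - g (n + 1) := by
        intro n
        induction n with
        | zero => simp
        | succ n ih => push_cast; linarith [hinc n]
      have hz : g 1 - g 2 ≤ 0 := by
        by_contra hpos
        push Not at hpos
        obtain ⟨n, hn⟩ := exists_nat_gt (1 / (g 1 - g 2))
        rw [div_lt_iff₀ hpos] at hn
        linarith [hsum n, hgn (n + 1)]
      have : g 1 - g 2 = 0 := le_antisymm hz (sub_nonneg.2 (hgle 1))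
      rw [this, mul_zero] at hb0
      nlinarith
  · push Not at hsξ
    have hs : 0 < s := hξ0.trans hsξ
    refine le_antisymm (le_of_tendsto' (hlim 1) fun t => queueTail_one_le hξ0.le hsξ hs1 t) ?_
    have hξ1' : ξ < 1 := hsξ.trans_le hs1
    have hd : 0 < s * (1 - ξ) := mul_pos hs (by linarith)
    have hsum : ∀ n : ℕ, s * (1 - ξ) * (g 1 - g (n + 1)) - ξ * (1 - s) * (g 1 - g (n + 1))
        = s * (1 - ξ) * (g 1 - g 2) - s * (1 - ξ) * (g (n + 1) - g (n + 2)) := by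
      intro n
      induction n with
      | zero => simp
      | succ n ih => linarith [hb n]
    have hdec : Tendsto g atTop (𝓝 (⨅ k, g k)) :=
      tendsto_atTop_ciInf (antitone_nat_of_succ_le hgle) ⟨0, by rintro _ ⟨k, rfl⟩; exact hgn k⟩
    have hl0 : 0 ≤ ⨅ k, g k := ge_of_tendsto' hdec hgn
    have h1 := (tendsto_const_nhds (x := g 1)).sub (hdec.comp (tendsto_add_atTop_nat 1))
    have h2 := (h1.const_mul (s * (1 - ξ))).sub (h1.const_mul (ξ * (1 - s)))
    have h3 := ((hdec.comp (tendsto_add_atTop_nat 1)).sub (hdec.comp (tendsto_add_atTop_nat 2))).const_mul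
      (s * (1 - ξ))
    have h4 := (tendsto_const_nhds (x := s * (1 - ξ) * (g 1 - g 2))).sub h3
    have h5 := tendsto_nhds_unique h2 (h4.congr fun n => (hsum n).symm)
    rw [div_le_iff₀ hs]
    nlinarith

end QueueTail

/-! ### Queues driven by independent slot variables. -/

/-- The length of a queue with arrivals in the slots in `A` and, when the queue is non-empty,
departures in the slots in `D`. -/
def queueLength (A D : Set ℕ) : ℕ → ℕ
  | 0 => 0
  | t + 1 => open Classical in queueLength A D t
      - (if 0 < queueLength A D t ∧ t ∈ D then 1 else 0) + (if t ∈ A then 1 else 0)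

lemma queueLength_congr {A D A' D' : Set ℕ} {t : ℕ} (hA : ∀ i < t, i ∈ A ↔ i ∈ A')
    (hD : ∀ i < t, i ∈ D ↔ i ∈ D') : queueLength A D t = queueLength A' D' t := by
  induction t with
  | zero => rfl
  | succ t ih =>
    have e := ih (fun i hi => hA i (by omega)) fun i hi => hD i (by omega)
    have h1 := hA t (by omega)
    have h2 := hD t (by omega)
    by_cases hA' : t ∈ A' <;> by_cases hD' : t ∈ D' <;> simp [queueLength, e, h1, h2, hA', hD']

lemma measurable_queueLength {Ω : Type*} [MeasurableSpace Ω] {A D : ℕ → Set Ω}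
    (hA : ∀ i, MeasurableSet (A i)) (hD : ∀ i, MeasurableSet (D i)) (t : ℕ) :
    Measurable fun ω => queueLength {i | ω ∈ A i} {i | ω ∈ D i} t := by
  classical
  induction t with
  | zero => exact measurable_const
  | succ t ih =>
    have h1 : MeasurableSet {ω | 0 < queueLength {i | ω ∈ A i} {i | ω ∈ D i} t ∧ ω ∈ D t} :=
      (ih (measurableSet_Ioi (a := 0))).inter (hD t)
    exact (ih.sub (Measurable.ite h1 measurable_const measurable_const)).add
      (Measurable.ite (hA t) measurable_const measurable_const)

section QueueLaw

variable {E : Type*} [MeasurableSpace E] (ν : Measure E) [IsProbabilityMeasure ν] {A D : Set E}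

/-- The queue length driven by the slot variables `w`. -/
def drivenQueue (A D : Set E) (t : ℕ) (w : ℕ → E) : ℕ :=
  queueLength {i | w i ∈ A} {i | w i ∈ D} t

lemma measurable_drivenQueue (hA : MeasurableSet A) (hD : MeasurableSet D) (t : ℕ) :
    Measurable (drivenQueue A D t) :=
  measurable_queueLength (A := fun i => {w : ℕ → E | w i ∈ A}) (D := fun i => {w : ℕ → E | w i ∈ D})
    (fun i => measurable_pi_apply i hA) (fun i => measurable_pi_apply i hD) t

/-- The queue length in a slot is independent of the variables of that slot. -/
lemma indepFun_drivenQueue (hA : MeasurableSet A) (hD : MeasurableSet D) (t : ℕ) :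
    IndepFun (drivenQueue A D t) (fun w : ℕ → E => w t) (Measure.infinitePi fun _ => ν) := by
  have h0 : iIndepFun (fun (i : ℕ) (w : ℕ → E) => w i) (Measure.infinitePi fun _ => ν) :=
    iIndepFun_infinitePi (P := fun _ : ℕ => ν) (X := fun _ x => x) (fun _ => measurable_id)
  have h1 := h0.indepFun_finset (Finset.range t) {t} (by simp) (fun i => measurable_pi_apply i)
  let ψ : (Finset.range t → E) → ℕ := fun v =>
    queueLength {i | v ∈ {v : Finset.range t → E | ∃ h : i ∈ Finset.range t, v ⟨i, h⟩ ∈ A}}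
      {i | v ∈ {v : Finset.range t → E | ∃ h : i ∈ Finset.range t, v ⟨i, h⟩ ∈ D}} t
  have hm : ∀ B : Set E, MeasurableSet B → ∀ i, MeasurableSet
      {v : Finset.range t → E | ∃ h : i ∈ Finset.range t, v ⟨i, h⟩ ∈ B} := by
    intro B hB i
    by_cases hi : i ∈ Finset.range t
    · simp only [hi, exists_true_left]
      exact measurable_pi_apply _ hB
    · simp [hi]
  have hψ : Measurable ψ := measurable_queueLength (hm A hA) (hm D hD) t
  have h2 := h1.comp hψ (measurable_pi_apply (⟨t, by simp⟩ : ({t} : Finset ℕ)))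
  refine h2.congr (Eventually.of_forall fun w => ?_) (Eventually.of_forall fun w => rfl)
  refine queueLength_congr (fun i hi => ?_) fun i hi => ?_ <;> simp [hi]

/-- The length at time t is independent of the variables of slot t, so splitting by its value turns
the pathwise dynamics into the recursion for the tails. Within the slot, only the independence of
arrival and departure is used. -/
lemma drivenQueue_tail (hA : MeasurableSet A) (hD : MeasurableSet D)
    (hAD : ν.real (A ∩ D) = ν.real A * ν.real D) (t k : ℕ) :
    (Measure.infinitePi fun _ : ℕ => ν).real {w | k ≤ drivenQueue A D t w}
      = queueTail (ν.real A) (ν.real D) t k := by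
  set R := Measure.infinitePi fun _ : ℕ => ν with hR
  induction t generalizing k with
  | zero =>
    cases k with
    | zero => simp [queueTail]
    | succ k => simp [queueTail, drivenQueue, queueLength]
  | succ t ih =>
    cases k with
    | zero => simp [queueTail]
    | succ k =>
      have hQ := measurable_drivenQueue hA hD t
      have hind := indepFun_drivenQueue ν hA hD t
      have hmul : ∀ (n : ℕ) (B : Set E), MeasurableSet B →
          R.real ({w | drivenQueue A D t w = n} ∩ {w | w t ∈ B})
            = R.real {w | drivenQueue A D t w = n} * ν.real B := by
        intro n B hB
        have h := hind.measure_inter_preimage_eq_mul {n} B (measurableSet_singleton n) hB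
        have h3 : R ((fun w : ℕ → E => w t) ⁻¹' B) = ν B :=
          (measurePreserving_eval_infinitePi (fun _ : ℕ => ν) t).measure_preimage
            hB.nullMeasurableSet
        rw [h3] at h
        simp only [measureReal_def, ← ENNReal.toReal_mul]
        exact congrArg ENNReal.toReal h
      have hpt : ∀ n : ℕ, R.real {w | drivenQueue A D t w = n}
          = queueTail (ν.real A) (ν.real D) t n - queueTail (ν.real A) (ν.real D) t (n + 1) := by
        intro n
        have hsub : {w | n + 1 ≤ drivenQueue A D t w} ⊆ {w | n ≤ drivenQueue A D t w} :=
          fun w (hw : n + 1 ≤ drivenQueue A D t w) => (Nat.le_succ n).trans hw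
        have hmn : MeasurableSet {w | n + 1 ≤ drivenQueue A D t w} := hQ measurableSet_Ici
        rw [← ih n, ← ih (n + 1), ← measureReal_sdiff hsub hmn]
        congr 1
        ext w
        simp only [mem_ofPred_eq, Set.mem_sdiff]
        omega
      -- To end the slot with at least k + 1 packets: a length of at least k + 2 always suffices, k
      -- + 1 suffices unless a departure comes without an arrival, and k needs an arrival without a
      -- departure. An empty queue has no departure, hence the separate case k = 0.
      have hdec : {w : ℕ → E | k + 1 ≤ drivenQueue A D (t + 1) w}
          = ({w | k + 2 ≤ drivenQueue A D t w} ∪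
            ({w | drivenQueue A D t w = k + 1} ∩ {w | w t ∈ (D \ A)ᶜ})) ∪
            ({w | drivenQueue A D t w = k} ∩ {w | w t ∈ if k = 0 then A else A \ D}) := by
        ext w
        have : drivenQueue A D (t + 1) w = drivenQueue A D t w
            - (open Classical in if 0 < drivenQueue A D t w ∧ w t ∈ D then 1 else 0)
            + (open Classical in if w t ∈ A then 1 else 0) := rfl
        simp only [mem_ofPred_eq, mem_union, mem_inter_iff, this, mem_compl_iff, Set.mem_sdiff]
        by_cases h1 : w t ∈ A <;> by_cases h2 : w t ∈ D <;> by_cases h3 : k = 0 <;>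
          simp [h1, h2, h3] <;> (try split_ifs) <;> omega
      have hme : ∀ n, MeasurableSet {w | drivenQueue A D t w = n} := fun n =>
        hQ (measurableSet_singleton n)
      have hms : ∀ B : Set E, MeasurableSet B → MeasurableSet {w : ℕ → E | w t ∈ B} :=
        fun B hB => measurable_pi_apply t hB
      have hmif : MeasurableSet (if k = 0 then A else A \ D) := by
        split_ifs
        exacts [hA, hA.diff hD]
      rw [hdec, measureReal_union _ ((hme k).inter (hms _ hmif)), measureReal_union _
        ((hme (k + 1)).inter (hms _ (hD.diff hA).compl)), hmul _ _ (hD.diff hA).compl,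
        hmul _ _ hmif, ih, hpt, hpt]
      · have h1 : ν.real (D \ A)ᶜ = 1 - ν.real D * (1 - ν.real A) := by
          rw [probReal_compl_eq_one_sub (hD.diff hA)]
          have := measureReal_sdiff_add_inter (μ := ν) (s := D) (t := A) hA
          rw [inter_comm, hAD] at this
          linarith
        have h2 : ν.real (if k = 0 then A else A \ D)
            = if k = 0 then ν.real A else ν.real A * (1 - ν.real D) := by
          split_ifs
          · rfl
          · have := measureReal_sdiff_add_inter (μ := ν) (s := A) (t := D) hD
            rw [hAD] at this
            linarith
        rw [h1, h2]
        simp only [queueTail]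
        ring
      · refine disjoint_left.2 fun w hw hw' => ?_
        have h1 : k + 2 ≤ drivenQueue A D t w := hw
        have h2 : drivenQueue A D t w = k + 1 := hw'.1
        omega
      · refine disjoint_left.2 fun w hw hw' => ?_
        have h2 : drivenQueue A D t w = k := hw'.1
        rcases hw with hw | hw
        · have h1 : k + 2 ≤ drivenQueue A D t w := hw
          omega
        · have h1 : drivenQueue A D t w = k + 1 := hw.1
          omega

end QueueLaw
end

/-! ### Relative path loss: polar coordinates and the integrable majorant. -/

noncomputable section

namespace NetworkParams

variable (p : NetworkParams)

lemma α_pos : 0 < p.α := by linarith [p.two_lt_α]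

lemma refLoss_pos : 0 < p.T * p.r ^ p.α := mul_pos p.T_pos (Real.rpow_pos_of_pos p.r_pos _)

lemma relLoss_pos {x : Plane} (hx : x ≠ 0) : 0 < p.relLoss x :=
  div_pos (Real.rpow_pos_of_pos (norm_pos_iff.2 hx) _) p.refLoss_pos

lemma relLoss_nonneg (x : Plane) : 0 ≤ p.relLoss x :=
  div_nonneg (Real.rpow_nonneg (norm_nonneg _) _) p.refLoss_pos.le

lemma relLoss_pos_iff {x : Plane} : 0 < p.relLoss x ↔ x ≠ 0 := by
  refine ⟨fun h hx => ?_, p.relLoss_pos⟩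
  simp [relLoss, hx, Real.zero_rpow p.α_pos.ne'] at h

lemma measurable_relLoss : Measurable p.relLoss := by
  unfold relLoss; fun_prop

/-- The area scale `r² T^δ`. -/
lemma scale_rpow : (p.r ^ 2 * p.T ^ p.δ) ^ (p.α / 2) = p.T * p.r ^ p.α := by
  have hα := p.α_pos.ne'
  rw [Real.mul_rpow (by positivity) (Real.rpow_nonneg p.T_pos.le _), ← Real.rpow_natCast,
    ← Real.rpow_mul p.r_pos.le, ← Real.rpow_mul p.T_pos.le, δ]
  rw [show ((2 : ℕ) : ℝ) * (p.α / 2) = p.α by push_cast; ring,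
    show 2 / p.α * (p.α / 2) = 1 by field_simp, Real.rpow_one, mul_comm]

lemma scale_pos : 0 < p.r ^ 2 * p.T ^ p.δ :=
  mul_pos (pow_pos p.r_pos 2) (Real.rpow_pos_of_pos p.T_pos _)

variable {F : Type*} [NormedAddCommGroup F] [NormedSpace ℝ F]

lemma relLoss_scale {v : ℝ} (hv : 0 < v) :
    (p.r ^ 2 * p.T ^ p.δ * v) ^ (p.α / 2) / (p.T * p.r ^ p.α) = v ^ (p.α / 2) := by
  rw [Real.mul_rpow p.scale_pos.le hv.le, p.scale_rpow, mul_div_cancel_left₀ _ p.refLoss_pos.ne']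

lemma sq_rpow_half {y : ℝ} (hy : 0 < y) : (y ^ (2 : ℝ)) ^ (p.α / 2) = y ^ p.α := by
  rw [← Real.rpow_mul hy.le]; congr 1; ring

/-- Polar coordinates, in the variable in which the relative path loss is `v ^ (α / 2)`. -/
lemma integral_comp_relLoss (g : ℝ → F) :
    ∫ z, g (p.relLoss z)
      = (Real.pi * p.r ^ 2 * p.T ^ p.δ) • ∫ v in Ioi (0 : ℝ), g (v ^ (p.α / 2)) := by
  have h1 := integral_fun_norm_addHaar (volume : Measure Plane)
    (fun y => g (y ^ p.α / (p.T * p.r ^ p.α)))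
  have hb : (volume : Measure Plane).real (Metric.ball 0 1) = Real.pi := by
    rw [measureReal_def, EuclideanSpace.volume_ball_fin_two]
    simp [ENNReal.toReal_ofReal Real.pi_pos.le]
  have h2 := integral_comp_rpow_Ioi_of_pos
    (g := fun v => g (v ^ (p.α / 2) / (p.T * p.r ^ p.α))) (p := 2) two_pos
  have h3 := integral_comp_mul_left_Ioi'
    (fun v => g (v ^ (p.α / 2) / (p.T * p.r ^ p.α))) 0 p.scale_pos
  have e2 : ∫ x in Ioi (0 : ℝ), ((2 : ℝ) * x ^ ((2 : ℝ) - 1)) •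
      g ((x ^ (2 : ℝ)) ^ (p.α / 2) / (p.T * p.r ^ p.α))
      = (2 : ℝ) • ∫ y in Ioi (0 : ℝ), y ^ (2 - 1) • g (y ^ p.α / (p.T * p.r ^ p.α)) := by
    rw [← integral_smul]
    refine setIntegral_congr_fun measurableSet_Ioi fun y hy => ?_
    simp only [p.sq_rpow_half hy]
    rw [smul_smul]
    norm_num
  have e3 : ∫ x in Ioi (0 : ℝ), g ((p.r ^ 2 * p.T ^ p.δ * x) ^ (p.α / 2) / (p.T * p.r ^ p.α))
      = ∫ v in Ioi (0 : ℝ), g (v ^ (p.α / 2)) :=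
    setIntegral_congr_fun measurableSet_Ioi fun v hv => by simp only [p.relLoss_scale hv]
  rw [e3, mul_zero, ← h2, e2] at h3
  simp only [finrank_euclideanSpace, Fintype.card_fin, hb] at h1
  rw [show (∫ z, g (p.relLoss z)) = ∫ x : Plane, g (‖x‖ ^ p.α / (p.T * p.r ^ p.α)) from rfl, h1,
    mul_assoc, ← smul_smul, h3, ← Nat.cast_smul_eq_nsmul ℝ, smul_comm]
  norm_num

lemma integrable_comp_relLoss_iff (g : ℝ → F) :
    Integrable (fun z => g (p.relLoss z)) ↔
      IntegrableOn (fun v : ℝ => g (v ^ (p.α / 2))) (Ioi 0) := by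
  have h1 := integrable_fun_norm_addHaar (volume : Measure Plane)
    (f := fun y => g (y ^ p.α / (p.T * p.r ^ p.α)))
  have h2 := integrableOn_Ioi_comp_rpow_iff'
    (fun v => g (v ^ (p.α / 2) / (p.T * p.r ^ p.α))) (p := 2) two_ne_zero
  have h3 := integrableOn_Ioi_comp_mul_left_iff
    (fun v => g (v ^ (p.α / 2) / (p.T * p.r ^ p.α))) 0 p.scale_pos
  rw [mul_zero] at h3
  refine h1.trans (Iff.trans ?_ (h2.trans (h3.symm.trans ?_)))
  · refine integrableOn_congr_fun (fun y hy => ?_) measurableSet_Ioi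
    simp only [p.sq_rpow_half hy, finrank_euclideanSpace, Fintype.card_fin]
    norm_num
  · exact integrableOn_congr_fun (fun v hv => by simp only [p.relLoss_scale hv]) measurableSet_Ioi

/-- The integrability behind all the exchanges of limits below. -/
lemma integrableOn_log_one_add_inv :
    IntegrableOn (fun v : ℝ => Real.log (1 + 1 / v ^ (p.α / 2))) (Ioi 0) := by
  have hβ : 1 < p.α / 2 := by linarith [p.two_lt_α]
  have hm : Measurable fun v : ℝ => Real.log (1 + 1 / v ^ (p.α / 2)) := by fun_prop
  rw [← Ioc_union_Ioi_eq_Ioi zero_le_one]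
  refine IntegrableOn.union ?_ ?_
  -- Near 0, log y ≤ y^ε / ε with ε = 1/α turns the singularity v^(-α/2) into v^(-1/2).
  · have hi : IntegrableOn (fun v : ℝ => (2 ^ (1 / p.α) * p.α) * v ^ (-(1 / 2) : ℝ)) (Ioc 0 1) := by
      refine Integrable.const_mul ?_ _
      have := intervalIntegral.intervalIntegrable_rpow' (a := 0) (b := 1)
        (show (-1 : ℝ) < -(1 / 2) by norm_num)
      rwa [intervalIntegrable_iff_integrableOn_Ioc_of_le zero_le_one] at this
    refine hi.mono' hm.aestronglyMeasurable ?_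
    filter_upwards [ae_restrict_mem measurableSet_Ioc] with v hv
    have hv0 : 0 < v := hv.1
    have hvp : 0 < v ^ (p.α / 2) := Real.rpow_pos_of_pos hv0 _
    have hv1 : v ^ (p.α / 2) ≤ 1 := Real.rpow_le_one hv0.le hv.2 (by linarith)
    have h1 : 1 ≤ 1 / v ^ (p.α / 2) := by rw [le_div_iff₀ hvp]; linarith
    rw [Real.norm_of_nonneg (Real.log_nonneg (by linarith))]
    have hε : 0 < 1 / p.α := one_div_pos.2 p.α_pos
    calc Real.log (1 + 1 / v ^ (p.α / 2)) ≤ Real.log (2 * (1 / v ^ (p.α / 2))) :=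
          Real.log_le_log (by linarith) (by linarith)
      _ ≤ (2 * (1 / v ^ (p.α / 2))) ^ (1 / p.α) / (1 / p.α) :=
          Real.log_le_rpow_div (by positivity) hε
      _ = _ := by
          rw [Real.mul_rpow (by norm_num) (by positivity), one_div (v ^ (p.α / 2)),
            ← Real.rpow_neg hv0.le, ← Real.rpow_mul hv0.le]
          have hα := p.α_pos.ne'
          rw [show -(p.α / 2) * (1 / p.α) = (-(1 / 2) : ℝ) by field_simp]
          field_simp
  -- Away from 0 the logarithm is at most v^(-α/2), whose integrability is where α > 2 is used.
  · have hi : IntegrableOn (fun v : ℝ => v ^ (-(p.α / 2))) (Ioi 1) :=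
      integrableOn_Ioi_rpow_of_lt (by linarith) one_pos
    refine hi.mono' hm.aestronglyMeasurable ?_
    filter_upwards [ae_restrict_mem measurableSet_Ioi] with v hv
    have hv0 : 0 < v := zero_lt_one.trans hv
    have hvp : 0 < v ^ (p.α / 2) := Real.rpow_pos_of_pos hv0 _
    have h1 : 0 < 1 / v ^ (p.α / 2) := by positivity
    rw [Real.norm_of_nonneg (Real.log_nonneg (by linarith)), Real.rpow_neg hv0.le, ← one_div]
    exact (Real.log_le_sub_one_of_pos (by linarith)).trans (by linarith)

lemma integrable_log_relLoss : Integrable fun z => Real.log (1 + 1 / p.relLoss z) :=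
  (p.integrable_comp_relLoss_iff fun d => Real.log (1 + 1 / d)).2 p.integrableOn_log_one_add_inv

lemma log_relLoss_nonneg (z : Plane) : 0 ≤ Real.log (1 + 1 / p.relLoss z) :=
  Real.log_nonneg (by
    have := one_div_nonneg.2 (p.relLoss_nonneg z)
    linarith)

lemma measurable_log_relLoss : Measurable fun z => Real.log (1 + 1 / p.relLoss z) :=
  Real.measurable_log.comp ((p.measurable_relLoss.const_div 1).const_add 1)

end NetworkParams

/-- All but finitely many of the logarithms L are below 1, where e^L - 1 ≤ 2 L. The detour is needed
because the gain 1/d is not integrable over the plane at the origin, so Campbell's formula controls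
only its logarithmic form. -/
lemma summable_inv_of_summable_log {D : ℕ → ℝ} (hD : ∀ j, 0 < D j)
    (h : Summable fun j => Real.log (1 + 1 / D j)) : Summable fun j => 1 / D j := by
  refine Summable.of_norm_bounded_eventually (g := fun j => 2 * Real.log (1 + 1 / D j))
    (h.mul_left 2) ?_
  have hz := h.tendsto_cofinite_zero
  filter_upwards [hz.eventually (gt_mem_nhds zero_lt_one)] with j hj
  have h0 : 0 < 1 / D j := one_div_pos.2 (hD j)
  have hl : 0 ≤ Real.log (1 + 1 / D j) := Real.log_nonneg (by linarith)
  have := Real.abs_exp_sub_one_le (x := Real.log (1 + 1 / D j)) (by rw [abs_of_nonneg hl]; exact hj.le)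
  rw [Real.exp_log (by linarith), abs_of_nonneg hl] at this
  simpa using this

/-! ### Almost sure summability of the gains of transmitters and receivers. -/

section PointSequences

variable {Ω : Type*} [MeasurableSpace Ω] {P : Measure Ω} (p : NetworkParams)

/-- A sequence of random points whose intensity is that of the Poisson process almost surely avoids
the origin and has finite total gain. -/
lemma ae_summable_of_intensity {Y : ℕ → Ω → Plane} (hY : ∀ j, Measurable (Y j)) {c : ENNReal}
    (hc : c ≠ ⊤) (h : ∀ g : Plane → ENNReal, Measurable g →
      ∑' j, ∫⁻ ω, g (Y j ω) ∂P = c * ∫⁻ z, g z) :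
    ∀ᵐ ω ∂P, (∀ j, 0 < p.relLoss (Y j ω)) ∧ Summable (fun j => 1 / p.relLoss (Y j ω)) ∧
      Summable fun j => Real.log (1 + 1 / p.relLoss (Y j ω)) := by
  have h0 : ∀ᵐ ω ∂P, ∀ j, Y j ω ≠ 0 := by
    refine ae_all_iff.2 fun j => ?_
    have := h (({0} : Set Plane).indicator 1) (measurable_one.indicator (measurableSet_singleton 0))
    rw [lintegral_indicator_one (measurableSet_singleton _), measure_singleton, mul_zero,
      ENNReal.tsum_eq_zero] at this
    have hj := this j
    rw [← lintegral_map (measurable_one.indicator (measurableSet_singleton 0)) (hY j),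
      lintegral_indicator_one (measurableSet_singleton _),
      Measure.map_apply (hY j) (measurableSet_singleton _)] at hj
    rw [ae_iff]
    simpa [preimage] using hj
  have h1 : ∀ᵐ ω ∂P, Summable fun j => Real.log (1 + 1 / p.relLoss (Y j ω)) := by
    have hgm : Measurable fun z => ENNReal.ofReal (Real.log (1 + 1 / p.relLoss z)) :=
      p.measurable_log_relLoss.ennreal_ofReal
    have hs := h _ hgm
    rw [← lintegral_tsum (f := fun j ω => ENNReal.ofReal (Real.log (1 + 1 / p.relLoss (Y j ω))))
      fun j => (hgm.comp (hY j)).aemeasurable] at hs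
    have hlt : ∫⁻ ω, ∑' j, ENNReal.ofReal (Real.log (1 + 1 / p.relLoss (Y j ω))) ∂P < ⊤ := by
      rw [hs]
      exact ENNReal.mul_lt_top hc.lt_top
        ((hasFiniteIntegral_iff_ofReal (Eventually.of_forall p.log_relLoss_nonneg)).1
          p.integrable_log_relLoss.2)
    have := ae_lt_top (Measurable.tsum fun j => hgm.comp (hY j)) hlt.ne
    filter_upwards [this] with ω hω
    have h2 := ENNReal.summable_toReal hω.ne
    refine h2.congr fun j => ?_
    exact ENNReal.toReal_ofReal (p.log_relLoss_nonneg _)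
  filter_upwards [h0, h1] with ω hω0 hω1
  have hp : ∀ j, 0 < p.relLoss (Y j ω) := fun j => p.relLoss_pos (hω0 j)
  exact ⟨hp, summable_inv_of_summable_log hp hω1, hω1⟩

end PointSequences

lemma NetworkParams.measurable_receiver (p : NetworkParams) (j : ℕ) :
    Measurable fun c : LinkConfig => p.receiver c j := by
  have h1 : Measurable fun t : ℝ => (!₂[Real.cos t, Real.sin t] : Plane) := by
    refine (WithLp.measurable_toLp 2 (Fin 2 → ℝ)).comp (measurable_pi_lambda _ fun i => ?_)
    fin_cases i
    · exact Real.measurable_cos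
    · exact Real.measurable_sin
  have h2 : Measurable fun c : LinkConfig => c.2 j := (measurable_pi_apply j).comp measurable_snd
  exact ((measurable_pi_apply j).comp measurable_fst).add ((h1.comp h2).const_smul p.r)

namespace MeanFieldNetwork

variable {Ω : Type*} [MeasurableSpace Ω] {P : Measure Ω} [IsProbabilityMeasure P]
  {p : NetworkParams} {S : Set Plane} {X : ℕ → Ω → Plane} {θ m : ℕ → Ω → ℝ}

omit [IsProbabilityMeasure P] in
lemma measurable_config (hnet : MeanFieldNetwork P p S X θ m) :
    Measurable fun ω => ((fun j => X j ω, fun j => θ j ω) : LinkConfig) :=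
  (measurable_pi_lambda _ hnet.poisson.measurable).prodMk
    (measurable_pi_lambda _ hnet.measurable_angle)

/-- The receivers have the same intensity as the transmitters. -/
lemma lintegral_tsum_receiver (hnet : MeanFieldNetwork P p S X θ m) {g : Plane → ENNReal}
    (hg : Measurable g) :
    ∑' j, ∫⁻ ω, g (p.receiver (fun j => X j ω, fun j => θ j ω) j) ∂P
      = ENNReal.ofReal p.lam * ∫⁻ z, g z := by
  set Θ : Measure ℝ := ProbabilityTheory.cond volume (Ico 0 (2 * Real.pi)) with hΘ
  have hprob : IsProbabilityMeasure Θ := by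
    rw [hΘ, ← hnet.angle_law 0]
    exact Measure.isProbabilityMeasure_map (hnet.measurable_angle 0).aemeasurable
  have he : Measurable fun t : ℝ => (!₂[Real.cos t, Real.sin t] : Plane) := by
    refine (WithLp.measurable_toLp 2 (Fin 2 → ℝ)).comp (measurable_pi_lambda _ fun i => ?_)
    fin_cases i
    · exact Real.measurable_cos
    · exact Real.measurable_sin
  have hG : Measurable fun q : Plane × ℝ => g (q.1 + p.r • !₂[Real.cos q.2, Real.sin q.2]) :=
    hg.comp (measurable_fst.add ((he.comp measurable_snd).const_smul p.r))
  have h1 : ∀ j, ∫⁻ ω, g (p.receiver (fun j => X j ω, fun j => θ j ω) j) ∂P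
      = ∫⁻ t, ∫⁻ ω, g (X j ω + p.r • !₂[Real.cos t, Real.sin t]) ∂P ∂Θ := by
    intro j
    have hind : IndepFun (X j) (θ j) P :=
      hnet.angle_indep_loc.comp (measurable_pi_apply j) (measurable_pi_apply j)
    have hXj := hnet.poisson.measurable j
    have hmap := (indepFun_iff_map_prod_eq_prod_map_map hXj.aemeasurable
      (hnet.measurable_angle j).aemeasurable).1 hind
    rw [hnet.angle_law j, ← hΘ] at hmap
    have : IsProbabilityMeasure (P.map (X j)) := Measure.isProbabilityMeasure_map hXj.aemeasurable
    calc _ = ∫⁻ q, g (q.1 + p.r • !₂[Real.cos q.2, Real.sin q.2])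
            ∂(P.map fun ω => (X j ω, θ j ω)) :=
          (lintegral_map hG (hXj.prodMk (hnet.measurable_angle j))).symm
      _ = _ := by
          rw [hmap, lintegral_prod_symm' _ hG]
          congr 1; ext t
          exact lintegral_map (hG.comp (measurable_id.prodMk measurable_const)) hXj
  simp only [h1]
  rw [← lintegral_tsum fun j => by
    have h2 : Measurable fun q : ℝ × Ω => g (X j q.2 + p.r • !₂[Real.cos q.1, Real.sin q.1]) :=
      hG.comp (((hnet.poisson.measurable j).comp measurable_snd).prodMk measurable_fst)
    exact h2.lintegral_prod_right'.aemeasurable]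
  -- For a fixed angle the receivers are a translate of the transmitters, and Lebesgue measure is
  -- translation invariant.
  have h3 : ∀ t : ℝ, ∑' j, ∫⁻ ω, g (X j ω + p.r • !₂[Real.cos t, Real.sin t]) ∂P
      = ENNReal.ofReal p.lam * ∫⁻ z, g z := by
    intro t
    rw [hnet.poisson.lintegral_tsum_eq p.lam_pos.le
      (g := fun z => g (z + p.r • !₂[Real.cos t, Real.sin t])) (hg.comp (measurable_id.add_const _)),
      lintegral_add_right_eq_self]
  simp only [h3, lintegral_const, measure_univ, mul_one]

lemma ae_summable_loc (hnet : MeanFieldNetwork P p S X θ m) :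
    ∀ᵐ ω ∂P, (∀ j, 0 < p.relLoss (X j ω)) ∧ Summable (fun j => 1 / p.relLoss (X j ω)) ∧
      Summable fun j => Real.log (1 + 1 / p.relLoss (X j ω)) :=
  ae_summable_of_intensity p hnet.poisson.measurable ENNReal.ofReal_ne_top
    fun _ hg => hnet.poisson.lintegral_tsum_eq p.lam_pos.le hg

/-- Only the intensity of the receivers matters; that they form a Poisson process themselves is not
needed. The measurability of the event is what carries the statement over to the law of the
configuration. -/
lemma ae_summable_receiver (hnet : MeanFieldNetwork P p S X θ m) :
    ∀ᵐ c ∂(configLaw P X θ), (∀ j, 0 < p.relLoss (p.receiver c j)) ∧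
      Summable fun j => 1 / p.relLoss (p.receiver c j) := by
  have hms : MeasurableSet {c : LinkConfig | (∀ j, 0 < p.relLoss (p.receiver c j)) ∧
      Summable fun j => 1 / p.relLoss (p.receiver c j)} := by
    have hr := fun j => p.measurable_relLoss.comp (p.measurable_receiver j)
    have hA : MeasurableSet {c : LinkConfig | ∀ j, 0 < p.relLoss (p.receiver c j)} := by
      rw [show {c : LinkConfig | ∀ j, 0 < p.relLoss (p.receiver c j)}
        = ⋂ j, {c | 0 < p.relLoss (p.receiver c j)} by ext; simp]
      exact MeasurableSet.iInter fun j => hr j measurableSet_Ioi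
    have hB : MeasurableSet {c : LinkConfig | Summable fun j => 1 / p.relLoss (p.receiver c j)} := by
      have e : {c : LinkConfig | Summable fun j => 1 / p.relLoss (p.receiver c j)}
          = {c | ∑' j, ENNReal.ofReal (1 / p.relLoss (p.receiver c j)) < ⊤} := by
        ext c
        have hn : ∀ j, 0 ≤ 1 / p.relLoss (p.receiver c j) := fun j =>
          one_div_nonneg.2 (p.relLoss_nonneg _)
        refine ⟨fun h => (h.tsum_ofReal_lt_top), fun h => ?_⟩
        refine (ENNReal.summable_toReal (ne_of_lt h)).congr fun j => ?_
        exact ENNReal.toReal_ofReal (hn j)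
      rw [e]
      exact (Measurable.tsum fun j => ((hr j).const_div 1).ennreal_ofReal) measurableSet_Iio
    exact hA.inter hB
  rw [configLaw, ae_map_iff hnet.measurable_config.aemeasurable hms]
  have := ae_summable_of_intensity p
    (Y := fun j ω => p.receiver (fun j => X j ω, fun j => θ j ω) j)
    (fun j => (p.measurable_receiver j).comp hnet.measurable_config) ENNReal.ofReal_ne_top
    fun _ hg => hnet.lintegral_tsum_receiver hg
  filter_upwards [this] with ω hω using ⟨hω.1, hω.2.1⟩

end MeanFieldNetwork
end

/-! ### The access probability as a function of the environment, and its mean. -/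

noncomputable section

section AccessProb

variable {ι : Type} {D : ι → ℝ} {V : ℝ}

/-- The function of `η` whose zero is the access probability. -/
def accessGap (D : ι → ℝ) (V η : ℝ) : ℝ := 1 / η - ∑' i, 1 / (1 + D i - η) - V

lemma summable_accessGap (hD : ∀ i, 0 < D i) (hs : Summable fun i => 1 / D i) {η : ℝ} (h1 : η ≤ 1) :
    Summable fun i => 1 / (1 + D i - η) := by
  refine Summable.of_nonneg_of_le (fun i => ?_) (fun i => ?_) hs
  · have := hD i; exact one_div_nonneg.2 (by linarith)
  · exact one_div_le_one_div_of_le (hD i) (by linarith)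

lemma accessGap_strictAnti (hD : ∀ i, 0 < D i) (hs : Summable fun i => 1 / D i) {a b : ℝ}
    (ha : 0 < a) (hab : a < b) (hb : b ≤ 1) : accessGap D V b < accessGap D V a := by
  have h1 : 1 / b < 1 / a := one_div_lt_one_div_of_lt ha hab
  have h2 : ∑' i, 1 / (1 + D i - a) ≤ ∑' i, 1 / (1 + D i - b) :=
    Summable.tsum_le_tsum (fun i => one_div_le_one_div_of_le (by have := hD i; linarith) (by linarith))
      (summable_accessGap hD hs (by linarith)) (summable_accessGap hD hs hb)
  simp only [accessGap]
  linarith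

lemma continuousOn_accessGap (hD : ∀ i, 0 < D i) (hs : Summable fun i => 1 / D i) :
    ContinuousOn (accessGap D V) (Ioc 0 1) := by
  refine ContinuousOn.sub (ContinuousOn.sub ?_ ?_) continuousOn_const
  · exact continuousOn_const.div continuousOn_id fun x hx => hx.1.ne'
  · refine continuousOn_tsum (u := fun i => 1 / D i) (fun i => ?_) hs fun i x hx => ?_
    · refine continuousOn_const.div (continuousOn_const.sub continuousOn_id) fun x hx => ?_
      have := hD i
      have := hx.2
      show (1 : ℝ) + D i - x ≠ 0
      linarith
    · have := hD i
      have := hx.2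
      rw [Real.norm_of_nonneg (one_div_nonneg.2 (by linarith))]
      exact one_div_le_one_div_of_le (hD i) (by linarith)

lemma accessGap_one : accessGap D V 1 = 1 - (∑' i, 1 / D i + V) := by
  simp only [accessGap, add_sub_cancel_left, div_one]; ring

/-- The access probability lies in `(0, 1]`, and the region below it is where the gap is positive. -/
lemma accessProb_spec (hD : ∀ i, 0 < D i) (hs : Summable fun i => 1 / D i) :
    0 < accessProb D V ∧ accessProb D V ≤ 1 ∧
      ∀ a, 0 < a → a < 1 → (a < accessProb D V ↔ 0 < accessGap D V a) := by
  by_cases h : 1 < ∑' i, 1 / D i + V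
  · have hg1 : accessGap D V 1 < 0 := by rw [accessGap_one]; linarith
    set M := ∑' i, 1 / D i + V with hM
    -- Here 1/η₀ = M + 1 exceeds M, which bounds the remaining terms, so the gap is positive at η₀
    -- while it is negative at 1.
    set η₀ : ℝ := 1 / (M + 1) with hη
    have hM0 : 0 < M + 1 := by linarith
    have hη0 : 0 < η₀ := one_div_pos.2 hM0
    have hη1 : η₀ ≤ 1 := by rw [hη, div_le_one hM0]; linarith
    have hg0 : 0 < accessGap D V η₀ := by
      have h2 : ∑' i, 1 / (1 + D i - η₀) ≤ ∑' i, 1 / D i :=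
        Summable.tsum_le_tsum (fun i => one_div_le_one_div_of_le (hD i) (by linarith))
          (summable_accessGap hD hs hη1) hs
      simp only [accessGap]
      rw [hη, one_div_one_div] at *
      linarith
    obtain ⟨η, hηm, hηz⟩ := intermediate_value_Icc' hη1
      ((continuousOn_accessGap (V := V) hD hs).mono fun x hx => ⟨hη0.trans_le hx.1, hx.2⟩)
      (show (0 : ℝ) ∈ Icc _ _ from ⟨hg1.le, hg0.le⟩)
    have hpos : 0 < η := hη0.trans_le hηm.1
    have hlt : η < 1 := lt_of_le_of_ne hηm.2 fun h1 => by rw [h1] at hηz; linarith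
    have hset : {x : ℝ | 0 < x ∧ x < 1 ∧ 1 / x - ∑' i, 1 / (1 + D i - x) - V = 0} = {η} := by
      ext x
      simp only [mem_ofPred_eq, mem_singleton_iff]
      refine ⟨fun ⟨h0, h1, hz⟩ => ?_, fun hx => hx ▸ ⟨hpos, hlt, hηz⟩⟩
      have hz' : accessGap D V x = 0 := hz
      rcases lt_trichotomy x η with hl | hl | hl
      · have := accessGap_strictAnti (V := V) hD hs h0 hl hlt.le; linarith
      · exact hl
      · have := accessGap_strictAnti (V := V) hD hs hpos hl h1.le; linarith
    have hval : accessProb D V = η := by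
      rw [accessProb, if_pos h, hset, csSup_singleton]
    rw [hval]
    refine ⟨hpos, hlt.le, fun a ha0 ha1 => ⟨fun hl => ?_, fun hg => ?_⟩⟩
    · have := accessGap_strictAnti (V := V) hD hs ha0 hl hlt.le; linarith
    · by_contra hle
      rcases (not_lt.1 hle).eq_or_lt with he | hl
      · rw [he] at hηz; linarith
      · have := accessGap_strictAnti (V := V) hD hs hpos hl ha1.le; linarith
  · have hval : accessProb D V = 1 := by rw [accessProb, if_neg h]
    rw [hval]
    refine ⟨one_pos, le_rfl, fun a ha0 ha1 => ⟨fun _ => ?_, fun _ => ha1⟩⟩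
    have h1 := accessGap_strictAnti (V := V) hD hs ha0 ha1 le_rfl
    rw [accessGap_one] at h1
    linarith

end AccessProb

namespace NetworkParams

variable (p : NetworkParams) {S : Set Plane}

/-- The configurations for which the access probability is the solution of its equation. -/
def Tame (c : LinkConfig) : Prop :=
  (∀ j, 0 < p.relLoss (p.receiver c j)) ∧ Summable fun j => 1 / p.relLoss (p.receiver c j)

variable {p}

/-- The set of observed receivers varies with the configuration. Written as an indicator sum over
all receivers, with the term of the typical one split off, the sum is visibly measurable in the
configuration. -/
lemma tsum_observed {c : LinkConfig} (hc : p.Tame c) {a d : ℝ} (ha : a ≤ 1) :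
    Summable (fun o : Option {j : ℕ // p.receiver c j ∈ S} =>
      1 / (1 + o.elim d (fun j => p.relLoss (p.receiver c j)) - a)) ∧
    ∑' o : Option {j : ℕ // p.receiver c j ∈ S},
      1 / (1 + o.elim d (fun j => p.relLoss (p.receiver c j)) - a)
      = 1 / (1 + d - a)
        + ∑' j, S.indicator (fun y => 1 / (1 + p.relLoss y - a)) (p.receiver c j) := by
  set f : Option {j : ℕ // p.receiver c j ∈ S} → ℝ := fun o =>
    1 / (1 + o.elim d (fun j => p.relLoss (p.receiver c j)) - a) with hf
  have hs0 : Summable fun j => 1 / (1 + p.relLoss (p.receiver c j) - a) := by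
    refine Summable.of_nonneg_of_le (fun i => ?_) (fun i => ?_) hc.2
    · have := hc.1 i; exact one_div_nonneg.2 (by linarith)
    · exact one_div_le_one_div_of_le (hc.1 i) (by linarith)
  have hs1 : Summable fun j : {j : ℕ // p.receiver c j ∈ S} => f (some j) :=
    hs0.comp_injective Subtype.val_injective
  have h := ((Equiv.optionEquivSumPUnit.{0} {j : ℕ // p.receiver c j ∈ S}).symm).hasSum_iff
    (f := f) (a := (∑' j : {j : ℕ // p.receiver c j ∈ S}, f (some j)) + f none)
  have h2 : HasSum (f ∘ (Equiv.optionEquivSumPUnit.{0} {j : ℕ // p.receiver c j ∈ S}).symm)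
      ((∑' j : {j : ℕ // p.receiver c j ∈ S}, f (some j)) + f none) := by
    refine HasSum.add_isCompl (s := range Sum.inl) (t := range Sum.inr)
      Set.isCompl_range_inl_range_inr ?_ ?_
    · exact Sum.inl_injective.hasSum_range_iff.2 hs1.hasSum
    · exact Sum.inr_injective.hasSum_range_iff.2 (hasSum_unique _)
  have h3 := h.1 h2
  refine ⟨h3.summable, h3.tsum_eq.trans ?_⟩
  rw [add_comm]
  congr 1
  exact tsum_subtype {j | p.receiver c j ∈ S} fun j => 1 / (1 + p.relLoss (p.receiver c j) - a)

/-- The superlevel sets of the policy are given by the sign of an explicit expression, which removes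
the supremum from sight. Monotonicity in the path loss and measurability in the environment are both
read off from it. -/
lemma policy_spec {c : LinkConfig} (hc : p.Tame c) {d : ℝ} (hd : 0 < d) :
    0 < p.policy S c d ∧ p.policy S c d ≤ 1 ∧ ∀ a, 0 < a → a < 1 → (a < p.policy S c d ↔
      0 < 1 / a - (1 / (1 + d - a)
        + ∑' j, S.indicator (fun y => 1 / (1 + p.relLoss y - a)) (p.receiver c j))
        - p.unobserved S) := by
  have hs := (tsum_observed (S := S) hc (a := 1) (d := d) le_rfl).1
  simp only [add_sub_cancel_left] at hs
  have h := accessProb_spec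
    (D := fun o : Option {j : ℕ // p.receiver c j ∈ S} =>
      o.elim d (fun j => p.relLoss (p.receiver c j)))
    (by rintro (_ | j); exacts [hd, hc.1 j]) hs (V := p.unobserved S)
  refine ⟨h.1, h.2.1, fun a ha0 ha1 => ?_⟩
  rw [← (tsum_observed hc ha1.le).2]
  exact h.2.2 a ha0 ha1

lemma policy_mono {c : LinkConfig} (hc : p.Tame c) {d d' : ℝ} (hd : 0 < d) (hdd : d ≤ d') :
    p.policy S c d ≤ p.policy S c d' := by
  have h := policy_spec (S := S) hc hd
  have h' := policy_spec (S := S) hc (hd.trans_le hdd)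
  refine le_of_forall_lt fun a ha => ?_
  rcases le_or_gt a 0 with h0 | h0
  · exact h0.trans_lt h'.1
  · have h1 : a < 1 := ha.trans_le h.2.1
    rw [h'.2.2 a h0 h1]
    refine ((h.2.2 a h0 h1).1 ha).trans_le ?_
    have : 1 / (1 + d' - a) ≤ 1 / (1 + d - a) :=
      one_div_le_one_div_of_le (by linarith) (by linarith)
    linarith

/-- The superlevel sets are known only for tame configurations, so the policy is set to 1 outside a
measurable set of full measure on which they are tame. -/
lemma aemeasurable_policy (hS : MeasurableSet S) {envLaw : Measure LinkConfig}
    (henv : ∀ᵐ c ∂envLaw, p.Tame c) {d : ℝ} (hd : 0 < d) :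
    AEMeasurable (fun c => p.policy S c d) envLaw := by
  classical
  obtain ⟨G, hG, hGm, hGt⟩ := henv.exists_measurable_mem
  refine ⟨G.piecewise (fun c => p.policy S c d) fun _ => 1, ?_, ?_⟩
  swap
  · filter_upwards [hG] with c hc
    rw [piecewise_eq_of_mem _ _ _ hc]
  refine measurable_of_Ioi fun a => ?_
  have hpos : ∀ c, 0 < G.piecewise (fun c => p.policy S c d) (fun _ => 1) c := by
    intro c
    by_cases hc : c ∈ G
    · rw [piecewise_eq_of_mem _ _ _ hc]; exact (policy_spec (hGt c hc) hd).1
    · rw [piecewise_eq_of_notMem _ _ _ hc]; exact one_pos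
  have hle : ∀ c, G.piecewise (fun c => p.policy S c d) (fun _ => 1) c ≤ 1 := by
    intro c
    by_cases hc : c ∈ G
    · rw [piecewise_eq_of_mem _ _ _ hc]; exact (policy_spec (hGt c hc) hd).2.1
    · rw [piecewise_eq_of_notMem _ _ _ hc]
  rcases le_or_gt a 0 with h0 | h0
  · convert MeasurableSet.univ
    ext c; simpa using h0.trans_lt (hpos c)
  rcases le_or_gt 1 a with h1 | h1
  · convert MeasurableSet.empty
    ext c; simpa using (hle c).trans h1
  have hm : Measurable fun c : LinkConfig => 1 / a - (1 / (1 + d - a)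
        + ∑' j, S.indicator (fun y => 1 / (1 + p.relLoss y - a)) (p.receiver c j))
        - p.unobserved S := by
    have hy : Measurable (S.indicator fun y => 1 / (1 + p.relLoss y - a)) :=
      (((p.measurable_relLoss.const_add 1).sub_const a).const_div 1).indicator hS
    exact ((((Measurable.tsum fun j => hy.comp (p.measurable_receiver j)).const_add _).const_sub
      _).sub_const _)
  have : G.piecewise (fun c => p.policy S c d) (fun _ => 1) ⁻¹' Ioi a
      = Gᶜ ∪ {c | 0 < 1 / a - (1 / (1 + d - a)
        + ∑' j, S.indicator (fun y => 1 / (1 + p.relLoss y - a)) (p.receiver c j))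
        - p.unobserved S} := by
    ext c
    by_cases hc : c ∈ G
    · simp only [mem_preimage, mem_Ioi, piecewise_eq_of_mem _ _ _ hc, mem_union, mem_compl_iff, hc,
        not_true_eq_false, false_or, mem_ofPred_eq]
      exact (policy_spec (hGt c hc) hd).2.2 a h0 h1
    · simp only [mem_preimage, mem_Ioi, piecewise_eq_of_notMem _ _ _ hc, mem_union, mem_compl_iff,
        hc, not_false_eq_true, true_or, iff_true]
      exact h1
  rw [this]
  exact hGm.compl.union (hm measurableSet_Ioi)

lemma integrable_policy (hS : MeasurableSet S) {envLaw : Measure LinkConfig}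
    [IsProbabilityMeasure envLaw] (henv : ∀ᵐ c ∂envLaw, p.Tame c) {d : ℝ} (hd : 0 < d) :
    Integrable (fun c => p.policy S c d) envLaw := by
  refine (integrable_const (1 : ℝ)).mono' (aemeasurable_policy hS henv hd).aestronglyMeasurable ?_
  filter_upwards [henv] with c hc
  have := policy_spec (S := S) hc hd
  rw [Real.norm_of_nonneg this.1.le]
  exact this.2.1

lemma schedZ_pos (hS : MeasurableSet S) {envLaw : Measure LinkConfig}
    [IsProbabilityMeasure envLaw] (henv : ∀ᵐ c ∂envLaw, p.Tame c) {d : ℝ} (hd : 0 < d) :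
    0 < p.schedZ S envLaw d := by
  have hi := integrable_policy hS henv hd
  rw [schedZ, integral_pos_iff_support_of_nonneg_ae ?_ hi]
  · have : ∀ᵐ c ∂envLaw, c ∈ Function.support fun c => p.policy S c d := by
      filter_upwards [henv] with c hc using (policy_spec hc hd).1.ne'
    have h := measure_congr (eventuallyEq_univ.2 this)
    rw [measure_univ] at h
    exact zero_lt_one.trans_eq h.symm
  · filter_upwards [henv] with c hc using (policy_spec hc hd).1.le

lemma schedZ_le_one (hS : MeasurableSet S) {envLaw : Measure LinkConfig}
    [IsProbabilityMeasure envLaw] (henv : ∀ᵐ c ∂envLaw, p.Tame c) {d : ℝ} (hd : 0 < d) :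
    p.schedZ S envLaw d ≤ 1 := by
  have := integral_mono_ae (integrable_policy hS henv hd) (integrable_const (1 : ℝ)) (by
    filter_upwards [henv] with c hc using (policy_spec hc hd).2.1)
  simpa [schedZ] using this

lemma schedZ_mono (hS : MeasurableSet S) {envLaw : Measure LinkConfig}
    [IsProbabilityMeasure envLaw] (henv : ∀ᵐ c ∂envLaw, p.Tame c) {d d' : ℝ} (hd : 0 < d)
    (hdd : d ≤ d') : p.schedZ S envLaw d ≤ p.schedZ S envLaw d' :=
  integral_mono_ae (integrable_policy hS henv hd) (integrable_policy hS henv (hd.trans_le hdd)) (by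
    filter_upwards [henv] with c hc using policy_mono hc hd hdd)

/-- Monotone functions are measurable, and the extension by 0 to nonpositive arguments preserves
monotonicity because the mean access probability is positive. -/
lemma measurable_schedZ (hS : MeasurableSet S) {envLaw : Measure LinkConfig}
    [IsProbabilityMeasure envLaw] (henv : ∀ᵐ c ∂envLaw, p.Tame c) :
    Measurable ((Ioi 0).indicator (p.schedZ S envLaw)) := by
  refine Monotone.measurable fun d d' hdd => ?_
  by_cases hd : 0 < d
  · rw [indicator_of_mem (by exact hd), indicator_of_mem (by exact hd.trans_le hdd)]
    exact schedZ_mono hS henv hd hdd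
  · rw [indicator_of_notMem (by exact hd)]
    exact indicator_nonneg (fun x hx => (schedZ_pos hS henv hx).le) _

end NetworkParams
end

/-! ### The noise rearranged into independent rows, one for each interferer. -/

noncomputable section

section ProductMeasures

/-- Infinite product measures are determined by finite boxes. On a box, integrating out the second
sequence leaves a product of functions of different coordinates of the first, which factors by
independence. -/
lemma measurePreserving_zip_infinitePi {ι A B : Type*} [MeasurableSpace A] [MeasurableSpace B]
    (a : Measure A) (b : Measure B) [IsProbabilityMeasure a] [IsProbabilityMeasure b] :
    MeasurePreserving (fun (q : (ι → A) × (ι → B)) i => (q.1 i, q.2 i))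
      ((Measure.infinitePi fun _ : ι => a).prod (Measure.infinitePi fun _ : ι => b))
      (Measure.infinitePi fun _ : ι => a.prod b) := by
  have hm : Measurable fun (q : (ι → A) × (ι → B)) i => (q.1 i, q.2 i) := by fun_prop
  refine ⟨hm, Measure.eq_infinitePi (fun _ : ι => a.prod b) fun s t ht => ?_⟩
  have hs : MeasurableSet (Set.pi (s : Set ι) t) := MeasurableSet.pi s.countable_toSet fun i _ => ht i
  rw [Measure.map_apply hm hs, Measure.prod_apply (hm hs)]
  have h1 : ∀ u : ι → A, (Measure.infinitePi fun _ : ι => b)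
      (Prod.mk u ⁻¹' ((fun (q : (ι → A) × (ι → B)) i => (q.1 i, q.2 i)) ⁻¹' Set.pi (s : Set ι) t))
      = ∏ i ∈ s, b (Prod.mk (u i) ⁻¹' t i) := fun u =>
    Measure.infinitePi_pi (μ := fun _ : ι => b) (s := s) (t := fun i => Prod.mk (u i) ⁻¹' t i)
      fun i _ => measurable_prodMk_left (ht i)
  simp only [h1]
  have hmi : ∀ i, Measurable fun x => b (Prod.mk x ⁻¹' t i) := fun i =>
    measurable_measure_prodMk_left (ht i)
  have hind : iIndepFun (fun i (u : ι → A) => b (Prod.mk (u i) ⁻¹' t i))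
      (Measure.infinitePi fun _ : ι => a) :=
    iIndepFun_infinitePi (P := fun _ : ι => a) (X := fun i x => b (Prod.mk x ⁻¹' t i)) hmi
  rw [lintegral_prod_eq_prod_lintegral_of_indepFun s _ hind
    fun i => (hmi i).comp (measurable_pi_apply i)]
  refine Finset.prod_congr rfl fun i _ => ?_
  rw [Measure.prod_apply (ht i)]
  exact (measurePreserving_eval_infinitePi (fun _ : ι => a) i).lintegral_comp (hmi i)

end ProductMeasures

section UnitLaws

lemma volume_unitI_le (a : ℝ) : (volume : Measure UnitI) {u | (u : ℝ) ≤ a} = ENNReal.ofReal (min 1 a) := by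
  rw [unitInterval.volume_apply]
  have : (Subtype.val '' {u : UnitI | (u : ℝ) ≤ a}) = Icc 0 (min 1 a) := by
    ext x
    constructor
    · rintro ⟨u, hu, rfl⟩
      exact ⟨u.2.1, le_min u.2.2 hu⟩
    · rintro ⟨h0, h1⟩
      exact ⟨⟨x, h0, h1.trans (min_le_left _ _)⟩, h1.trans (min_le_right _ _), rfl⟩
  rw [this, Real.volume_Icc, sub_zero]

lemma measurableSet_unitI_le (a : ℝ) : MeasurableSet {u : UnitI | (u : ℝ) ≤ a} :=
  measurable_subtype_coe measurableSet_Iic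

instance : IsProbabilityMeasure (expMeasure 1) := isProbabilityMeasure_expMeasure one_pos

lemma expMeasure_one_eq : expMeasure 1
    = (volume.restrict (Ioi (0 : ℝ))).withDensity fun x => ENNReal.ofReal (Real.exp (-x)) := by
  have h : expMeasure 1 = volume.withDensity (exponentialPDF 1) := rfl
  rw [h, ← withDensity_indicator measurableSet_Ioi]
  refine withDensity_congr_ae ?_
  have h0 : ∀ᵐ x : ℝ, x ≠ 0 := by simp [ae_iff]
  filter_upwards [h0] with x hx
  rw [exponentialPDF_eq]
  rcases lt_or_gt_of_ne hx with hl | hl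
  · rw [if_neg (not_le.2 hl), indicator_of_notMem (by exact not_lt.2 hl.le), ENNReal.ofReal_zero]
  · rw [if_pos hl.le, indicator_of_mem (by exact hl)]; simp

lemma integral_expMeasure_one (f : ℝ → ℝ) :
    ∫ x, f x ∂(expMeasure 1) = ∫ x in Ioi (0 : ℝ), Real.exp (-x) * f x := by
  rw [expMeasure_one_eq, integral_withDensity_eq_integral_toReal_smul (by fun_prop) (by simp)]
  simp [ENNReal.toReal_ofReal (Real.exp_pos _).le]

lemma ae_expMeasure_one_pos : ∀ᵐ x ∂(expMeasure 1), 0 < x := by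
  rw [expMeasure_one_eq]
  exact (withDensity_absolutelyContinuous _ _) (ae_restrict_mem measurableSet_Ioi)

lemma integrable_id_expMeasure_one : Integrable (fun x => x) (expMeasure 1) := by
  rw [expMeasure_one_eq, integrable_withDensity_iff_integrable_smul' (by fun_prop) (by simp)]
  have := Real.GammaIntegral_convergent (s := 2) two_pos
  refine this.congr_fun (fun x _ => ?_) measurableSet_Ioi
  simp only [ENNReal.toReal_ofReal (Real.exp_pos _).le, smul_eq_mul]
  norm_num

lemma integral_exp_neg_expMeasure_one {s : ℝ} (hs : 0 ≤ s) :
    ∫ x, Real.exp (-(x * s)) ∂(expMeasure 1) = 1 / (1 + s) := by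
  rw [integral_expMeasure_one]
  have h := integral_exp_mul_Ioi (show -(1 + s) < 0 by linarith) 0
  simp only [mul_zero, Real.exp_zero] at h
  have e : ∀ x, Real.exp (-x) * Real.exp (-(x * s)) = Real.exp (-(1 + s) * x) := by
    intro x; rw [← Real.exp_add]; congr 1; ring
  simp only [e, h]
  rw [neg_div_neg_eq]

lemma expMeasure_one_real_Ioi {k : ℝ} (hk : 0 ≤ k) :
    (expMeasure 1).real (Ioi k) = Real.exp (-k) := by
  have h := cdf_expMeasure_eq (one_pos : (0 : ℝ) < 1) k
  rw [cdf_eq_real, if_pos hk, one_mul] at h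
  rw [← compl_Iic, probReal_compl_eq_one_sub measurableSet_Iic, h]
  ring

end UnitLaws

/-- The random variables of one interferer in one slot: fading, arrival, environment, scheduling
and success. -/
abbrev SlotVars : Type := ℝ × UnitI × LinkConfig × UnitI × UnitI

/-- The law of the random variables of one interferer in one slot. -/
def slotLaw (envLaw : Measure LinkConfig) : Measure SlotVars :=
  (expMeasure 1).prod <| (volume : Measure UnitI).prod <| envLaw.prod <|
    (volume : Measure UnitI).prod volume

section Rows

variable (envLaw : Measure LinkConfig) [IsProbabilityMeasure envLaw]

instance : IsProbabilityMeasure (slotLaw envLaw) := by unfold slotLaw; infer_instance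

/-- The law of the random variables of all interferers in all slots. -/
def rowsLaw : Measure (ℕ → ℕ → SlotVars) :=
  Measure.infinitePi fun _ => Measure.infinitePi fun _ => slotLaw envLaw

instance : IsProbabilityMeasure (rowsLaw envLaw) := by unfold rowsLaw; infer_instance

/-- The noise, sorted by interferer and slot. -/
def toRows (n : (ℕ → ℝ) × (ℕ × ℕ → ℝ) × (ℕ × ℕ → UnitI) × (ℕ × ℕ → LinkConfig) ×
    (ℕ × ℕ → UnitI) × (ℕ × ℕ → UnitI)) : (ℕ → ℝ) × (ℕ → ℕ → SlotVars) :=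
  (n.1, fun j t => (n.2.1 (j, t), n.2.2.1 (j, t), n.2.2.2.1 (j, t), n.2.2.2.2.1 (j, t),
    n.2.2.2.2.2 (j, t)))

/-- The five fields indexed by interferer and slot are zipped into a single field of slot variables,
which is then curried. In this form the interferers are independent, and so are the slots of each.
-/
lemma measurePreserving_toRows : MeasurePreserving toRows (NetworkParams.noiseLaw envLaw)
    ((Measure.infinitePi fun _ => expMeasure 1).prod (rowsLaw envLaw)) := by
  have h1 := measurePreserving_zip_infinitePi (ι := ℕ × ℕ) (volume : Measure UnitI)
    (volume : Measure UnitI)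
  have h2 := (measurePreserving_zip_infinitePi (ι := ℕ × ℕ) envLaw _).comp
    ((MeasurePreserving.id (Measure.infinitePi fun _ : ℕ × ℕ => envLaw)).prod h1)
  have h3 := (measurePreserving_zip_infinitePi (ι := ℕ × ℕ) (volume : Measure UnitI) _).comp
    ((MeasurePreserving.id (Measure.infinitePi fun _ : ℕ × ℕ => (volume : Measure UnitI))).prod h2)
  have h4 := (measurePreserving_zip_infinitePi (ι := ℕ × ℕ) (expMeasure 1) _).comp
    ((MeasurePreserving.id (Measure.infinitePi fun _ : ℕ × ℕ => expMeasure 1)).prod h3)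
  have h5 : MeasurePreserving (MeasurableEquiv.curry ℕ ℕ SlotVars)
      (Measure.infinitePi fun _ : ℕ × ℕ => slotLaw envLaw) (rowsLaw envLaw) :=
    ⟨(MeasurableEquiv.curry ℕ ℕ SlotVars).measurable,
      Measure.infinitePi_map_curry fun _ _ : ℕ => slotLaw envLaw⟩
  exact (MeasurePreserving.id (Measure.infinitePi fun _ : ℕ => expMeasure 1)).prod (h5.comp h4)

end Rows
end

/-! ### A single interferer: slot probabilities and the Laplace transform of its interference. -/

noncomputable section

/-- The slot variables that produce an arrival. -/
def arrivalSet (ξ : ℝ) : Set SlotVars := {e | (e.2.1 : ℝ) ≤ ξ}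

/-- The slot variables for which access is granted, with access probability `q`. -/
def grantSet (q : LinkConfig → ℝ) : Set SlotVars := {e | (e.2.2.2.1 : ℝ) ≤ q e.2.2.1}

/-- The slot variables for which a busy transmitter delivers a packet. -/
def departSet (q : LinkConfig → ℝ) (μ : ℝ) : Set SlotVars :=
  {e | (e.2.2.2.1 : ℝ) ≤ q e.2.2.1 ∧ (e.2.2.2.2 : ℝ) ≤ μ}

open Classical in
/-- The normalized interference of an interferer in slot `t`, with gain `s`. -/
def rowLoss (ξ : ℝ) (q : LinkConfig → ℝ) (μ s : ℝ) (t : ℕ) (w : ℕ → SlotVars) : ℝ :=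
  (w t).1 * s * ((if 0 < drivenQueue (arrivalSet ξ) (departSet q μ) t w then 1 else 0)
    * (if w t ∈ grantSet q then 1 else 0))

section SlotLaw

variable (envLaw : Measure LinkConfig) [IsProbabilityMeasure envLaw] {q : LinkConfig → ℝ}

lemma measurableSet_arrivalSet (ξ : ℝ) : MeasurableSet (arrivalSet ξ) :=
  (measurable_fst.comp measurable_snd) (measurableSet_unitI_le ξ)

lemma measurableSet_grantSet (hq : Measurable q) : MeasurableSet (grantSet q) :=
  measurableSet_le (by fun_prop) (by fun_prop)

lemma measurableSet_departSet (hq : Measurable q) (μ : ℝ) : MeasurableSet (departSet q μ) :=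
  (measurableSet_grantSet hq).inter
    ((measurable_snd.comp (measurable_snd.comp (measurable_snd.comp measurable_snd)))
      (measurableSet_unitI_le μ))

lemma measurableSet_env_grant (hq : Measurable q) (μ : ℝ) :
    MeasurableSet {y : LinkConfig × UnitI × UnitI | (y.2.1 : ℝ) ≤ q y.1 ∧ (y.2.2 : ℝ) ≤ μ} := by
  have h1 : MeasurableSet {y : LinkConfig × UnitI × UnitI | (y.2.1 : ℝ) ≤ q y.1} :=
    measurableSet_le (by fun_prop) (by fun_prop)
  exact h1.inter ((measurable_snd.comp measurable_snd) (measurableSet_unitI_le μ))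

/-- Given the environment, the two uniform numbers are independent and the slice has probability q c
times min 1 μ. Averaging leaves only the mean of `q`, which is how 𝒵 alone comes to describe the
policy. -/
lemma env_prod_grant (hq : Measurable q) (hq0 : ∀ᵐ c ∂envLaw, 0 ≤ q c)
    (hq1 : ∀ᵐ c ∂envLaw, q c ≤ 1) (μ : ℝ) :
    (envLaw.prod ((volume : Measure UnitI).prod (volume : Measure UnitI)))
      {y | (y.2.1 : ℝ) ≤ q y.1 ∧ (y.2.2 : ℝ) ≤ μ}
      = ENNReal.ofReal (∫ c, q c ∂envLaw) * ENNReal.ofReal (min 1 μ) := by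
  have hm := measurableSet_env_grant hq μ
  have hint : Integrable q envLaw := by
    refine (integrable_const (1 : ℝ)).mono' hq.aestronglyMeasurable ?_
    filter_upwards [hq0, hq1] with c h0 h1
    rwa [Real.norm_of_nonneg h0]
  rw [Measure.prod_apply hm, ofReal_integral_eq_lintegral_ofReal hint hq0,
    ← lintegral_mul_const _ hq.ennreal_ofReal]
  refine lintegral_congr_ae ?_
  filter_upwards [hq1] with c h1
  have : Prod.mk c ⁻¹' {y : LinkConfig × UnitI × UnitI | (y.2.1 : ℝ) ≤ q y.1 ∧ (y.2.2 : ℝ) ≤ μ}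
      = {u : UnitI | (u : ℝ) ≤ q c} ×ˢ {u : UnitI | (u : ℝ) ≤ μ} := by
    ext; simp
  rw [this, Measure.prod_prod, volume_unitI_le, volume_unitI_le, min_eq_right h1]

lemma slotLaw_arrivalSet {ξ : ℝ} (h0 : 0 ≤ ξ) (h1 : ξ ≤ 1) :
    (slotLaw envLaw).real (arrivalSet ξ) = ξ := by
  have : arrivalSet ξ = univ ×ˢ ({u : UnitI | (u : ℝ) ≤ ξ} ×ˢ univ) := by ext; simp [arrivalSet]
  rw [measureReal_def, this, slotLaw, Measure.prod_prod, Measure.prod_prod, volume_unitI_le,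
    min_eq_right h1]
  simp [h0]

lemma slotLaw_departSet (hq : Measurable q) (hq0 : ∀ᵐ c ∂envLaw, 0 ≤ q c)
    (hq1 : ∀ᵐ c ∂envLaw, q c ≤ 1) (μ : ℝ) :
    (slotLaw envLaw).real (departSet q μ) = (∫ c, q c ∂envLaw) * max 0 (min 1 μ) := by
  have : departSet q μ = univ ×ˢ (univ ×ˢ
      {y : LinkConfig × UnitI × UnitI | (y.2.1 : ℝ) ≤ q y.1 ∧ (y.2.2 : ℝ) ≤ μ}) := by
    ext; simp [departSet]
  rw [measureReal_def, this, slotLaw, Measure.prod_prod, Measure.prod_prod,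
    env_prod_grant envLaw hq hq0 hq1]
  simp only [measure_univ, one_mul, ENNReal.toReal_mul]
  rw [ENNReal.toReal_ofReal (integral_nonneg_of_ae hq0), ENNReal.toReal_ofReal', max_comm]

lemma slotLaw_arrivalSet_inter {ξ : ℝ} (h0 : 0 ≤ ξ) (h1 : ξ ≤ 1) (hq : Measurable q)
    (hq0 : ∀ᵐ c ∂envLaw, 0 ≤ q c) (hq1 : ∀ᵐ c ∂envLaw, q c ≤ 1) (μ : ℝ) :
    (slotLaw envLaw).real (arrivalSet ξ ∩ departSet q μ)
      = (slotLaw envLaw).real (arrivalSet ξ) * (slotLaw envLaw).real (departSet q μ) := by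
  have : arrivalSet ξ ∩ departSet q μ = univ ×ˢ ({u : UnitI | (u : ℝ) ≤ ξ} ×ˢ
      {y : LinkConfig × UnitI × UnitI | (y.2.1 : ℝ) ≤ q y.1 ∧ (y.2.2 : ℝ) ≤ μ}) := by
    ext; simp [departSet, arrivalSet]
  rw [slotLaw_arrivalSet envLaw h0 h1, slotLaw_departSet envLaw hq hq0 hq1, measureReal_def, this,
    slotLaw, Measure.prod_prod, Measure.prod_prod, env_prod_grant envLaw hq hq0 hq1,
    volume_unitI_le, min_eq_right h1]
  simp only [measure_univ, one_mul, ENNReal.toReal_mul]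
  rw [ENNReal.toReal_ofReal (integral_nonneg_of_ae hq0), ENNReal.toReal_ofReal h0,
    ENNReal.toReal_ofReal', max_comm]

lemma integral_slotLaw_grant (hq : Measurable q) (hq0 : ∀ᵐ c ∂envLaw, 0 ≤ q c)
    (hq1 : ∀ᵐ c ∂envLaw, q c ≤ 1) {s : ℝ} (hs : 0 ≤ s) :
    ∫ e, (1 - Real.exp (-(e.1 * s))) * (grantSet q).indicator 1 e ∂(slotLaw envLaw)
      = (1 - 1 / (1 + s)) * ∫ c, q c ∂envLaw := by
  set B : Set (UnitI × LinkConfig × UnitI × UnitI) := univ ×ˢ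
    {y : LinkConfig × UnitI × UnitI | (y.2.1 : ℝ) ≤ q y.1 ∧ (y.2.2 : ℝ) ≤ 1} with hB
  have hBm : MeasurableSet B := MeasurableSet.univ.prod (measurableSet_env_grant hq 1)
  have e1 : ∀ e : SlotVars, (grantSet q).indicator (1 : SlotVars → ℝ) e = B.indicator 1 e.2 := by
    intro e
    have : e ∈ grantSet q ↔ e.2 ∈ B := by
      simp only [grantSet, hB, mem_ofPred_eq, mem_prod, mem_univ, true_and]
      exact ⟨fun h => ⟨h, e.2.2.2.2.2.2⟩, fun h => h.1⟩
    by_cases h : e ∈ grantSet q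
    · rw [indicator_of_mem h, indicator_of_mem (this.1 h)]; rfl
    · rw [indicator_of_notMem h, indicator_of_notMem fun h' => h (this.2 h')]
  simp only [e1]
  rw [slotLaw, integral_prod_mul (fun h : ℝ => 1 - Real.exp (-(h * s))) (B.indicator 1),
    integral_indicator_one hBm]
  have hi : Integrable (fun h : ℝ => Real.exp (-(h * s))) (expMeasure 1) := by
    refine (integrable_const (1 : ℝ)).mono' (Measurable.aestronglyMeasurable (by fun_prop)) ?_
    filter_upwards [ae_expMeasure_one_pos] with h hh
    rw [Real.norm_of_nonneg (Real.exp_pos _).le, Real.exp_le_one_iff]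
    have := mul_nonneg hh.le hs
    linarith
  rw [integral_sub (integrable_const _) hi, integral_exp_neg_expMeasure_one hs]
  congr 1
  · simp
  · rw [measureReal_def, hB, Measure.prod_prod, env_prod_grant envLaw hq hq0 hq1]
    simp [ENNReal.toReal_ofReal (integral_nonneg_of_ae hq0)]

lemma measurable_rowLoss (hq : Measurable q) (ξ μ s : ℝ) (t : ℕ) :
    Measurable (rowLoss ξ q μ s t) := by
  classical
  unfold rowLoss
  refine Measurable.mul (by fun_prop) (Measurable.mul ?_ ?_)
  · exact Measurable.ite (measurable_drivenQueue (measurableSet_arrivalSet ξ)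
      (measurableSet_departSet hq μ) t (measurableSet_Ioi (a := 0))) measurable_const measurable_const
  · exact Measurable.ite (measurable_pi_apply t (measurableSet_grantSet hq)) measurable_const
      measurable_const

/-- The Laplace transform of the normalized interference of one interferer. -/
lemma integral_exp_neg_rowLoss {ξ : ℝ} (h0 : 0 ≤ ξ) (h1 : ξ ≤ 1) (hq : Measurable q)
    (hq0 : ∀ᵐ c ∂envLaw, 0 ≤ q c) (hq1 : ∀ᵐ c ∂envLaw, q c ≤ 1) (μ : ℝ) {s : ℝ} (hs : 0 ≤ s)
    (t : ℕ) :
    ∫ w, Real.exp (-(rowLoss ξ q μ s t w)) ∂(Measure.infinitePi fun _ : ℕ => slotLaw envLaw)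
      = 1 - queueTail ξ ((∫ c, q c ∂envLaw) * max 0 (min 1 μ)) t 1
        * ((1 - 1 / (1 + s)) * ∫ c, q c ∂envLaw) := by
  set M := Measure.infinitePi fun _ : ℕ => slotLaw envLaw
  have hA := measurableSet_arrivalSet ξ
  have hD := measurableSet_departSet hq μ
  set Q := drivenQueue (arrivalSet ξ) (departSet q μ) t with hQ
  have hQm : Measurable Q := measurable_drivenQueue hA hD t
  set f : ℕ → ℝ := (Ici 1).indicator 1 with hf
  have hfm : Measurable f := measurable_from_top
  set g : SlotVars → ℝ := fun e => (1 - Real.exp (-(e.1 * s))) * (grantSet q).indicator 1 e with hg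
  have hgm : Measurable g := Measurable.mul (by fun_prop)
    (measurable_one.indicator (measurableSet_grantSet hq))
  have hgi : ∀ᵐ e ∂(slotLaw envLaw), ‖g e‖ ≤ 1 := by
    have : ∀ᵐ e ∂(slotLaw envLaw), 0 < e.1 :=
      Measure.quasiMeasurePreserving_fst.ae ae_expMeasure_one_pos
    filter_upwards [this] with e he
    have h1 : Real.exp (-(e.1 * s)) ≤ 1 := by
      rw [Real.exp_le_one_iff]
      have := mul_nonneg he.le hs
      linarith
    have h2 := Real.exp_pos (-(e.1 * s))
    rw [hg, norm_mul, Real.norm_of_nonneg (by linarith)]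
    refine mul_le_one₀ (by linarith) (norm_nonneg _) ?_
    by_cases h : e ∈ grantSet q <;> simp [h]
  -- The loss is nonzero only when the queue is busy and access is granted, so one minus the
  -- exponential splits into a function of the queue length and a function of slot t; these are
  -- independent.
  have hpt : ∀ w : ℕ → SlotVars, Real.exp (-(rowLoss ξ q μ s t w)) = 1 - f (Q w) * g (w t) := by
    intro w
    rw [rowLoss, ← hQ]
    by_cases h1 : 0 < Q w <;> by_cases h2 : w t ∈ grantSet q <;>
      simp [f, g, h1, h2, Nat.one_le_iff_ne_zero, Nat.pos_iff_ne_zero.1]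
    all_goals
      have : Q w = 0 := by omega
      simp [this]
  have hind := indepFun_drivenQueue (slotLaw envLaw) hA hD t
  have hind2 := (hind.comp hfm hgm)
  have hev : MeasurePreserving (fun w : ℕ → SlotVars => w t) M (slotLaw envLaw) :=
    measurePreserving_eval_infinitePi (fun _ : ℕ => slotLaw envLaw) t
  have hfb : ∀ n, ‖f n‖ ≤ 1 := by
    intro n
    by_cases h : n ∈ Ici 1
    · rw [hf, indicator_of_mem h]; simp
    · rw [hf, indicator_of_notMem h]; simp
  have hi : Integrable (fun w => f (Q w) * g (w t)) M := by
    refine (integrable_const (1 : ℝ)).mono' ((hfm.comp hQm).mul (hgm.comp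
      (measurable_pi_apply t))).aestronglyMeasurable ?_
    filter_upwards [hev.quasiMeasurePreserving.ae hgi] with w hw
    rw [norm_mul]
    exact mul_le_one₀ (hfb _) (norm_nonneg _) hw
  simp only [hpt]
  rw [integral_sub (integrable_const _) hi]
  have hmul : ∫ w, f (Q w) * g (w t) ∂M = (∫ w, f (Q w) ∂M) * ∫ w, g (w t) ∂M :=
    hind2.integral_fun_mul_eq_mul_integral (hfm.comp hQm).aestronglyMeasurable
      (hgm.comp (measurable_pi_apply t)).aestronglyMeasurable
  have hg2 : ∫ w, g (w t) ∂M = (1 - 1 / (1 + s)) * ∫ c, q c ∂envLaw := by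
    rw [← integral_slotLaw_grant envLaw hq hq0 hq1 hs, ← hev.map_eq,
      integral_map hev.measurable.aemeasurable hgm.aestronglyMeasurable]
  have hf2 : ∫ w, f (Q w) ∂M = queueTail ξ ((∫ c, q c ∂envLaw) * max 0 (min 1 μ)) t 1 := by
    have h3 := drivenQueue_tail (slotLaw envLaw) hA hD
      (slotLaw_arrivalSet_inter envLaw h0 h1 hq hq0 hq1 μ) t 1
    rw [slotLaw_arrivalSet envLaw h0 h1, slotLaw_departSet envLaw hq hq0 hq1] at h3
    have h4 : ∀ w, f (Q w) = (Q ⁻¹' Ici 1).indicator 1 w := fun w => by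
      by_cases h : 1 ≤ Q w
      · rw [hf, indicator_of_mem (by exact h), indicator_of_mem (by exact h)]; rfl
      · rw [hf, indicator_of_notMem (by exact h), indicator_of_notMem (by exact h)]
    rw [← h3]
    simp only [h4]
    exact integral_indicator_one (hQm measurableSet_Ici)
  rw [hmul, hg2, hf2]
  simp

end SlotLaw
end

/-! ### The success probability given locations and rates, and its limit in time. -/

noncomputable section

/-- In the extreme case a = 1 / (1 + d) one has 1 - a = (1 + 1/d)⁻¹. The majorant involves neither
time, nor rates, nor the policy. -/
lemma abs_log_one_sub_le {a d : ℝ} (hd : 0 < d) (h0 : 0 ≤ a) (h1 : a ≤ 1 / (1 + d)) :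
    |Real.log (1 - a)| ≤ Real.log (1 + 1 / d) := by
  have h2 : 1 / (1 + d) < 1 := by rw [div_lt_one (by linarith)]; linarith
  rw [abs_of_nonpos (Real.log_nonpos (by linarith) (by linarith)), ← Real.log_inv]
  refine Real.log_le_log (inv_pos.2 (by linarith)) ?_
  rw [inv_le_comm₀ (by linarith) (by positivity)]
  have : (1 + 1 / d)⁻¹ = 1 - 1 / (1 + d) := by field_simp; ring
  linarith

lemma log_one_add_inv_le {d : ℝ} (hd : 0 < d) : Real.log (1 + 1 / d) ≤ 1 / d := by
  have h : 0 < 1 / d := by positivity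
  have := Real.log_le_sub_one_of_pos (show 0 < 1 + 1 / d by linarith)
  linarith

namespace NetworkParams

variable {p : NetworkParams} {S : Set Plane} {envLaw : Measure LinkConfig}

/-- The exponent due to the thermal noise. -/
def noiseExponent (p : NetworkParams) : ℝ := p.T * p.r ^ p.α / p.ρ

lemma noiseExponent_pos (p : NetworkParams) : 0 < p.noiseExponent :=
  div_pos p.refLoss_pos (div_pos p.Ptx_pos p.noiseVar_pos)

lemma queue_eq_queueLength (x : ℕ → Plane) (m : ℕ → ℝ) (n : Noise) (j t : ℕ) :
    queue p S x m n j t = queueLength {i | (n.arr (j, i) : ℝ) ≤ p.ξ}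
      {i | IsScheduled p S x n j i ∧ (n.succ (j, i) : ℝ) ≤ m j} t := by
  classical
  induction t with
  | zero => rfl
  | succ t ih =>
    rw [queue, queueLength, ih]
    by_cases h1 : IsScheduled p S x n j t ∧ (n.succ (j, t) : ℝ) ≤ m j <;>
      by_cases h2 : (n.arr (j, t) : ℝ) ≤ p.ξ <;> simp [h1, h2]

/-- The normalized interference plus noise, as a function of the sorted noise. -/
def totalLoss (p : NetworkParams) (q : ℕ → LinkConfig → ℝ) (x : ℕ → Plane) (m : ℕ → ℝ) (t : ℕ)
    (w : ℕ → ℕ → SlotVars) : ℝ :=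
  p.noiseExponent + ∑' j, rowLoss p.ξ (q j) (m j) (1 / p.relLoss (x j)) t (w j)

/-- Rearranging the inequality isolates the fading of the typical link. Here `q` stands for a
version of the policy that agrees with it on the sampled environments; positive fadings and positive
thermal noise keep the denominator positive. -/
lemma lt_SINR_iff {q : ℕ → LinkConfig → ℝ} {x : ℕ → Plane} {m : ℕ → ℝ} {t : ℕ}
    {n : (ℕ → ℝ) × (ℕ × ℕ → ℝ) × (ℕ × ℕ → UnitI) × (ℕ × ℕ → LinkConfig) ×
      (ℕ × ℕ → UnitI) × (ℕ × ℕ → UnitI)}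
    (hx : ∀ j, 0 < p.relLoss (x j))
    (hn : ∀ j i, 0 < n.2.1 (j, i) ∧
      p.policy S (n.2.2.2.1 (j, i)) (p.relLoss (x j)) = q j (n.2.2.2.1 (j, i))) :
    p.T < SINR p S x m (Noise.ofProd n) t ↔ totalLoss p q x m t (toRows n).2 < n.1 t := by
  classical
  have hsched : ∀ j i, IsScheduled p S x (Noise.ofProd n) j i ↔ (toRows n).2 j i ∈ grantSet (q j) := by
    intro j i
    simp only [IsScheduled, Noise.ofProd, (hn j i).2]
    rfl
  have hqueue : ∀ j, queue p S x m (Noise.ofProd n) j t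
      = drivenQueue (arrivalSet p.ξ) (departSet (q j) (m j)) t ((toRows n).2 j) := by
    intro j
    rw [queue_eq_queueLength, drivenQueue]
    refine queueLength_congr (fun i _ => Iff.rfl) fun i _ => ?_
    simp only [mem_ofPred_eq, hsched]
    rfl
  have hr : 0 < p.r ^ p.α := Real.rpow_pos_of_pos p.r_pos _
  have hT := p.T_pos
  have hP := p.Ptx_pos
  set a : ℕ → ℝ := fun j => p.Ptx * n.2.1 (j, t) * (if 0 < queue p S x m (Noise.ofProd n) j t
    then 1 else 0) * (if IsScheduled p S x (Noise.ofProd n) j t then 1 else 0) * ‖x j‖ ^ (-p.α)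
    with ha
  have hterm : ∀ j, rowLoss p.ξ (q j) (m j) (1 / p.relLoss (x j)) t ((toRows n).2 j)
      = p.T * p.r ^ p.α / p.Ptx * a j := by
    intro j
    have hxn : 0 < ‖x j‖ ^ p.α := Real.rpow_pos_of_pos (norm_pos_iff.2 (p.relLoss_pos_iff.1 (hx j))) _
    simp only [rowLoss, ha, hqueue, hsched]
    rw [relLoss, Real.rpow_neg (norm_nonneg _)]
    have : ((toRows n).2 j t).1 = n.2.1 (j, t) := rfl
    rw [this]
    by_cases h1 : 0 < drivenQueue (arrivalSet p.ξ) (departSet (q j) (m j)) t ((toRows n).2 j) <;>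
      by_cases h2 : (toRows n).2 j t ∈ grantSet (q j) <;> simp [h1, h2]
    field_simp
  have hI : 0 ≤ ∑' j, a j := by
    refine tsum_nonneg fun j => ?_
    have := (hn j t).1
    simp only [ha]
    have h2 : 0 ≤ ‖x j‖ ^ (-p.α) := Real.rpow_nonneg (norm_nonneg _) _
    split_ifs <;> simp 
    positivity
  have hS : SINR p S x m (Noise.ofProd n) t = p.Ptx * n.1 t * p.r ^ (-p.α) / (∑' j, a j + p.noiseVar) :=
    rfl
  have hden : 0 < ∑' j, a j + p.noiseVar := by have := p.noiseVar_pos; linarith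
  have hK : totalLoss p q x m t (toRows n).2 = p.T * p.r ^ p.α / p.Ptx * (∑' j, a j + p.noiseVar) := by
    rw [totalLoss]
    simp only [hterm]
    rw [tsum_mul_left, noiseExponent, ρ]
    have := p.noiseVar_pos
    field_simp
    ring
  rw [hS, hK, lt_div_iff₀ hden, Real.rpow_neg p.r_pos.le]
  constructor
  · intro h
    have : p.T * p.r ^ p.α / p.Ptx * (∑' j, a j + p.noiseVar)
        = p.r ^ p.α / p.Ptx * (p.T * (∑' j, a j + p.noiseVar)) := by ring
    rw [this]
    refine (mul_lt_mul_of_pos_left h (div_pos hr hP)).trans_eq ?_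
    field_simp
  · intro h
    have h2 := mul_lt_mul_of_pos_left h (div_pos hP hr)
    refine lt_of_eq_of_lt ?_ (h2.trans_eq ?_) <;> field_simp

variable [IsProbabilityMeasure envLaw]

lemma rowsLaw_ae_all {Q : ℕ → SlotVars → Prop} (h : ∀ j, ∀ᵐ e ∂(slotLaw envLaw), Q j e) :
    ∀ᵐ w ∂(rowsLaw envLaw), ∀ j i, Q j (w j i) := by
  refine ae_all_iff.2 fun j => ae_all_iff.2 fun i => ?_
  have h1 : MeasurePreserving (fun w : ℕ → SlotVars => w i) (Measure.infinitePi fun _ : ℕ => slotLaw envLaw)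
      (slotLaw envLaw) := measurePreserving_eval_infinitePi (fun _ : ℕ => slotLaw envLaw) i
  have h2 : MeasurePreserving (fun w : ℕ → ℕ → SlotVars => w j) (rowsLaw envLaw)
      (Measure.infinitePi fun _ : ℕ => slotLaw envLaw) :=
    measurePreserving_eval_infinitePi (fun _ : ℕ => Measure.infinitePi fun _ : ℕ => slotLaw envLaw) j
  exact (h1.comp h2).quasiMeasurePreserving.ae (h j)

omit [IsProbabilityMeasure envLaw] in
lemma ae_slotLaw_env {Q : LinkConfig → Prop} (h : ∀ᵐ c ∂envLaw, Q c) :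
    ∀ᵐ e ∂(slotLaw envLaw), Q e.2.2.1 := by
  have h1 : ∀ᵐ y ∂(envLaw.prod ((volume : Measure UnitI).prod (volume : Measure UnitI))), Q y.1 :=
    Measure.quasiMeasurePreserving_fst.ae h
  have h2 : ∀ᵐ y ∂((volume : Measure UnitI).prod (envLaw.prod
      ((volume : Measure UnitI).prod (volume : Measure UnitI)))), Q y.2.1 :=
    Measure.quasiMeasurePreserving_snd.ae h1
  exact Measure.quasiMeasurePreserving_snd.ae h2

/-- The fadings have finite mean, so the series has finite mean as well. Without summability the
interference sum would take the default value 0, and the factorization over interferers would not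
follow from finite products. -/
lemma ae_summable_fading {D : ℕ → ℝ} (hD : ∀ j, 0 < D j) (hs : Summable fun j => 1 / D j) (t : ℕ) :
    ∀ᵐ w ∂(rowsLaw envLaw), Summable fun j => (w j t).1 * (1 / D j) := by
  have hpos : ∀ᵐ w ∂(rowsLaw envLaw), ∀ j i, 0 < (w j i).1 :=
    rowsLaw_ae_all fun _ => Measure.quasiMeasurePreserving_fst.ae ae_expMeasure_one_pos
  have hm : ∀ j, Measurable fun w : ℕ → ℕ → SlotVars => ENNReal.ofReal ((w j t).1 * (1 / D j)) :=
    fun j => by fun_prop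
  have hmarg : ∀ j, MeasurePreserving (fun w : ℕ → ℕ → SlotVars => (w j t).1) (rowsLaw envLaw)
      (expMeasure 1) := by
    intro j
    have h1 : MeasurePreserving (fun w : ℕ → SlotVars => w t) (Measure.infinitePi fun _ : ℕ => slotLaw envLaw)
        (slotLaw envLaw) := measurePreserving_eval_infinitePi (fun _ : ℕ => slotLaw envLaw) t
    have h2 : MeasurePreserving (fun w : ℕ → ℕ → SlotVars => w j) (rowsLaw envLaw)
        (Measure.infinitePi fun _ : ℕ => slotLaw envLaw) :=
      measurePreserving_eval_infinitePi (fun _ : ℕ => Measure.infinitePi fun _ : ℕ => slotLaw envLaw) j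
    exact measurePreserving_fst.comp (h1.comp h2)
  have hval : ∀ j, ∫⁻ w, ENNReal.ofReal ((w j t).1 * (1 / D j)) ∂(rowsLaw envLaw)
      = ENNReal.ofReal (1 / D j) * ∫⁻ h, ENNReal.ofReal h ∂(expMeasure 1) := by
    intro j
    rw [← lintegral_const_mul _ (by fun_prop), ← (hmarg j).lintegral_comp (by fun_prop)]
    congr 1; ext w
    rw [mul_comm, ENNReal.ofReal_mul (one_div_nonneg.2 (hD j).le)]
  have hlt : ∫⁻ w, ∑' j, ENNReal.ofReal ((w j t).1 * (1 / D j)) ∂(rowsLaw envLaw) < ⊤ := by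
    rw [lintegral_tsum fun j => (hm j).aemeasurable]
    simp only [hval]
    rw [ENNReal.tsum_mul_right]
    refine ENNReal.mul_lt_top hs.tsum_ofReal_lt_top ?_
    exact (hasFiniteIntegral_iff_ofReal (ae_expMeasure_one_pos.mono fun _ h => h.le)).1
      integrable_id_expMeasure_one.2
  filter_upwards [hpos, ae_lt_top (Measurable.tsum hm) hlt.ne] with w hw hω
  refine (ENNReal.summable_toReal hω.ne).congr fun j => ?_
  exact ENNReal.toReal_ofReal (mul_nonneg (hw j t).le (one_div_nonneg.2 (hD j).le))

/-- The activity probability, discounted by the path loss, of an interferer in slot `t`. -/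
def slotActivity (p : NetworkParams) (z m d : ℝ) (t : ℕ) : ℝ :=
  queueTail p.ξ (z * max 0 (min 1 m)) t 1 * (z / (1 + d))

lemma slotActivity_bounds {z m d : ℝ} (hz0 : 0 ≤ z) (hz1 : z ≤ 1) (hd : 0 < d) (t : ℕ) :
    0 ≤ p.slotActivity z m d t ∧ p.slotActivity z m d t ≤ 1 / (1 + d) := by
  have hm0 : 0 ≤ max 0 (min 1 m) := le_max_left _ _
  have hm1 : max 0 (min 1 m) ≤ 1 := max_le zero_le_one (min_le_left _ _)
  have hs0 := mul_nonneg hz0 hm0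
  have hs1 : z * max 0 (min 1 m) ≤ 1 := mul_le_one₀ hz1 hm0 hm1
  have h0 := queueTail_nonneg p.ξ_pos.le p.ξ_le_one hs0 hs1 t 1
  have h1 := queueTail_le_one p.ξ_pos.le p.ξ_le_one hs0 hs1 t 1
  have h2 : 0 ≤ z / (1 + d) := by positivity
  refine ⟨mul_nonneg h0 h2, (mul_le_of_le_one_left h2 h1).trans ?_⟩
  gcongr

/-- The conditional success probability in slot `t`. -/
theorem successProbAt_eq (hS : MeasurableSet S) (henv : ∀ᵐ c ∂envLaw, p.Tame c) {x : ℕ → Plane}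
    (m : ℕ → ℝ) (hx : ∀ j, 0 < p.relLoss (x j)) (hxs : Summable fun j => 1 / p.relLoss (x j))
    (t : ℕ) :
    p.successProbAt S envLaw x m t = Real.exp (-p.noiseExponent + ∑' j, Real.log
      (1 - p.slotActivity (p.schedZ S envLaw (p.relLoss (x j))) (m j) (p.relLoss (x j)) t)) := by
  have haem := fun j => aemeasurable_policy hS henv (hx j)
  -- The policy is only almost everywhere measurable in the environment; passing to measurable
  -- versions changes the events by null sets.
  set q : ℕ → LinkConfig → ℝ := fun j => (haem j).mk _ with hq
  have hqm : ∀ j, Measurable (q j) := fun j => (haem j).measurable_mk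
  have hqe : ∀ j, ∀ᵐ c ∂envLaw, p.policy S c (p.relLoss (x j)) = q j c := fun j => (haem j).ae_eq_mk
  have hq0 : ∀ j, ∀ᵐ c ∂envLaw, 0 ≤ q j c := by
    intro j
    filter_upwards [hqe j, henv] with c h1 h2
    rw [← h1]; exact (policy_spec h2 (hx j)).1.le
  have hq1 : ∀ j, ∀ᵐ c ∂envLaw, q j c ≤ 1 := by
    intro j
    filter_upwards [hqe j, henv] with c h1 h2
    rw [← h1]; exact (policy_spec h2 (hx j)).2.1
  have hqz : ∀ j, ∫ c, q j c ∂envLaw = p.schedZ S envLaw (p.relLoss (x j)) := fun j =>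
    (integral_congr_ae (hqe j)).symm
  have hpos : ∀ᵐ w ∂(rowsLaw envLaw), ∀ j i, 0 < (w j i).1 :=
    rowsLaw_ae_all fun _ => Measure.quasiMeasurePreserving_fst.ae ae_expMeasure_one_pos
  have hpol : ∀ᵐ w ∂(rowsLaw envLaw), ∀ j i,
      p.policy S (w j i).2.2.1 (p.relLoss (x j)) = q j (w j i).2.2.1 :=
    rowsLaw_ae_all fun j => ae_slotLaw_env (hqe j)
  have hmK : ∀ j, Measurable fun w : ℕ → ℕ → SlotVars =>
      rowLoss p.ξ (q j) (m j) (1 / p.relLoss (x j)) t (w j) := fun j =>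
    (measurable_rowLoss (hqm j) _ _ _ t).comp (measurable_pi_apply j)
  have hKm : Measurable (totalLoss p q x m t) := (Measurable.tsum hmK).const_add _
  -- reduction to the sorted noise
  have h1 : p.successProbAt S envLaw x m t
      = ((expMeasure 1).prod (rowsLaw envLaw)).real {y | totalLoss p q x m t y.2 < y.1} := by
    have hmp : MeasurePreserving
        (Prod.map (fun h : ℕ → ℝ => h t) (id : (ℕ → ℕ → SlotVars) → _) ∘ toRows)
        (noiseLaw envLaw) ((expMeasure 1).prod (rowsLaw envLaw)) :=
      ((measurePreserving_eval_infinitePi (fun _ : ℕ => expMeasure 1) t).prod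
        (MeasurePreserving.id _)).comp (measurePreserving_toRows envLaw)
    have hms : MeasurableSet {y : ℝ × (ℕ → ℕ → SlotVars) | totalLoss p q x m t y.2 < y.1} :=
      measurableSet_lt (hKm.comp measurable_snd) measurable_fst
    rw [measureReal_def, ← hmp.measure_preimage hms.nullMeasurableSet, successProbAt, measureReal_def]
    congr 1
    refine measure_congr ?_
    have hall : ∀ᵐ n ∂(noiseLaw envLaw), ∀ j i, 0 < n.2.1 (j, i) ∧
        p.policy S (n.2.2.2.1 (j, i)) (p.relLoss (x j)) = q j (n.2.2.2.1 (j, i)) := by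
      have h2 : ∀ᵐ y ∂((Measure.infinitePi fun _ : ℕ => expMeasure 1).prod (rowsLaw envLaw)),
          ∀ j i, 0 < (y.2 j i).1 ∧
            p.policy S (y.2 j i).2.2.1 (p.relLoss (x j)) = q j (y.2 j i).2.2.1 := by
        refine Measure.quasiMeasurePreserving_snd.ae
          (p := fun w : ℕ → ℕ → SlotVars => ∀ j i, 0 < (w j i).1 ∧
            p.policy S (w j i).2.2.1 (p.relLoss (x j)) = q j (w j i).2.2.1) ?_
        filter_upwards [hpos, hpol] with w hw1 hw2 j i using ⟨hw1 j i, hw2 j i⟩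
      exact (measurePreserving_toRows envLaw).quasiMeasurePreserving.ae h2
    filter_upwards [hall] with n hn
    exact propext (lt_SINR_iff hx hn)
  have hKnn : ∀ᵐ w ∂(rowsLaw envLaw), 0 ≤ totalLoss p q x m t w := by
    filter_upwards [hpos] with w hw
    refine add_nonneg p.noiseExponent_pos.le (tsum_nonneg fun j => ?_)
    rw [rowLoss]
    have h2 := (hw j t).le
    have h3 := one_div_nonneg.2 (hx j).le
    refine mul_nonneg (mul_nonneg h2 h3) (mul_nonneg ?_ ?_) <;> split_ifs <;> norm_num
  -- Integrating out the fading of the typical link, which exceeds a level K ≥ 0 with probability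
  -- exp (-K).
  have h2 : p.successProbAt S envLaw x m t
      = ∫ w, Real.exp (-(totalLoss p q x m t w)) ∂(rowsLaw envLaw) := by
    have hms : MeasurableSet {y : ℝ × (ℕ → ℕ → SlotVars) | totalLoss p q x m t y.2 < y.1} :=
      measurableSet_lt (hKm.comp measurable_snd) measurable_fst
    rw [h1, measureReal_def, Measure.prod_apply_symm hms, integral_eq_lintegral_of_nonneg_ae
      (Eventually.of_forall fun w => (Real.exp_pos _).le) (by fun_prop)]
    congr 1
    refine lintegral_congr_ae ?_
    filter_upwards [hKnn] with w hw
    rw [← expMeasure_one_real_Ioi hw, measureReal_def, ENNReal.ofReal_toReal (measure_ne_top _ _)]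
    rfl
  -- independence of the interferers
  set a : ℕ → ℝ := fun j =>
    p.slotActivity (p.schedZ S envLaw (p.relLoss (x j))) (m j) (p.relLoss (x j)) t with ha
  have hprod : ∀ n, ∫ w, ∏ j ∈ Finset.range n,
      Real.exp (-(rowLoss p.ξ (q j) (m j) (1 / p.relLoss (x j)) t (w j))) ∂(rowsLaw envLaw)
      = ∏ j ∈ Finset.range n, (1 - a j) := by
    intro n
    have hind : iIndepFun (fun (j : ℕ) (w : ℕ → ℕ → SlotVars) => w j) (rowsLaw envLaw) :=
      iIndepFun_infinitePi (P := fun _ : ℕ => Measure.infinitePi fun _ : ℕ => slotLaw envLaw)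
        (X := fun _ w => w) fun _ => measurable_id
    have hind2 : iIndepFun (fun (i : Fin n) (w : ℕ → ℕ → SlotVars) => w (i : ℕ)) (rowsLaw envLaw) :=
      hind.precomp Fin.val_injective
    have h3 := iIndepFun.integral_fun_prod_comp
      (X := fun (i : Fin n) (w : ℕ → ℕ → SlotVars) => w (i : ℕ)) (f := fun (i : Fin n) w => Real.exp (-(rowLoss p.ξ (q i) (m i) (1 / p.relLoss (x i)) t w)))
      hind2 (fun i => (measurable_pi_apply (i : ℕ)).aemeasurable)
      (fun i => (Real.measurable_exp.comp
        (measurable_rowLoss (hqm i) _ _ _ t).neg).aestronglyMeasurable)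
    simp only [Finset.prod_range]
    refine h3.trans (Finset.prod_congr rfl fun i _ => ?_)
    have h4 : MeasurePreserving (fun w : ℕ → ℕ → SlotVars => w i) (rowsLaw envLaw)
        (Measure.infinitePi fun _ : ℕ => slotLaw envLaw) :=
      measurePreserving_eval_infinitePi (fun _ : ℕ => Measure.infinitePi fun _ : ℕ => slotLaw envLaw) i
    have h5 := integral_map (μ := rowsLaw envLaw) h4.measurable.aemeasurable
      (f := fun w => Real.exp (-(rowLoss p.ξ (q i) (m i) (1 / p.relLoss (x i)) t w)))
      (Real.measurable_exp.comp (measurable_rowLoss (hqm i) _ _ _ t).neg).aestronglyMeasurable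
    rw [← h5, h4.map_eq, integral_exp_neg_rowLoss envLaw p.ξ_pos.le p.ξ_le_one (hqm i) (hq0 i) (hq1 i)
      (m i) (one_div_nonneg.2 (hx i).le), hqz]
    simp only [ha, slotActivity]
    congr 2
    have := hx i
    field_simp
    ring
  have hfact : ∀ᵐ w ∂(rowsLaw envLaw), ∀ j,
      0 ≤ rowLoss p.ξ (q j) (m j) (1 / p.relLoss (x j)) t (w j) ∧
      rowLoss p.ξ (q j) (m j) (1 / p.relLoss (x j)) t (w j) ≤ (w j t).1 * (1 / p.relLoss (x j)) := by
    filter_upwards [hpos] with w hw j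
    have h4 := mul_nonneg (hw j t).le (one_div_nonneg.2 (hx j).le)
    rw [rowLoss]
    split_ifs <;> simp <;> simpa using h4
  have hlim1 : Tendsto (fun n => ∫ w, Real.exp (-p.noiseExponent) * ∏ j ∈ Finset.range n,
      Real.exp (-(rowLoss p.ξ (q j) (m j) (1 / p.relLoss (x j)) t (w j))) ∂(rowsLaw envLaw)) atTop
      (𝓝 (p.successProbAt S envLaw x m t)) := by
    rw [h2]
    refine tendsto_integral_of_dominated_convergence (fun _ => 1) (fun n => ?_) (integrable_const _)
      (fun n => ?_) ?_
    · exact ((Finset.measurable_fun_prod _ fun j _ =>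
        Real.measurable_exp.comp (hmK j).neg).const_mul _).aestronglyMeasurable
    · filter_upwards [hfact] with w hw
      rw [← Real.exp_sum, ← Real.exp_add, Real.norm_of_nonneg (Real.exp_pos _).le,
        Real.exp_le_one_iff, Finset.sum_neg_distrib]
      have := Finset.sum_nonneg fun j (_ : j ∈ Finset.range n) => (hw j).1
      linarith [p.noiseExponent_pos]
    · filter_upwards [hfact, ae_summable_fading hx hxs t] with w hw hws
      have hsum : Summable fun j => rowLoss p.ξ (q j) (m j) (1 / p.relLoss (x j)) t (w j) :=
        Summable.of_nonneg_of_le (fun j => (hw j).1) (fun j => (hw j).2) hws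
      have h3 := (Real.continuous_exp.tendsto _).comp
        ((hsum.hasSum.tendsto_sum_nat.neg).const_add (-p.noiseExponent))
      have e : totalLoss p q x m t w = p.noiseExponent
        + ∑' j, rowLoss p.ξ (q j) (m j) (1 / p.relLoss (x j)) t (w j) := rfl
      rw [e, neg_add]
      refine h3.congr fun n => ?_
      simp only [Function.comp]
      rw [Real.exp_add, ← Finset.sum_neg_distrib, Real.exp_sum]
  have hab : ∀ j, 0 ≤ a j ∧ a j ≤ 1 / (1 + p.relLoss (x j)) := fun j =>
    slotActivity_bounds (schedZ_pos hS henv (hx j)).le (schedZ_le_one hS henv (hx j)) (hx j) t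
  have hlogs : Summable fun j => Real.log (1 - a j) := by
    refine Summable.of_norm_bounded hxs fun j => ?_
    exact (abs_log_one_sub_le (hx j) (hab j).1 (hab j).2).trans (log_one_add_inv_le (hx j))
  have hlim2 : Tendsto (fun n => Real.exp (-p.noiseExponent) * ∏ j ∈ Finset.range n, (1 - a j)) atTop
      (𝓝 (Real.exp (-p.noiseExponent + ∑' j, Real.log (1 - a j)))) := by
    have h3 := (Real.continuous_exp.tendsto _).comp
      (hlogs.hasSum.tendsto_sum_nat.const_add (-p.noiseExponent))
    refine h3.congr fun n => ?_
    simp only [Function.comp]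
    rw [Real.exp_add, Real.exp_sum]
    congr 1
    refine Finset.prod_congr rfl fun j _ => Real.exp_log ?_
    have h4 : 1 / (1 + p.relLoss (x j)) < 1 := by
      rw [div_lt_one (by linarith [hx j])]; linarith [hx j]
    linarith [(hab j).2]
  -- The integrals over finitely many interferers tend to the success probability by dominated
  -- convergence, and to the infinite product by independence.
  refine tendsto_nhds_unique hlim1 (hlim2.congr fun n => ?_)
  rw [integral_const_mul, hprod]

/-- The activity probability, discounted by the path loss, in steady state. -/
def activity (p : NetworkParams) (z m d : ℝ) : ℝ :=
  busyLimit p.ξ (z * max 0 (min 1 m)) * (z / (1 + d))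

lemma tendsto_slotActivity {z : ℝ} (hz0 : 0 ≤ z) (hz1 : z ≤ 1) (m d : ℝ) :
    Tendsto (p.slotActivity z m d) atTop (𝓝 (p.activity z m d)) := by
  have hm0 : 0 ≤ max 0 (min 1 m) := le_max_left _ _
  have hm1 : max 0 (min 1 m) ≤ 1 := max_le zero_le_one (min_le_left _ _)
  exact (tendsto_queueTail_one p.ξ_pos p.ξ_le_one (mul_nonneg hz0 hm0)
    (mul_le_one₀ hz1 hm0 hm1)).mul_const _

lemma activity_bounds {z m d : ℝ} (hz0 : 0 ≤ z) (hz1 : z ≤ 1) (hd : 0 < d) :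
    0 ≤ p.activity z m d ∧ p.activity z m d ≤ 1 / (1 + d) :=
  ⟨ge_of_tendsto' (tendsto_slotActivity hz0 hz1 m d) fun t => (slotActivity_bounds hz0 hz1 hd t).1,
    le_of_tendsto' (tendsto_slotActivity hz0 hz1 m d) fun t => (slotActivity_bounds hz0 hz1 hd t).2⟩

/-- Each factor converges because its queue settles, and the summable gains bound the logarithms
uniformly in time; hence dominated convergence for the series. -/
theorem tendsto_successProbAt (hS : MeasurableSet S) (henv : ∀ᵐ c ∂envLaw, p.Tame c)
    {x : ℕ → Plane} (m : ℕ → ℝ) (hx : ∀ j, 0 < p.relLoss (x j))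
    (hxs : Summable fun j => 1 / p.relLoss (x j)) :
    Tendsto (p.successProbAt S envLaw x m) atTop (𝓝 (Real.exp (-p.noiseExponent + ∑' j, Real.log
      (1 - p.activity (p.schedZ S envLaw (p.relLoss (x j))) (m j) (p.relLoss (x j)))))) := by
  have hz0 := fun j => (schedZ_pos hS henv (hx j)).le
  have hz1 := fun j => schedZ_le_one hS henv (hx j)
  rw [show p.successProbAt S envLaw x m = _ from
    funext fun t => successProbAt_eq hS henv m hx hxs t]
  refine (Real.continuous_exp.tendsto _).comp (Tendsto.const_add _ ?_)
  refine tendsto_tsum_of_dominated_convergence hxs (fun j => ?_) (Eventually.of_forall fun t j => ?_)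
  · refine Tendsto.log ((tendsto_slotActivity (hz0 j) (hz1 j) _ _).const_sub 1) ?_
    have h1 := (activity_bounds (p := p) (m := m j) (hz0 j) (hz1 j) (hx j)).2
    have h4 : 1 / (1 + p.relLoss (x j)) < 1 := by
      rw [div_lt_one (by linarith [hx j])]; linarith [hx j]
    linarith
  · have h := slotActivity_bounds (p := p) (m := m j) (hz0 j) (hz1 j) (hx j) t
    exact (abs_log_one_sub_le (hx j) h.1 h.2).trans (log_one_add_inv_le (hx j))

end NetworkParams
end

/-! ### The binomial series at an imaginary exponent and the moments of the activity. -/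

noncomputable section

section BinomialSeries

/-- Consecutive coefficients differ by the factor (iw - k) / (k + 1), and |iw - k| = k √(1 + w²/k²)
≤ k exp (w²/k²) for k ≥ 1. The correction factors have a convergent product, so the decay 1/k
remains. This is the rate of the coefficients of -log (1 - a), which makes the integrated series
converge absolutely. -/
lemma exists_norm_choose_le (w : ℝ) :
    ∃ C : ℝ, 0 ≤ C ∧ ∀ k : ℕ, ‖Ring.choose (Complex.I * w) (k + 1)‖ ≤ C / (k + 1) := by
  set s : ℂ := Complex.I * w with hs
  have hsum : Summable fun i : ℕ => w ^ 2 / ((i : ℝ) + 1) ^ 2 := by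
    have h := (summable_nat_add_iff 1).2 (Real.summable_one_div_nat_pow.2 one_lt_two)
    refine (h.mul_left (w ^ 2)).congr fun i => ?_
    push_cast; ring
  have hstep : ∀ k : ℕ, ((k : ℂ) + 1) * Ring.choose s (k + 1) = Ring.choose s k * (s - k) := by
    intro k
    have h1 := Ring.descPochhammer_eq_factorial_smul_choose s (k + 1)
    have h2 := Ring.descPochhammer_eq_factorial_smul_choose s k
    rw [descPochhammer_succ_right, Polynomial.smeval_mul, h2] at h1
    have h3 : (Polynomial.X - (k : Polynomial ℤ)).smeval s = s - k := by
      simp [Polynomial.smeval_sub, Polynomial.smeval_natCast]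
    rw [h3, nsmul_eq_mul, nsmul_eq_mul, Nat.factorial_succ] at h1
    have h4 : ((k.factorial : ℕ) : ℂ) ≠ 0 := by exact_mod_cast k.factorial_ne_zero
    push_cast at h1
    refine mul_left_cancel₀ h4 ?_
    linear_combination -h1
  have hfac : ∀ k : ℕ, ‖s - ((k + 1 : ℕ) : ℂ)‖
      ≤ ((k : ℝ) + 1) * Real.exp (w ^ 2 / ((k : ℝ) + 1) ^ 2) := by
    intro k
    have hk : (0 : ℝ) < (k : ℝ) + 1 := by positivity
    have h1 : ‖s - ((k + 1 : ℕ) : ℂ)‖ ^ 2 = ((k : ℝ) + 1) ^ 2 * (1 + w ^ 2 / ((k : ℝ) + 1) ^ 2) := by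
      rw [← Complex.normSq_eq_norm_sq, Complex.normSq_apply]
      simp [hs]
      field_simp
      ring
    set b := w ^ 2 / ((k : ℝ) + 1) ^ 2 with hb
    have hb0 : 0 ≤ b := by positivity
    refine le_of_sq_le_sq ?_ (by positivity)
    rw [h1, mul_pow]
    have h2 := Real.add_one_le_exp b
    have h3 : 1 ≤ Real.exp b := Real.one_le_exp hb0
    gcongr
    nlinarith
  refine ⟨|w| * Real.exp (∑' i : ℕ, w ^ 2 / ((i : ℝ) + 1) ^ 2), by positivity, fun k => ?_⟩
  have key : ((k : ℝ) + 1) * ‖Ring.choose s (k + 1)‖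
      ≤ |w| * Real.exp (∑ i ∈ Finset.range k, w ^ 2 / ((i : ℝ) + 1) ^ 2) := by
    induction k with
    | zero => simp [hs]
    | succ k ih =>
      have h1 := congrArg norm (hstep (k + 1))
      rw [norm_mul, norm_mul] at h1
      have h2 : ‖((k + 1 : ℕ) : ℂ) + 1‖ = ((k + 1 : ℕ) : ℝ) + 1 := by
        rw [show ((k + 1 : ℕ) : ℂ) + 1 = ((k + 2 : ℕ) : ℂ) by push_cast; ring, Complex.norm_natCast]
        push_cast; ring
      rw [h2] at h1
      rw [h1, Finset.sum_range_succ, Real.exp_add]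
      calc _ ≤ ‖Ring.choose s (k + 1)‖ *
            (((k : ℝ) + 1) * Real.exp (w ^ 2 / ((k : ℝ) + 1) ^ 2)) := by
            gcongr; exact hfac k
        _ = (((k : ℝ) + 1) * ‖Ring.choose s (k + 1)‖) * Real.exp (w ^ 2 / ((k : ℝ) + 1) ^ 2) := by
            ring
        _ ≤ _ := by rw [← mul_assoc]; gcongr
  rw [le_div_iff₀ (by positivity), mul_comm]
  refine key.trans ?_
  gcongr
  exact hsum.sum_le_tsum _ fun i _ => by positivity

lemma hasSum_choose_mul_pow (w : ℝ) {a : ℝ} (h0 : 0 ≤ a) (h1 : a < 1) :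
    HasSum (fun k : ℕ => Ring.choose (Complex.I * w) (k + 1) * (((-1) ^ (k + 2) * a ^ (k + 1) : ℝ) : ℂ))
      (1 - Complex.exp (Complex.I * (w * Real.log (1 - a)))) := by
  have hmem : (-(a : ℂ)) ∈ Metric.eball (0 : ℂ) 1 := by
    rw [← ENNReal.ofReal_one, Metric.eball_ofReal]
    simpa [abs_of_nonneg h0] using h1
  have h := (Complex.one_add_cpow_hasFPowerSeriesOnBall_zero (a := Complex.I * w)).hasSum hmem
  simp only [binomialSeries_apply, List.ofFn_const, List.prod_replicate, zero_add] at h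
  have h2 := (hasSum_nat_add_iff' 1).2 h
  simp only [Finset.range_one, Finset.sum_singleton, Ring.choose_zero_right, pow_zero, smul_eq_mul,
    mul_one] at h2
  have h3 := h2.neg
  have e : -((1 + -(a : ℂ)) ^ (Complex.I * w) - 1)
      = 1 - Complex.exp (Complex.I * (w * Real.log (1 - a))) := by
    have hne : (1 + -(a : ℂ)) = ((1 - a : ℝ) : ℂ) := by push_cast; ring
    have hne0 : ((1 - a : ℝ) : ℂ) ≠ 0 := by exact_mod_cast (by linarith : (0 : ℝ) < 1 - a).ne'
    rw [hne, Complex.cpow_def_of_ne_zero hne0, ← Complex.ofReal_log (by linarith)]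
    rw [neg_sub]
    congr 2; ring
  rw [e] at h3
  have hk : ∀ k : ℕ, -(Ring.choose (Complex.I * w) (k + 1) * (-(a : ℂ)) ^ (k + 1))
      = Ring.choose (Complex.I * w) (k + 1) * (((-1) ^ (k + 2) * a ^ (k + 1) : ℝ) : ℂ) := by
    intro k
    rw [neg_pow (a : ℂ)]
    push_cast
    ring
  exact funext hk ▸ h3

/-- Integrated binomial series of `(1 - a) ^ (I w)`. -/
lemma hasSum_choose_mul_integral {E : Type*} [MeasurableSpace E] {μ : Measure E} {a : E → ℝ}
    (ha : AEStronglyMeasurable a μ) (h01 : ∀ᵐ e ∂μ, 0 ≤ a e ∧ a e < 1)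
    (hi : Integrable (fun e => Real.log (1 - a e)) μ) (w : ℝ) :
    (∀ k : ℕ, Integrable (fun e => a e ^ (k + 1)) μ) ∧
    HasSum (fun k : ℕ => Ring.choose (Complex.I * w) (k + 1) *
        (((-1) ^ (k + 2) * ∫ e, a e ^ (k + 1) ∂μ : ℝ) : ℂ))
      (∫ e, (1 - Complex.exp (Complex.I * (w * Real.log (1 - a e)))) ∂μ) := by
  -- The partial sums of the logarithmic series lie below -log (1 - a), so integrability of the
  -- logarithm alone controls all moments and the whole series.
  have hlog : ∀ᵐ e ∂μ, ∀ n : ℕ, ∑ k ∈ Finset.range n, a e ^ (k + 1) / ((k : ℝ) + 1)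
      ≤ -Real.log (1 - a e) := by
    filter_upwards [h01] with e he n
    refine sum_le_hasSum _ (fun k _ => div_nonneg (pow_nonneg he.1 _) (by positivity))
      (Real.hasSum_pow_div_log_of_abs_lt_one ?_)
    rw [abs_of_nonneg he.1]; exact he.2
  have hai : Integrable a μ := by
    refine hi.neg.mono' ha ?_
    filter_upwards [hlog, h01] with e he h
    have := he 1
    simp only [Finset.range_one, Finset.sum_singleton] at this
    rw [Real.norm_of_nonneg h.1]
    simpa using this
  have hpow : ∀ k : ℕ, Integrable (fun e => a e ^ (k + 1)) μ := by
    intro k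
    refine hai.mono' (ha.pow _) ?_
    filter_upwards [h01] with e he
    rw [Real.norm_of_nonneg (pow_nonneg he.1 _)]
    exact pow_le_of_le_one he.1 he.2.le (Nat.succ_ne_zero k)
  refine ⟨hpow, ?_⟩
  obtain ⟨C, hC0, hC⟩ := exists_norm_choose_le w
  have hnorm : ∀ k : ℕ, ∀ᵐ e ∂μ, ‖Ring.choose (Complex.I * w) (k + 1) *
      (((-1) ^ (k + 2) * a e ^ (k + 1) : ℝ) : ℂ)‖ ≤ C * (a e ^ (k + 1) / ((k : ℝ) + 1)) := by
    intro k
    filter_upwards [h01] with e he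
    rw [norm_mul, Complex.norm_real, norm_mul, norm_pow, norm_neg, norm_one, one_pow, one_mul,
      Real.norm_of_nonneg (pow_nonneg he.1 _)]
    calc _ ≤ C / (k + 1) * a e ^ (k + 1) := by
          gcongr
          · exact pow_nonneg he.1 _
          · exact hC k
      _ = _ := by ring
  have hFi : ∀ k : ℕ, Integrable (fun e => Ring.choose (Complex.I * w) (k + 1) *
      (((-1) ^ (k + 2) * a e ^ (k + 1) : ℝ) : ℂ)) μ := fun k =>
    (((hpow k).const_mul _).ofReal).const_mul _
  have hmaj : ∀ k : ℕ, Integrable (fun e => a e ^ (k + 1) / ((k : ℝ) + 1)) μ := fun k =>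
    (hpow k).div_const _
  have hsummable : Summable fun k : ℕ => ∫ e, ‖Ring.choose (Complex.I * w) (k + 1) *
      (((-1) ^ (k + 2) * a e ^ (k + 1) : ℝ) : ℂ)‖ ∂μ := by
    refine summable_of_sum_range_le (c := C * ∫ e, -Real.log (1 - a e) ∂μ)
      (fun k => integral_nonneg fun e => norm_nonneg _) fun n => ?_
    calc _ ≤ ∑ k ∈ Finset.range n, C * ∫ e, a e ^ (k + 1) / ((k : ℝ) + 1) ∂μ := by
          refine Finset.sum_le_sum fun k _ => ?_
          rw [← integral_const_mul]
          exact integral_mono_ae (hFi k).norm ((hmaj k).const_mul _) (hnorm k)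
      _ = C * ∫ e, ∑ k ∈ Finset.range n, a e ^ (k + 1) / ((k : ℝ) + 1) ∂μ := by
          rw [← Finset.mul_sum, integral_finsetSum _ fun k _ => hmaj k]
      _ ≤ _ := by
          refine mul_le_mul_of_nonneg_left (integral_mono_ae (integrable_finsetSum _ fun k _ => hmaj k)
            hi.neg ?_) hC0
          filter_upwards [hlog] with e he using he n
  have h := hasSum_integral_of_summable_integral_norm hFi hsummable
  have e1 : ∫ e, ∑' k : ℕ, Ring.choose (Complex.I * w) (k + 1) *
      (((-1) ^ (k + 2) * a e ^ (k + 1) : ℝ) : ℂ) ∂μ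
      = ∫ e, (1 - Complex.exp (Complex.I * (w * Real.log (1 - a e)))) ∂μ := by
    refine integral_congr_ae ?_
    filter_upwards [h01] with e he using (hasSum_choose_mul_pow w he.1 he.2).tsum_eq
  rw [e1] at h
  have hk : ∀ k : ℕ, ∫ e, Ring.choose (Complex.I * w) (k + 1) *
      (((-1) ^ (k + 2) * a e ^ (k + 1) : ℝ) : ℂ) ∂μ = Ring.choose (Complex.I * w) (k + 1) *
        (((-1) ^ (k + 2) * ∫ e, a e ^ (k + 1) ∂μ : ℝ) : ℂ) := fun k => by
    rw [integral_const_mul, integral_complex_ofReal, integral_const_mul]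
  exact funext hk ▸ h

end BinomialSeries

namespace NetworkParams

variable {p : NetworkParams}

lemma measurable_activity :
    Measurable fun q : ℝ × ℝ × ℝ => p.activity q.1 q.2.1 q.2.2 := by
  unfold activity busyLimit
  refine Measurable.mul (Measurable.ite (measurableSet_le (by fun_prop) measurable_const)
    measurable_const (by fun_prop)) (by fun_prop)

/-- A queue with service probability z t is saturated exactly when t ≤ ξ / z and is then active with
probability z. Otherwise it is busy with probability ξ / (z t), and z cancels. These two cases
become the two terms in the bracket of the formula. -/
lemma activity_eq {z t d : ℝ} (hz : 0 < z) (ht : t ∈ Ioc (0 : ℝ) 1) :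
    p.activity z t d = (if t ≤ p.ξ / z then z else p.ξ / t) / (1 + d) := by
  rw [activity, min_eq_right ht.2, max_eq_right ht.1.le, busyLimit]
  have h : z * t ≤ p.ξ ↔ t ≤ p.ξ / z := by rw [le_div_iff₀ hz, mul_comm]
  have h0 := ht.1.ne'
  simp only [h]
  split_ifs
  · ring
  · field_simp

/-- The lower bound does not depend on the rate t; it is the source of the decay of the
characteristic function. -/
lemma activity_pos {z t d : ℝ} (hz : 0 < z) (ht : t ∈ Ioc (0 : ℝ) 1) (hd : 0 < d) :
    min z p.ξ / (1 + d) ≤ p.activity z t d := by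
  rw [activity_eq hz ht]
  gcongr
  split_ifs
  · exact min_le_left _ _
  · exact (min_le_right _ _).trans (le_div_self p.ξ_pos.le ht.1 ht.2)

lemma measurable_activity_rate (z d : ℝ) : Measurable fun t => p.activity z t d :=
  measurable_activity.comp (by fun_prop : Measurable fun t : ℝ => (z, t, d))

/-- The moments of the activity probability. -/
lemma integral_activity_pow {F : StieltjesFunction ℝ} {ν : Measure ℝ} [IsProbabilityMeasure ν]
    (hF : F = cdf ν) (hν : ∀ᵐ t ∂ν, t ∈ Ioc (0 : ℝ) 1) {z : ℝ} (hz : 0 < z) (hz1 : z ≤ 1) {d : ℝ}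
    (hd : 0 < d) (k : ℕ) :
    ∫ t, p.activity z t d ^ k ∂ν = p.activityMoment F z k / (1 + d) ^ k := by
  have hFν : F.measure = ν := by rw [hF]; exact measure_cdf ν
  have hFx : F (p.ξ / z) = ν.real (Iic (p.ξ / z)) := by rw [hF, cdf_eq_real]
  have hint : Integrable (fun t => p.activity z t d ^ k) ν := by
    refine (integrable_const (1 : ℝ)).mono' ((measurable_activity_rate z d).pow_const k).aestronglyMeasurable
      (Eventually.of_forall fun t => ?_)
    have h := activity_bounds (p := p) (m := t) hz.le hz1 hd
    rw [Real.norm_of_nonneg (pow_nonneg h.1 _)]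
    exact pow_le_one₀ h.1 (h.2.trans (by rw [div_le_one (by linarith)]; linarith))
  rw [← integral_add_compl (measurableSet_Iic (a := p.ξ / z)) hint, activityMoment, add_div, hFν, hFx]
  congr 1
  · rw [setIntegral_congr_ae (g := fun _ => z ^ k / (1 + d) ^ k) measurableSet_Iic]
    · rw [setIntegral_const, smul_eq_mul]; ring
    · filter_upwards [hν] with t ht h
      rw [activity_eq hz ht, if_pos (mem_Iic.1 h), div_pow]
  · rw [compl_Iic, ← integral_div]
    have hset : (Ioi (p.ξ / z) : Set ℝ) =ᵐ[ν] Ioc (p.ξ / z) 1 := by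
      filter_upwards [hν] with t ht
      exact propext ⟨fun h => ⟨h, ht.2⟩, fun h => h.1⟩
    rw [setIntegral_congr_set hset]
    refine setIntegral_congr_ae measurableSet_Ioc ?_
    filter_upwards [hν] with t ht h
    rw [activity_eq hz ht, if_neg (not_le.2 h.1), div_pow, div_pow]

section Exponent

variable {Z : ℝ → ℝ} {F : StieltjesFunction ℝ} {ν : Measure ℝ} [IsProbabilityMeasure ν]

/-- The mean of `1 - (1 - a) ^ (I w)` for an interferer at relative path loss `d` which is active,
discounted by the path loss, with probability `a`. -/
def meanDefect (p : NetworkParams) (Z : ℝ → ℝ) (ν : Measure ℝ) (w d : ℝ) : ℂ :=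
  ∫ t, (1 - Complex.exp (Complex.I * (w * Real.log (1 - p.activity (Z d) t d)))) ∂ν

lemma measurable_activity_extend (hZm : Measurable ((Ioi 0).indicator Z)) :
    Measurable fun q : ℝ × ℝ => p.activity ((Ioi 0).indicator Z q.1) q.2 q.1 :=
  measurable_activity.comp
    ((hZm.comp measurable_fst).prodMk (measurable_snd.prodMk measurable_fst))

/-- The series in the exponent converges to the integral of `meanDefect`. -/
theorem hasSum_seriesTerm (hF : F = cdf ν) (hν : ∀ᵐ t ∂ν, t ∈ Ioc (0 : ℝ) 1)
    (hZm : Measurable ((Ioi 0).indicator Z)) (hZ0 : ∀ d, 0 < d → 0 < Z d)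
    (hZ1 : ∀ d, 0 < d → Z d ≤ 1) (w : ℝ) :
    (∀ k : ℕ, IntegrableOn (p.seriesIntegrand Z F (k + 1)) (Ioi 0)) ∧
    HasSum (fun k : ℕ => p.seriesTerm Z F w (k + 1))
      (∫ v in Ioi (0 : ℝ), p.meanDefect Z ν w (v ^ (p.α / 2))) := by
  -- Only the extension of Z by zero is assumed measurable; on v > 0 it makes no difference.
  set a : ℝ × ℝ → ℝ := fun e =>
    p.activity ((Ioi 0).indicator Z (e.1 ^ (p.α / 2))) e.2 (e.1 ^ (p.α / 2)) with ha
  have ham : Measurable a := (measurable_activity_extend hZm).comp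
    ((measurable_fst.pow_const _).prodMk measurable_snd)
  set μ : Measure (ℝ × ℝ) := (volume.restrict (Ioi 0)).prod ν with hμ
  have hv : ∀ v : ℝ, 0 < v → ∀ t, a (v, t) = p.activity (Z (v ^ (p.α / 2))) t (v ^ (p.α / 2)) := by
    intro v hv t
    simp only [ha]
    rw [indicator_of_mem (mem_Ioi.2 (Real.rpow_pos_of_pos hv _))]
  have hbd : ∀ v : ℝ, 0 < v → ∀ t, 0 ≤ a (v, t) ∧ a (v, t) ≤ 1 / (1 + v ^ (p.α / 2)) := by
    intro v hv0 t
    have hd := Real.rpow_pos_of_pos hv0 (p.α / 2)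
    rw [hv v hv0]
    exact activity_bounds (hZ0 _ hd).le (hZ1 _ hd) hd
  have hae : ∀ᵐ e ∂μ, 0 < e.1 :=
    Measure.quasiMeasurePreserving_fst.ae (ae_restrict_mem measurableSet_Ioi)
  have h01 : ∀ᵐ e ∂μ, 0 ≤ a e ∧ a e < 1 := by
    filter_upwards [hae] with e he
    have h := hbd e.1 he e.2
    refine ⟨h.1, h.2.trans_lt ?_⟩
    have := Real.rpow_pos_of_pos he (p.α / 2)
    rw [div_lt_one (by linarith)]; linarith
  have hi : Integrable (fun e => Real.log (1 - a e)) μ := by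
    have h1 : Integrable (fun e : ℝ × ℝ => Real.log (1 + 1 / e.1 ^ (p.α / 2))) μ :=
      Integrable.comp_fst (μ := volume.restrict (Ioi 0)) (ν := ν) p.integrableOn_log_one_add_inv
    refine h1.mono' (Real.measurable_log.comp (ham.const_sub 1)).aestronglyMeasurable ?_
    filter_upwards [hae] with e he
    exact abs_log_one_sub_le (Real.rpow_pos_of_pos he _) (hbd e.1 he e.2).1 (hbd e.1 he e.2).2
  obtain ⟨hpow, hsum⟩ := hasSum_choose_mul_integral ham.aestronglyMeasurable h01 hi w
  have hser : ∀ k : ℕ, ∀ v ∈ Ioi (0 : ℝ), p.seriesIntegrand Z F (k + 1) v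
      = (-1) ^ (k + 2) * ∫ t, a (v, t) ^ (k + 1) ∂ν := by
    intro k v hv0
    have hd := Real.rpow_pos_of_pos (mem_Ioi.1 hv0) (p.α / 2)
    simp only [hv v hv0]
    rw [integral_activity_pow hF hν (hZ0 _ hd) (hZ1 _ hd) hd, seriesIntegrand]
    ring
  constructor
  · intro k
    exact ((hpow k).integral_prod_left.const_mul _).congr
      ((ae_restrict_mem measurableSet_Ioi).mono fun v hv0 => (hser k v hv0).symm)
  · convert hsum using 1
    · ext k
      rw [seriesTerm, setIntegral_congr_fun measurableSet_Ioi (hser k), integral_const_mul,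
        integral_prod _ (hpow k)]
    · have hi2 : Integrable (fun e => 1 - Complex.exp (Complex.I * (w * Real.log (1 - a e)))) μ := by
        refine (hi.const_mul w).norm.mono' (Measurable.aestronglyMeasurable (by fun_prop))
          (Eventually.of_forall fun e => ?_)
        rw [norm_sub_rev]
        have := Real.norm_exp_I_mul_ofReal_sub_one_le (x := w * Real.log (1 - a e))
        simpa using this
      rw [integral_prod _ hi2]
      refine setIntegral_congr_fun measurableSet_Ioi fun v hv0 => ?_
      simp only [meanDefect, hv v hv0]

end Exponent

end NetworkParams
end

/-! ### The characteristic function of the logarithm of the success probability. -/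

noncomputable section

/-- Integrating out independent marks in a product over the points of a random sequence. -/
lemma integral_prod_marks {Ω E : Type*} [MeasurableSpace Ω] [MeasurableSpace E] {P : Measure Ω}
    [IsProbabilityMeasure P] {X : ℕ → Ω → E} {m : ℕ → Ω → ℝ} {ν : Measure ℝ}
    (hX : ∀ j, Measurable (X j)) (hm : ∀ j, AEMeasurable (m j) P) (hlaw : ∀ j, P.map (m j) = ν)
    (hind : iIndepFun m P) (hXm : IndepFun (fun ω j => X j ω) (fun ω j => m j ω) P)
    {f : E → ℝ → ℂ} (hf : Measurable (Function.uncurry f)) (hf1 : ∀ x t, ‖f x t‖ ≤ 1) (n : ℕ) :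
    ∫ ω, ∏ j ∈ Finset.range n, f (X j ω) (m j ω) ∂P
      = ∫ ω, ∏ j ∈ Finset.range n, (∫ t, f (X j ω) t ∂ν) ∂P := by
  set A : Ω → ℕ → E := fun ω j => X j ω with hA
  set B : Ω → ℕ → ℝ := fun ω j => m j ω with hB
  have hAm : Measurable A := measurable_pi_lambda _ hX
  have hBm : AEMeasurable B P := aemeasurable_pi_lambda _ hm
  have := Measure.isProbabilityMeasure_map hAm.aemeasurable (μ := P)
  have := Measure.isProbabilityMeasure_map hBm (μ := P)
  set G : (ℕ → E) × (ℕ → ℝ) → ℂ := fun y => ∏ j ∈ Finset.range n, f (y.1 j) (y.2 j) with hG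
  have hGm : Measurable G := Finset.measurable_fun_prod _ fun j _ => by
    have h : Measurable fun y : (ℕ → E) × (ℕ → ℝ) => (y.1 j, y.2 j) := by fun_prop
    exact hf.comp h
  have hG1 : ∀ y, ‖G y‖ ≤ 1 := fun y => by
    simp only [hG]
    rw [norm_prod]
    exact Finset.prod_le_one (fun j _ => norm_nonneg _) fun j _ => hf1 _ _
  have hGi : Integrable G ((P.map A).prod (P.map B)) :=
    (integrable_const (1 : ℝ)).mono' hGm.aestronglyMeasurable (Eventually.of_forall hG1)
  have hinner : ∀ x : ℕ → E, ∫ b, G (x, b) ∂(P.map B) = ∏ j ∈ Finset.range n, ∫ t, f (x j) t ∂ν := by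
    intro x
    have hfx : ∀ j, Measurable (f (x j)) := fun j => hf.comp measurable_prodMk_left
    rw [integral_map (f := fun b => G (x, b)) hBm (hGm.comp measurable_prodMk_left).aestronglyMeasurable]
    simp only [hG, hB, Finset.prod_range]
    have hind2 : iIndepFun (fun (i : Fin n) => m i) P := hind.precomp Fin.val_injective
    have h := iIndepFun.integral_fun_prod_comp (X := fun i : Fin n => m i)
      (f := fun (i : Fin n) => f (x i)) hind2 (fun i => hm i)
      (fun i => (hfx i).aestronglyMeasurable)
    rw [h]
    refine Finset.prod_congr rfl fun i _ => ?_
    rw [← hlaw i, integral_map (hm i) (hfx i).aestronglyMeasurable]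
  have h1 : ∫ ω, G (A ω, B ω) ∂P = ∫ y, G y ∂((P.map A).prod (P.map B)) := by
    rw [← (indepFun_iff_map_prod_eq_prod_map_map hAm.aemeasurable hBm).1 hXm,
      integral_map (hAm.aemeasurable.prodMk hBm) hGm.aestronglyMeasurable]
  rw [show (∫ ω, ∏ j ∈ Finset.range n, f (X j ω) (m j ω) ∂P) = ∫ ω, G (A ω, B ω) ∂P from rfl, h1,
    integral_prod _ hGi, integral_map hAm.aemeasurable hGi.integral_prod_left.aestronglyMeasurable]
  simp only [hinner, hA]

namespace MeanFieldNetwork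

variable {Ω : Type*} [MeasurableSpace Ω] {P : Measure Ω} [IsProbabilityMeasure P]
  {p : NetworkParams} {S : Set Plane} {X : ℕ → Ω → Plane} {θ m : ℕ → Ω → ℝ}

lemma isProbabilityMeasure_configLaw (hnet : MeanFieldNetwork P p S X θ m) :
    IsProbabilityMeasure (configLaw P X θ) :=
  Measure.isProbabilityMeasure_map hnet.measurable_config.aemeasurable

/-- The probability that an interferer at a given relative path loss with a given success
probability is active, discounted by the path loss. -/
def activityAt (P : Measure Ω) (p : NetworkParams) (S : Set Plane) (X : ℕ → Ω → Plane)
    (θ : ℕ → Ω → ℝ) (d t : ℝ) : ℝ :=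
  p.activity ((Ioi 0).indicator (p.schedZ S (configLaw P X θ)) d) t d

omit [IsProbabilityMeasure P] in
lemma activityAt_of_pos {d : ℝ} (hd : 0 < d) (t : ℝ) :
    activityAt P p S X θ d t = p.activity (p.schedZ S (configLaw P X θ) d) t d := by
  rw [activityAt, indicator_of_mem (mem_Ioi.2 hd)]

lemma activityAt_bounds (hS : MeasurableSet S) (hnet : MeanFieldNetwork P p S X θ m) {d : ℝ}
    (hd : 0 < d) (t : ℝ) :
    0 ≤ activityAt P p S X θ d t ∧ activityAt P p S X θ d t ≤ 1 / (1 + d) := by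
  have := hnet.isProbabilityMeasure_configLaw
  rw [activityAt_of_pos hd]
  exact NetworkParams.activity_bounds (NetworkParams.schedZ_pos hS hnet.ae_summable_receiver hd).le
    (NetworkParams.schedZ_le_one hS hnet.ae_summable_receiver hd) hd

lemma measurable_activityAt (hS : MeasurableSet S) (hnet : MeanFieldNetwork P p S X θ m) :
    Measurable fun q : ℝ × ℝ => activityAt P p S X θ q.1 q.2 := by
  have := hnet.isProbabilityMeasure_configLaw
  exact NetworkParams.measurable_activity_extend
    (NetworkParams.measurable_schedZ hS hnet.ae_summable_receiver)

/-- The conditional success probability in steady state. -/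
theorem ae_tendsto_successProbAt (hS : MeasurableSet S) (hnet : MeanFieldNetwork P p S X θ m) :
    ∀ᵐ ω ∂P, Tendsto (p.successProbAt S (configLaw P X θ) (fun j => X j ω) (fun j => m j ω)) atTop
        (𝓝 (typicalSuccess P p S X θ m ω)) ∧
      typicalSuccess P p S X θ m ω = Real.exp (-p.noiseExponent
        + ∑' j, Real.log (1 - activityAt P p S X θ (p.relLoss (X j ω)) (m j ω))) := by
  have := hnet.isProbabilityMeasure_configLaw
  filter_upwards [hnet.ae_summable_loc] with ω hω
  have h := NetworkParams.tendsto_successProbAt hS hnet.ae_summable_receiver (fun j => m j ω) hω.1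
    hω.2.1
  have h2 : typicalSuccess P p S X θ m ω = _ := h.limUnder_eq
  refine ⟨h2 ▸ h, ?_⟩
  rw [h2]
  simp only [activityAt_of_pos (hω.1 _)]

lemma summable_log_activityAt (hS : MeasurableSet S) (hnet : MeanFieldNetwork P p S X θ m)
    {D : ℕ → ℝ} (hD : ∀ j, 0 < D j) (hs : Summable fun j => Real.log (1 + 1 / D j)) (t : ℕ → ℝ) :
    Summable fun j => Real.log (1 - activityAt P p S X θ (D j) (t j)) :=
  Summable.of_norm_bounded hs fun j => abs_log_one_sub_le (hD j)
    (activityAt_bounds hS hnet (hD j) _).1 (activityAt_bounds hS hnet (hD j) _).2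

lemma log_one_sub_activityAt_nonpos (hS : MeasurableSet S) (hnet : MeanFieldNetwork P p S X θ m)
    {d : ℝ} (hd : 0 < d) (t : ℝ) : Real.log (1 - activityAt P p S X θ d t) ≤ 0 := by
  have h := activityAt_bounds hS hnet hd t
  have : 1 / (1 + d) < 1 := by rw [div_lt_one (by linarith)]; linarith
  exact Real.log_nonpos (by linarith) (by linarith)

lemma typicalSuccess_mem (hS : MeasurableSet S) (hnet : MeanFieldNetwork P p S X θ m) :
    ∀ᵐ ω ∂P, typicalSuccess P p S X θ m ω ∈ Ioc (0 : ℝ) 1 := by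
  filter_upwards [hnet.ae_summable_loc, ae_tendsto_successProbAt hS hnet] with ω hω h
  rw [h.2]
  refine ⟨Real.exp_pos _, Real.exp_le_one_iff.2 ?_⟩
  have : ∑' j, Real.log (1 - activityAt P p S X θ (p.relLoss (X j ω)) (m j ω)) ≤ 0 :=
    tsum_nonpos fun j => log_one_sub_activityAt_nonpos hS hnet (hω.1 j) (m j ω)
  linarith [p.noiseExponent_pos]

omit [IsProbabilityMeasure P] in
-- Consistency states an identity of distributions, which includes almost everywhere measurability
-- of the typical success probability; it need not be derived from the construction.
lemma aemeasurable_typicalSuccess (hnet : MeanFieldNetwork P p S X θ m) :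
    AEMeasurable (typicalSuccess P p S X θ m) P := (hnet.rate_law 0).aemeasurable_snd

/-- The law of the conditional success probability. -/
def successLaw (P : Measure Ω) (p : NetworkParams) (S : Set Plane) (X : ℕ → Ω → Plane)
    (θ m : ℕ → Ω → ℝ) : Measure ℝ := P.map (typicalSuccess P p S X θ m)

lemma isProbabilityMeasure_successLaw (hnet : MeanFieldNetwork P p S X θ m) :
    IsProbabilityMeasure (successLaw P p S X θ m) :=
  Measure.isProbabilityMeasure_map hnet.aemeasurable_typicalSuccess

lemma ae_successLaw (hS : MeasurableSet S) (hnet : MeanFieldNetwork P p S X θ m) :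
    ∀ᵐ t ∂(successLaw P p S X θ m), t ∈ Ioc (0 : ℝ) 1 :=
  (ae_map_iff hnet.aemeasurable_typicalSuccess measurableSet_Ioc).2 (typicalSuccess_mem hS hnet)

/-- The logarithm of the conditional success probability is integrable. -/
lemma integrable_log_typicalSuccess (hS : MeasurableSet S) (hnet : MeanFieldNetwork P p S X θ m) :
    Integrable (fun ω => Real.log (typicalSuccess P p S X θ m ω)) P := by
  have hmeas : ∀ j, Measurable fun ω => Real.log (1 + 1 / p.relLoss (X j ω)) := fun j =>
    p.measurable_log_relLoss.comp (hnet.poisson.measurable j)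
  set Y : Ω → ℝ := fun ω => ∑' j, Real.log (1 + 1 / p.relLoss (X j ω)) with hY
  have hYm : Measurable Y := Measurable.tsum hmeas
  have hYi : Integrable Y P := by
    refine ⟨hYm.aestronglyMeasurable, ?_⟩
    rw [hasFiniteIntegral_iff_ofReal (Eventually.of_forall fun ω =>
      tsum_nonneg fun j => p.log_relLoss_nonneg _)]
    have h1 : ∫⁻ ω, ENNReal.ofReal (Y ω) ∂P
        = ∫⁻ ω, ∑' j, ENNReal.ofReal (Real.log (1 + 1 / p.relLoss (X j ω))) ∂P := by
      refine lintegral_congr_ae ?_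
      filter_upwards [hnet.ae_summable_loc] with ω hω
      exact ENNReal.ofReal_tsum_of_nonneg (fun j => p.log_relLoss_nonneg _) hω.2.2
    rw [h1, lintegral_tsum fun j => (hmeas j).ennreal_ofReal.aemeasurable,
      hnet.poisson.lintegral_tsum_eq p.lam_pos.le (g := fun z => ENNReal.ofReal
        (Real.log (1 + 1 / p.relLoss z))) p.measurable_log_relLoss.ennreal_ofReal]
    refine ENNReal.mul_lt_top ENNReal.ofReal_lt_top ?_
    exact (hasFiniteIntegral_iff_ofReal (Eventually.of_forall p.log_relLoss_nonneg)).1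
      p.integrable_log_relLoss.2
  refine ((integrable_const p.noiseExponent).add hYi).mono'
    (Real.measurable_log.comp_aemeasurable hnet.aemeasurable_typicalSuccess).aestronglyMeasurable ?_
  filter_upwards [hnet.ae_summable_loc, ae_tendsto_successProbAt hS hnet] with ω hω h
  rw [h.2, Real.log_exp]
  refine (norm_add_le _ _).trans (add_le_add ?_ ?_)
  · rw [norm_neg, Real.norm_of_nonneg p.noiseExponent_pos.le]
  · refine tsum_of_norm_bounded hω.2.2.hasSum fun j => ?_
    exact abs_log_one_sub_le (hω.1 j)
      (activityAt_bounds hS hnet (hω.1 j) _).1 (activityAt_bounds hS hnet (hω.1 j) _).2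

/-- The characteristic function of the logarithm of the conditional success probability. -/
theorem charFun_log_typicalSuccess (hS : MeasurableSet S) (hnet : MeanFieldNetwork P p S X θ m)
    (w : ℝ) :
    Integrable (fun z => p.meanDefect (p.schedZ S (configLaw P X θ)) (successLaw P p S X θ m) w
      (p.relLoss z)) ∧
    ∫ ω, Complex.exp (Complex.I * (w * Real.log (typicalSuccess P p S X θ m ω))) ∂P
      = Complex.exp (-(Complex.I * w * p.noiseExponent)) * Complex.exp (-(p.lam * ∫ z,
        p.meanDefect (p.schedZ S (configLaw P X θ)) (successLaw P p S X θ m) w (p.relLoss z))) := by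
  have := hnet.isProbabilityMeasure_configLaw
  have := hnet.isProbabilityMeasure_successLaw
  set ν := successLaw P p S X θ m with hν
  set f : Plane → ℝ → ℂ := fun z t =>
    Complex.exp (Complex.I * (w * Real.log (1 - activityAt P p S X θ (p.relLoss z) t))) with hf
  have hact : Measurable fun q : Plane × ℝ => activityAt P p S X θ (p.relLoss q.1) q.2 :=
    (measurable_activityAt hS hnet).comp
      ((p.measurable_relLoss.comp measurable_fst).prodMk measurable_snd)
  have hfm : Measurable (Function.uncurry f) := by
    simp only [hf, Function.uncurry_def]
    fun_prop
  have hf1 : ∀ z t, ‖f z t‖ = 1 := fun z t => by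
    simp only [hf]
    rw [mul_comm, ← Complex.ofReal_mul, Complex.norm_exp_ofReal_mul_I]
  have hfi : ∀ z, Integrable (f z) ν := fun z => (integrable_const (1 : ℝ)).mono'
    (hfm.comp measurable_prodMk_left).aestronglyMeasurable (Eventually.of_forall fun t => (hf1 z t).le)
  set h : Plane → ℂ := fun z => ∫ t, f z t ∂ν with hh
  have hhm : Measurable h := (hfm.stronglyMeasurable.integral_prod_right (ν := ν)).measurable
  have hh1 : ∀ z, ‖h z‖ ≤ 1 := fun z => by
    refine (norm_integral_le_of_norm_le_const (Eventually.of_forall fun t => (hf1 z t).le)).trans ?_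
    simp
  have hdef : ∀ z, 1 - h z = ∫ t, (1 - f z t) ∂ν := fun z => by
    rw [integral_sub (integrable_const _) (hfi z)]; simp [hh]
  have hpos : ∀ᵐ z : Plane, 0 < p.relLoss z := by
    have : ∀ᵐ z : Plane, z ≠ 0 := by simp [ae_iff]
    filter_upwards [this] with z hz using p.relLoss_pos hz
  have hmd : ∀ᵐ z : Plane, 1 - h z
      = p.meanDefect (p.schedZ S (configLaw P X θ)) ν w (p.relLoss z) := by
    filter_upwards [hpos] with z hz
    rw [hdef, NetworkParams.meanDefect]
    simp only [hf, activityAt_of_pos hz]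
  -- The bound |1 - e^(ix)| ≤ |x| together with the logarithmic majorant provides the integrability
  -- that the generating functional requires.
  have hi : Integrable fun z => 1 - h z := by
    refine (p.integrable_log_relLoss.const_mul |w|).mono' (hhm.const_sub 1).aestronglyMeasurable ?_
    filter_upwards [hpos] with z hz
    rw [hdef]
    refine (norm_integral_le_of_norm_le_const (C := |w| * Real.log (1 + 1 / p.relLoss z))
      (Eventually.of_forall fun t => ?_)).trans (by simp)
    rw [norm_sub_rev]
    have h1 := Real.norm_exp_I_mul_ofReal_sub_one_le
      (x := w * Real.log (1 - activityAt P p S X θ (p.relLoss z) t))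
    rw [Real.norm_eq_abs, abs_mul] at h1
    push_cast at h1
    refine h1.trans (mul_le_mul_of_nonneg_left ?_ (abs_nonneg _))
    exact abs_log_one_sub_le hz (activityAt_bounds hS hnet hz _).1 (activityAt_bounds hS hnet hz _).2
  refine ⟨hi.congr hmd, ?_⟩
  rw [← integral_congr_ae hmd]
  have hlim1 := (hnet.poisson.tendsto_integral_prod p.lam_pos.le hhm hh1 hi).const_mul
    (Complex.exp (-(Complex.I * w * p.noiseExponent)))
  -- Consistency enters here: the marks are distributed according to ν, the law of the quantity
  -- under study.
  have hfin : ∀ n, ∫ ω, ∏ j ∈ Finset.range n, f (X j ω) (m j ω) ∂P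
      = ∫ ω, ∏ j ∈ Finset.range n, h (X j ω) ∂P := fun n =>
    integral_prod_marks hnet.poisson.measurable (fun j => (hnet.rate_law j).aemeasurable_fst)
      (fun j => (hnet.rate_law j).map_eq) hnet.rate_indep
      (hnet.rate_indep_config.comp measurable_fst measurable_id) hfm (fun z t => (hf1 z t).le) n
  replace hlim1 := hlim1.congr fun n => show _ = ∫ ω,
      Complex.exp (-(Complex.I * w * p.noiseExponent)) * ∏ j ∈ Finset.range n, f (X j ω) (m j ω) ∂P by
    rw [← hfin, ← integral_const_mul]
  refine tendsto_nhds_unique ?_ hlim1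
  refine tendsto_integral_of_dominated_convergence (fun _ => 1) (fun n => ?_) (integrable_const _)
    (fun n => ?_) ?_
  · refine AEStronglyMeasurable.const_mul (AEMeasurable.aestronglyMeasurable ?_) _
    refine Finset.aemeasurable_fun_prod _ fun j _ => ?_
    have hp : AEMeasurable (fun ω => (X j ω, m j ω)) P :=
      (hnet.poisson.measurable j).aemeasurable.prodMk (hnet.rate_law j).aemeasurable_fst
    have h2 : AEMeasurable (Function.uncurry f ∘ fun ω => (X j ω, m j ω)) P := hfm.comp_aemeasurable hp
    exact h2
  · refine Eventually.of_forall fun ω => ?_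
    rw [norm_mul, norm_prod]
    simp only [hf1, Finset.prod_const_one, mul_one]
    rw [show -(Complex.I * w * p.noiseExponent) = ((-(w * p.noiseExponent) : ℝ) : ℂ) * Complex.I by
      push_cast; ring, Complex.norm_exp_ofReal_mul_I]
  · filter_upwards [hnet.ae_summable_loc, ae_tendsto_successProbAt hS hnet] with ω hω hs
    rw [hs.2, Real.log_exp]
    have h1 := (summable_log_activityAt hS hnet hω.1 hω.2.2 fun j => m j ω).hasSum.tendsto_sum_nat
    have hc : Continuous fun y : ℝ => Complex.exp (Complex.I * (w * y)) := by fun_prop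
    have h2 := (hc.tendsto _).comp (h1.const_add (-p.noiseExponent))
    refine Tendsto.congr (fun n => ?_) h2
    rw [Function.comp_apply, ← Complex.exp_sum, ← Complex.exp_add, ← Finset.mul_sum, ← Finset.mul_sum,
      ← Complex.ofReal_sum]
    congr 1
    rw [Complex.ofReal_add, Complex.ofReal_neg]
    ring

end MeanFieldNetwork
end

/-! ### Decay of the characteristic function, inversion and conclusion. -/

noncomputable section

namespace NetworkParams

variable {p : NetworkParams} {Z : ℝ → ℝ} {ν : Measure ℝ} [IsProbabilityMeasure ν]

lemma re_meanDefect (w d : ℝ) :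
    (p.meanDefect Z ν w d).re = ∫ t, (1 - Real.cos (w * Real.log (1 - p.activity (Z d) t d))) ∂ν := by
  have hint : Integrable (fun t => 1 - Complex.exp (Complex.I *
      (w * Real.log (1 - p.activity (Z d) t d)))) ν := by
    have hm := measurable_activity_rate (p := p) (Z d) d
    refine (integrable_const (2 : ℝ)).mono' (Measurable.aestronglyMeasurable (by fun_prop))
      (Eventually.of_forall fun t => (norm_sub_le _ _).trans ?_)
    rw [mul_comm Complex.I, ← Complex.ofReal_mul, Complex.norm_exp_ofReal_mul_I, norm_one]
    norm_num
  have h := Complex.reCLM.integral_comp_comm hint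
  rw [Complex.reCLM_apply] at h
  rw [meanDefect, ← h]
  refine integral_congr_ae (Eventually.of_forall fun t => ?_)
  simp only [Complex.reCLM_apply, Complex.sub_re, Complex.one_re]
  rw [mul_comm Complex.I, ← Complex.ofReal_mul, Complex.exp_ofReal_mul_I_re]

lemma re_meanDefect_nonneg (w d : ℝ) : 0 ≤ (p.meanDefect Z ν w d).re := by
  rw [re_meanDefect]
  exact integral_nonneg fun t => sub_nonneg.2 (Real.cos_le_one _)

/-- When d lies between w and 2 w the activity is of order 1/w, so the phase w log (1 - a) has
modulus between κ/3 and 1, and 1 - cos x ≥ 2 x² / π² for |x| ≤ π. The estimate is uniform in the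
rate. -/
lemma le_re_meanDefect (hν : ∀ᵐ t ∂ν, t ∈ Ioc (0 : ℝ) 1) {κ : ℝ} (hκ : 0 < κ) (hκξ : κ ≤ p.ξ)
    {w d : ℝ} (hw : 1 ≤ w) (hwd : w ≤ d) (hdw : d ≤ 2 * w) (hκZ : κ ≤ Z d) (hZ1 : Z d ≤ 1) :
    2 / Real.pi ^ 2 * (κ / 3) ^ 2 ≤ (p.meanDefect Z ν w d).re := by
  have hd : 0 < d := by linarith
  have hz : 0 < Z d := hκ.trans_le hκZ
  have hint : Integrable (fun t => 1 - Real.cos (w * Real.log (1 - p.activity (Z d) t d))) ν := by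
    have hm := measurable_activity_rate (p := p) (Z d) d
    refine (integrable_const (2 : ℝ)).mono' (Measurable.aestronglyMeasurable (by fun_prop))
      (Eventually.of_forall fun t => ?_)
    rw [Real.norm_of_nonneg (sub_nonneg.2 (Real.cos_le_one _))]
    linarith [Real.neg_one_le_cos (w * Real.log (1 - p.activity (Z d) t d))]
  rw [re_meanDefect]
  have h0 : 2 / Real.pi ^ 2 * (κ / 3) ^ 2 = ∫ _, 2 / Real.pi ^ 2 * (κ / 3) ^ 2 ∂ν := by simp
  rw [h0]
  refine integral_mono_ae (integrable_const _) hint ?_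
  filter_upwards [hν] with t ht
  set a := p.activity (Z d) t d with ha
  have hb := activity_bounds (p := p) (m := t) hz.le hZ1 hd
  have h1 : 1 / (1 + d) < 1 := by rw [div_lt_one (by linarith)]; linarith
  have hlow : κ / (1 + d) ≤ a := by
    refine le_trans ?_ (activity_pos hz ht hd)
    gcongr
    exact le_min hκZ hκξ
  have hneg : Real.log (1 - a) ≤ -a := by
    have := Real.log_le_sub_one_of_pos (show 0 < 1 - a by linarith)
    linarith
  have habs := (abs_log_one_sub_le hd hb.1 hb.2).trans (log_one_add_inv_le hd)
  have hup : |w * Real.log (1 - a)| ≤ 1 := by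
    rw [abs_mul, abs_of_nonneg (by linarith : (0 : ℝ) ≤ w)]
    calc w * |Real.log (1 - a)| ≤ d * (1 / d) := by gcongr
      _ = 1 := by field_simp
  have hcos := Real.cos_le_one_sub_mul_cos_sq (hup.trans (by linarith [Real.pi_gt_three]))
  have hsq : (κ / 3) ^ 2 ≤ (w * Real.log (1 - a)) ^ 2 := by
    rw [← neg_sq (w * Real.log (1 - a))]
    -- Since 1 ≤ w and d ≤ 2 w, the denominator 1 + d is at most 3 w.
    have h3 : κ / 3 ≤ w * (κ / (1 + d)) := by
      rw [mul_div_assoc', div_le_div_iff₀ (by norm_num) (by linarith)]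
      nlinarith
    have h4 : w * (κ / (1 + d)) ≤ w * (-Real.log (1 - a)) := by gcongr; linarith
    have : κ / 3 ≤ -(w * Real.log (1 - a)) := by linarith
    gcongr
  have := mul_le_mul_of_nonneg_left hsq (show 0 ≤ 2 / Real.pi ^ 2 by positivity)
  linarith

/-- The real part of the exponent grows at least like a power of the frequency. -/
lemma le_integral_re_meanDefect (hν : ∀ᵐ t ∂ν, t ∈ Ioc (0 : ℝ) 1) (hZ0 : 0 < Z 1)
    (hZmono : ∀ d, 1 ≤ d → Z 1 ≤ Z d) (hZ1 : ∀ d, 0 < d → Z d ≤ 1) :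
    ∃ c : ℝ, 0 < c ∧ ∀ w : ℝ, 1 ≤ w →
      IntegrableOn (fun v => p.meanDefect Z ν w (v ^ (p.α / 2))) (Ioi 0) →
      c * w ^ p.δ ≤ ∫ v in Ioi (0 : ℝ), (p.meanDefect Z ν w (v ^ (p.α / 2))).re := by
  set κ := min (Z 1) p.ξ with hκ
  have hκ0 : 0 < κ := lt_min hZ0 p.ξ_pos
  have hδ : 0 < p.δ := div_pos two_pos p.α_pos
  have h2δ : 1 < (2 : ℝ) ^ p.δ := Real.one_lt_rpow one_lt_two hδ
  have hc0 : 0 < 2 / Real.pi ^ 2 * (κ / 3) ^ 2 := by have := Real.pi_pos; positivity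
  refine ⟨2 / Real.pi ^ 2 * (κ / 3) ^ 2 * (2 ^ p.δ - 1), mul_pos hc0 (by linarith), fun w hw hi => ?_⟩
  have hw0 : 0 < w := by linarith
  have hwδ := Real.rpow_pos_of_pos hw0 p.δ
  have hinv : ∀ y : ℝ, 0 < y → (y ^ p.δ) ^ (p.α / 2) = y := fun y hy => by
    rw [← Real.rpow_mul hy.le, δ, div_mul_div_cancel₀ p.α_pos.ne', div_self two_ne_zero, Real.rpow_one]
  -- On this window d = v^(α/2) runs from w to 2 w, and the window has length (2^δ - 1) w^δ;
  -- elsewhere the integrand is nonnegative and is dropped.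
  have hsub : Ioc (w ^ p.δ) ((2 * w) ^ p.δ) ⊆ Ioi 0 := fun v hv => hwδ.trans hv.1
  have hre : IntegrableOn (fun v => (p.meanDefect Z ν w (v ^ (p.α / 2))).re) (Ioi 0) := hi.re
  calc 2 / Real.pi ^ 2 * (κ / 3) ^ 2 * (2 ^ p.δ - 1) * w ^ p.δ
      = ∫ _ in Ioc (w ^ p.δ) ((2 * w) ^ p.δ), 2 / Real.pi ^ 2 * (κ / 3) ^ 2 := by
        rw [setIntegral_const, Real.volume_real_Ioc_of_le, Real.mul_rpow two_pos.le hw0.le, smul_eq_mul]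
        · ring
        · gcongr; linarith
    _ ≤ ∫ v in Ioc (w ^ p.δ) ((2 * w) ^ p.δ), (p.meanDefect Z ν w (v ^ (p.α / 2))).re := by
        refine setIntegral_mono_on (integrableOn_const (by simp)) (hre.mono_set hsub)
          measurableSet_Ioc fun v hv => ?_
        have h1 : w ≤ v ^ (p.α / 2) := by
          rw [← hinv w hw0]
          exact Real.rpow_le_rpow hwδ.le hv.1.le (by linarith [p.α_pos])
        have h2 : v ^ (p.α / 2) ≤ 2 * w := by
          rw [← hinv (2 * w) (by linarith)]
          exact Real.rpow_le_rpow (hsub hv).le hv.2 (by linarith [p.α_pos])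
        exact le_re_meanDefect hν hκ0 (min_le_right _ _) hw h1 h2
          ((min_le_left _ _).trans (hZmono _ (hw.trans h1))) (hZ1 _ (by linarith))
    _ ≤ _ := setIntegral_mono_set hre (Eventually.of_forall fun v => re_meanDefect_nonneg w _)
        (Filter.Eventually.of_forall hsub)

end NetworkParams

namespace MeanFieldNetwork

variable {Ω : Type*} [MeasurableSpace Ω] {P : Measure Ω} [IsProbabilityMeasure P]
  {p : NetworkParams} {S : Set Plane} {X : ℕ → Ω → Plane} {θ m : ℕ → Ω → ℝ}
  {F : StieltjesFunction ℝ}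

lemma hasSum_seriesTerm (hS : MeasurableSet S) (hnet : MeanFieldNetwork P p S X θ m)
    (hF : F = cdf (successLaw P p S X θ m)) (w : ℝ) :
    (∀ k : ℕ, IntegrableOn (p.seriesIntegrand (p.schedZ S (configLaw P X θ)) F (k + 1)) (Ioi 0)) ∧
    HasSum (fun k : ℕ => p.seriesTerm (p.schedZ S (configLaw P X θ)) F w (k + 1))
      (∫ v in Ioi (0 : ℝ), p.meanDefect (p.schedZ S (configLaw P X θ)) (successLaw P p S X θ m) w
        (v ^ (p.α / 2))) := by
  have := hnet.isProbabilityMeasure_configLaw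
  have := hnet.isProbabilityMeasure_successLaw
  have henv := hnet.ae_summable_receiver
  exact NetworkParams.hasSum_seriesTerm hF (ae_successLaw hS hnet)
    (NetworkParams.measurable_schedZ hS henv) (fun d hd => NetworkParams.schedZ_pos hS henv hd)
    (fun d hd => NetworkParams.schedZ_le_one hS henv hd) w

/-- The exponential factor is the characteristic function of the logarithm of the conditional
success probability. -/
theorem expFactor_eq (hS : MeasurableSet S) (hnet : MeanFieldNetwork P p S X θ m)
    (hF : F = cdf (successLaw P p S X θ m)) (w : ℝ) :
    p.expFactor (p.schedZ S (configLaw P X θ)) F w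
      = ∫ ω, Complex.exp (Complex.I * (w * Real.log (typicalSuccess P p S X θ m ω))) ∂P := by
  rw [(charFun_log_typicalSuccess hS hnet w).2, p.integral_comp_relLoss,
    ← (hasSum_seriesTerm hS hnet hF w).2.tsum_eq, NetworkParams.expFactor, ← Complex.exp_add,
    NetworkParams.noiseExponent, Complex.real_smul]
  congr 1
  push_cast
  ring

/-- For w ≥ 1 the real part of the exponent is at most a negative multiple of w^δ, a stretched
exponential decay; for smaller w the trivial bound 1 for a characteristic function suffices. -/
lemma integrableOn_expFactor (hS : MeasurableSet S) (hnet : MeanFieldNetwork P p S X θ m)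
    (hF : F = cdf (successLaw P p S X θ m)) :
    IntegrableOn (p.expFactor (p.schedZ S (configLaw P X θ)) F) (Ioi 0) := by
  have := hnet.isProbabilityMeasure_configLaw
  have := hnet.isProbabilityMeasure_successLaw
  have henv := hnet.ae_summable_receiver
  set Z := p.schedZ S (configLaw P X θ) with hZ
  set ν := successLaw P p S X θ m with hν
  have hδ : 0 < p.δ := div_pos two_pos p.α_pos
  obtain ⟨c, hc, hcw⟩ := NetworkParams.le_integral_re_meanDefect (p := p) (Z := Z)
    (ae_successLaw hS hnet) (NetworkParams.schedZ_pos hS henv one_pos)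
    (fun d hd => NetworkParams.schedZ_mono hS henv one_pos hd)
    (fun d hd => NetworkParams.schedZ_le_one hS henv hd)
  set b := p.lam * (Real.pi * p.r ^ 2 * p.T ^ p.δ) with hb
  have hb0 : 0 < b := by
    have := p.lam_pos; have := Real.pi_pos; have := p.r_pos
    have := Real.rpow_pos_of_pos p.T_pos p.δ
    positivity
  have hlogm : AEMeasurable (fun ω => Real.log (typicalSuccess P p S X θ m ω)) P :=
    Real.measurable_log.comp_aemeasurable hnet.aemeasurable_typicalSuccess
  have hle1 : ∀ w, ‖p.expFactor Z F w‖ ≤ 1 := fun w => by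
    rw [expFactor_eq hS hnet hF]
    refine (norm_integral_le_of_norm_le_const (C := 1) (Eventually.of_forall fun ω => ?_)).trans (by simp)
    rw [mul_comm Complex.I, ← Complex.ofReal_mul, Complex.norm_exp_ofReal_mul_I]
  -- Measurability in w is inherited from the characteristic function rather than taken from the
  -- series.
  have hmeas : Measurable (p.expFactor Z F) := by
    have h : p.expFactor Z F
        = charFun (P.map fun ω => Real.log (typicalSuccess P p S X θ m ω)) := by
      ext w
      rw [expFactor_eq hS hnet hF, charFun_apply_real, integral_map hlogm (by fun_prop)]
      congr 1; ext ω
      rw [mul_comm]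
    rw [h]
    exact measurable_charFun
  have hdecay : ∀ w, 1 ≤ w → ‖p.expFactor Z F w‖ ≤ Real.exp (-(b * c) * w ^ p.δ) := by
    intro w hw
    obtain ⟨hi, he⟩ := charFun_log_typicalSuccess hS hnet w
    have hi2 := (p.integrable_comp_relLoss_iff _).1 hi
    rw [expFactor_eq hS hnet hF, he, p.integral_comp_relLoss, norm_mul,
      show -(Complex.I * w * p.noiseExponent) = ((-(w * p.noiseExponent) : ℝ) : ℂ) * Complex.I by
        push_cast; ring, Complex.norm_exp_ofReal_mul_I, one_mul, Complex.norm_exp, Complex.real_smul,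
      ← mul_assoc, ← Complex.ofReal_mul, Complex.neg_re, Complex.re_ofReal_mul]
    have hre := Complex.reCLM.integral_comp_comm hi2
    simp only [Complex.reCLM_apply] at hre
    rw [← hre]
    refine Real.exp_le_exp.2 ?_
    have := mul_le_mul_of_nonneg_left (hcw w hw hi2) hb0.le
    linarith
  have hdom := integrableOn_rpow_mul_exp_neg_mul_rpow (s := 0) (by norm_num) hδ (mul_pos hb0 hc)
  -- The constant exp (b c) lifts the majorant to at least 1 for w ≤ 1, so that one function
  -- dominates on the whole half-line.
  refine (Integrable.const_mul hdom (Real.exp (b * c))).mono' hmeas.aestronglyMeasurable ?_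
  refine (ae_restrict_mem measurableSet_Ioi).mono fun w hw => ?_
  rw [Real.rpow_zero, one_mul]
  have hbc := mul_pos hb0 hc
  rcases le_total 1 w with h1 | h1
  · refine (hdecay w h1).trans (le_mul_of_one_le_left (Real.exp_pos _).le (Real.one_le_exp hbc.le))
  · refine (hle1 w).trans ?_
    rw [← Real.exp_add]
    refine Real.one_le_exp ?_
    have h2 := Real.rpow_le_one (mem_Ioi.1 hw).le h1 hδ.le
    nlinarith

/-- Inversion is applied to the law of log μ₀ at the point log u: u^(-iw) is exp (-iw log u), and
taking logarithms preserves the event μ₀ ≤ u because μ₀ > 0 almost surely. -/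
theorem cdf_typicalSuccess (hS : MeasurableSet S) (hnet : MeanFieldNetwork P p S X θ m)
    (hF : F = cdf (successLaw P p S X θ m)) {u : ℝ} (hu : 0 < u) :
    IntegrableOn (p.inversionIntegrand (p.schedZ S (configLaw P X θ)) F u) (Ioi 0) ∧
    F u = 1 / 2 - ∫ w in Ioi 0, p.inversionIntegrand (p.schedZ S (configLaw P X θ)) F u w := by
  have := hnet.isProbabilityMeasure_successLaw
  have hlogm : AEMeasurable (fun ω => Real.log (typicalSuccess P p S X θ m ω)) P :=
    Real.measurable_log.comp_aemeasurable hnet.aemeasurable_typicalSuccess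
  set L := P.map fun ω => Real.log (typicalSuccess P p S X θ m ω) with hL
  have : IsProbabilityMeasure L := Measure.isProbabilityMeasure_map hlogm
  have hint : Integrable (fun x : ℝ => x) L :=
    (integrable_map_measure measurable_id.aestronglyMeasurable hlogm).2
      (integrable_log_typicalSuccess hS hnet)
  have hφ : ∀ w : ℝ, p.expFactor (p.schedZ S (configLaw P X θ)) F w
      = ∫ x : ℝ, Complex.exp (Complex.I * (w * x)) ∂L := fun w => by
    rw [expFactor_eq hS hnet hF, hL, integral_map hlogm (by fun_prop)]
  have h := cdf_inversion L _ hφ hint (integrableOn_expFactor hS hnet hF) (Real.log u)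
  have hI : p.inversionIntegrand (p.schedZ S (configLaw P X θ)) F u = fun w : ℝ =>
      (Complex.exp (-(Complex.I * w * Real.log u)) *
        p.expFactor (p.schedZ S (configLaw P X θ)) F w).im / (Real.pi * w) := by
    ext w
    rw [NetworkParams.inversionIntegrand, Complex.cpow_def_of_ne_zero (by exact_mod_cast hu.ne'),
      ← Complex.ofReal_log hu.le]
    congr 4; ring
  have hFu : F u = L.real (Iic (Real.log u)) := by
    rw [hF, cdf_eq_real, successLaw, map_measureReal_apply_of_aemeasurable
      hnet.aemeasurable_typicalSuccess measurableSet_Iic, hL,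
      map_measureReal_apply_of_aemeasurable hlogm measurableSet_Iic]
    refine measureReal_congr ?_
    filter_upwards [typicalSuccess_mem hS hnet] with ω hω
    exact propext (Real.log_le_log_iff hω.1 hu).symm
  rw [hI, hFu]
  exact h

end MeanFieldNetwork
end

theorem theorem3 {Ω : Type*} [MeasurableSpace Ω] (P : Measure Ω) [IsProbabilityMeasure P]
    (p : NetworkParams) (S : Set Plane) (hS : MeasurableSet S)
    (X : ℕ → Ω → Plane) (θ m : ℕ → Ω → ℝ) (hnet : MeanFieldNetwork P p S X θ m)
    (Z : ℝ → ℝ) (hZ : Z = p.schedZ S (configLaw P X θ))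
    (F : StieltjesFunction ℝ) (hF : F = cdf (P.map (typicalSuccess P p S X θ m))) :
    (∀ᵐ ω ∂P, Tendsto
      (p.successProbAt S (configLaw P X θ) (fun j => X j ω) (fun j => m j ω)) atTop
      (𝓝 (typicalSuccess P p S X θ m ω))) ∧
    (∀ k : ℕ, 1 ≤ k → IntegrableOn (p.seriesIntegrand Z F k) (Ioi 0)) ∧
    (∀ w : ℝ, 0 < w → Summable fun k : ℕ => p.seriesTerm Z F w (k + 1)) ∧
    ∀ u : ℝ, 0 < u →
      IntegrableOn (p.inversionIntegrand Z F u) (Ioi 0) ∧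
      F u = 1 / 2 - ∫ w in Ioi 0, p.inversionIntegrand Z F u w := by
  subst hZ
  refine ⟨(MeanFieldNetwork.ae_tendsto_successProbAt hS hnet).mono fun ω h => h.1, fun k hk => ?_,
    fun w _ => (MeanFieldNetwork.hasSum_seriesTerm hS hnet hF w).2.summable,
    fun u hu => MeanFieldNetwork.cdf_typicalSuccess hS hnet hF hu⟩
  obtain ⟨k, rfl⟩ := Nat.exists_eq_add_of_le' hk
  -- The integrands in v do not involve the frequency, so any value serves.
  exact (MeanFieldNetwork.hasSum_seriesTerm hS hnet hF 0).1 k
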